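/- Setting. Let $(\psi_k)_{k\ge 0}$ be the Fock (normalized Hermite function) basis of $L^2(\mathbb R)$. For a density operator $\rho$ on $L^2(\mathbb R)$ (positive, self-adjoint, trace one) write $\rho_{j,k}=\langle\psi_j,\rho\psi_k\rangle$, $\|\tau\|^2=\sum_{j,k}|\tau_{j,k}|^2$, and let the energy of $\rho$ be $\tfrac12+\sum_j j\rho_{j,j}$. One observes independent $Y_1,\dots,Y_n$, $Y_l=(X_l,\phi_l)\in\mathbb R\times[0,\pi)$, with density $$p_\rho(x,\phi)=\sum_{j,k\ge 0}\rho_{j,k}\psi_j(x)\psi_k(x)e^{-i(j-k)\phi}$$ with respect to $dx\,d\phi/\pi$. Let $f_{j,k}=f_{k,j}$ be the real pattern functions, for $j\le k$ $$f_{j,k}(x)=\sqrt{\tfrac{j!}{k!}}\int_{-\infty}^{\infty}|r|\,(-ir)^{k-j}e^{-r^2/2}L_j^{k-j}(r^2)\,e^{i\sqrt2\,rx}\,dr ,$$ with $L_j^d$ the generalized Laguerre polynomials; they satisfy $\rho_{j,k}=\iint p_\rho(x,\phi) f_{j,k}(x)e^{i(j-k)\phi}\,dx\,d\phi/\pi$.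 With $E_{j,k}=|\psi_j\rangle\langle\psi_k|$, let $e_{j,k}=(E_{j,k}+E_{k,j})/\sqrt2$ if $j<k$, $e_{j,k}=i(E_{k,j}-E_{j,k})/\sqrt2$ if $k<j$, $e_{j,j}=E_{j,j}$, with dual functions $\tilde f_{j,k}(x,\phi)=\sqrt2 f_{j,k}(x)\cos((j-k)\phi)$ if $j<k$, $\sqrt2 f_{k,j}(x)\sin((k-j)\phi)$ if $k<j$, and $\tilde f_{j,j}=f_{j,j}$. Put $\hat\rho_i=\frac1n\sum_{l=1}^n\tilde f_i(Y_l)$ and $M_i=\sup\tilde f_i-\inf\tilde f_i$ over $\mathbb R\times[0,\pi]$ ($i\in\mathbb N^2$). Penalized estimator. Let $\varepsilon>0$ and let $(x_i)_{i\in\mathbb N^2}$ be positive numbers with $\sum_i e^{-x_i}\le\sigma<\infty$ and $x_{j,k}\le A\ln(j+k+2)$. Let $\mathcal M$ be a collection of finite subsets of $\mathbb N^2$ that contains all squares $\mathcal I_N=\{(j,k):j<N,\,k<N\}$, $N\ge1$. For $m\in\mathcal M$ let $\hat\rho_m=\sum_{i\in m}\hat\rho_ie_i$ and $$\mathrm{pen}_n(m)=\sum_{i\in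 m}(1+\varepsilon)\Big(\ln M_i+\frac{x_i}2\Big)\frac{M_i^2}{n}.$$ The estimator is $\hat\rho^{(n)}=\hat\rho_{\hat m}$, where $\hat m=\hat m(Y_1,\dots,Y_n)$ is a (measurable) minimizer over $m\in\mathcal M$ of $\gamma_n(\hat\rho_m)+\mathrm{pen}_n(m)$, with $\gamma_n(\tau)=\|\tau\|^2-2\sum_i\tau_i\hat\rho_i$ for $\tau=\sum_i\tau_ie_i$. Theorem. 1. There is a constant $C$ such that $\sum_{j,k=0}^N\|f_{j,k}\|_\infty^2\le C N^{7/3}$ for all $N\ge1$. 2. If $\rho$ has energy at most $H+\frac12$, $H\ge0$, and $N\ge1$, then the squared distance $d^2(\rho,N)$ from $\rho$ to the real span of $\{e_i:i\in\mathcal I_N\}$ satisfies $d^2(\rho,N)\le 2H/N$. 3. For all $\varepsilon>0$, $\sigma$, $A$ and $h_0>1$ there is a constant $C$, depending only on these four numbers, such that for every $(x_i)$ and $\mathcal M$ as above, every $n\ge2$, every selector $\hat m$ as above, every $H\ge h_0$ and every density operator $\rho$ with energy at most $H+\frac12$, $$\mathbb E\,\|\hat\rho^{(n)}-\rho\|^2\le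 C\,H^{7/10}\ln(H)\,n^{-3/10}\ln(n).$$ -/

import Mathlib

open MeasureTheory ProbabilityTheory
open scoped ENNReal

noncomputable section

namespace Homodyne

/-! ### The Fock basis of `L²(ℝ)` -/

/-- The `k`-th Hermite function `ψ_k(x) = H_k(x) e^{-x²/2}`, with `H_k` the `k`-th (physicists')
Hermite polynomial normalized so that `‖ψ_k‖₂ = 1`. In terms of the probabilists' polynomial
`He_k = Polynomial.hermite k` it is `(k! √π)^{-1/2} He_k(√2 x) e^{-x²/2}`. -/
def psi (k : ℕ) (x : ℝ) : ℝ :=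
  (Real.sqrt (k.factorial * Real.sqrt Real.pi))⁻¹ *
    Polynomial.aeval (Real.sqrt 2 * x) (Polynomial.hermite k) * Real.exp (-x ^ 2 / 2)

theorem continuous_psi (k : ℕ) : Continuous (psi k) := by
  unfold psi
  have h : Continuous fun x : ℝ =>
      Polynomial.aeval (Real.sqrt 2 * x) (Polynomial.hermite k) :=
    (Polynomial.continuous_aeval (Polynomial.hermite k)).comp (continuous_const.mul continuous_id)
  exact (continuous_const.mul h).mul (by fun_prop)

theorem integrable_poly_mul_gaussian (p : Polynomial ℝ) :
    Integrable (fun x : ℝ => p.eval x * Real.exp (-(1 : ℝ) * x ^ 2)) := by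
  induction p using Polynomial.induction_on' with
  | add p q hp hq =>
    refine (hp.add hq).congr (Filter.Eventually.of_forall fun x => ?_)
    simp [add_mul]
  | monomial n a =>
    have h := (integrable_rpow_mul_exp_neg_mul_sq (b := 1) one_pos (s := (n : ℝ))
      (by have : (0 : ℝ) ≤ n := Nat.cast_nonneg n
          linarith)).const_mul a
    simpa [Real.rpow_natCast, mul_assoc] using h

theorem memLp_psi (k : ℕ) : MemLp (fun x => (psi k x : ℂ)) 2 (volume : Measure ℝ) := by
  have h : MemLp (psi k) 2 (volume : Measure ℝ) := by
    rw [memLp_two_iff_integrable_sq (continuous_psi k).aestronglyMeasurable]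
    have hI := (integrable_poly_mul_gaussian
      ((((Polynomial.hermite k).map (Int.castRingHom ℝ)).comp
        (Polynomial.C (Real.sqrt 2) * Polynomial.X)) ^ 2)).const_mul
      ((Real.sqrt (k.factorial * Real.sqrt Real.pi))⁻¹ ^ 2)
    refine hI.congr (Filter.Eventually.of_forall fun x => ?_)
    have he : Real.exp (-(1 : ℝ) * x ^ 2) = Real.exp (-x ^ 2 / 2) ^ 2 := by
      rw [← Real.exp_nat_mul]
      congr 1
      push_cast
      ring
    have hp : Polynomial.eval (Real.sqrt 2 * x)
        ((Polynomial.hermite k).map (Int.castRingHom ℝ))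
        = Polynomial.aeval (Real.sqrt 2 * x) (Polynomial.hermite k) := by
      rw [Polynomial.eval_map, Polynomial.aeval_def]
      rfl
    simp only [Polynomial.eval_pow, Polynomial.eval_comp, Polynomial.eval_mul,
      Polynomial.eval_C, Polynomial.eval_X, psi, he, hp]
    ring
  exact h.ofReal

/-- The Hilbert space `L²(ℝ) = L²(ℝ; ℂ)`. -/
abbrev L2R : Type := Lp ℂ 2 (volume : Measure ℝ)

/-- The Fock vector `ψ_k ∈ L²(ℝ)`. -/
def fock (k : ℕ) : L2R := (memLp_psi k).toLp (fun x => (psi k x : ℂ))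

/-! ### States -/

/-- The matrix entry `ρ_{j,k} = ⟨ψ_j, ρ ψ_k⟩` in the Fock basis. -/
def entry (T : L2R →L[ℂ] L2R) (j k : ℕ) : ℂ := inner ℂ (fock j) (T (fock k))

/-- Density operators: positive self-adjoint operators of trace one (the trace of a positive
operator is computed in the Fock basis). -/
structure IsDensityOperator (ρ : L2R →L[ℂ] L2R) : Prop where
  isPositive : ρ.IsPositive
  trace_eq_one : HasSum (fun k => entry ρ k k) 1

/-- The energy `∑_j (j + 1/2) ρ_{j,j}`, which is `1/2 + ∑_j j ρ_{j,j}` for a trace-one `ρ`;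
it may be infinite. -/
def energy (ρ : L2R →L[ℂ] L2R) : ℝ≥0∞ :=
  ∑' j : ℕ, ENNReal.ofReal (((j : ℝ) + 1 / 2) * (entry ρ j j).re)

/-- The squared `L²` (Hilbert-Schmidt) norm `‖T‖₂² = ∑_{j,k} |T_{j,k}|²`; it may be infinite. -/
def hsSq (T : L2R →L[ℂ] L2R) : ℝ≥0∞ :=
  ∑' i : ℕ × ℕ, ENNReal.ofReal (‖entry T i.1 i.2‖ ^ 2)

/-! ### The law of the data -/

/-- `p_ρ(x, φ) = ∑_{j,k} ρ_{j,k} ψ_j(x) ψ_k(x) e^{-i(j-k)φ}`. -/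
def density (ρ : L2R →L[ℂ] L2R) (y : ℝ × ℝ) : ℝ :=
  (∑' i : ℕ × ℕ, entry ρ i.1 i.2 * (psi i.1 y.1 : ℂ) * (psi i.2 y.1 : ℂ) *
    Complex.exp (-Complex.I * ((i.1 : ℂ) - (i.2 : ℂ)) * (y.2 : ℂ))).re

/-- The law of one observation `(X, φ)` on `ℝ × [0, π)`: the phase is uniform on `[0, π)` and
`p_ρ` is the density with respect to `dx dφ / π`. -/
def law (ρ : L2R →L[ℂ] L2R) : Measure (ℝ × ℝ) :=
  ((volume : Measure ℝ).prod
    (ENNReal.ofReal (Real.pi⁻¹) • (volume : Measure ℝ).restrict (Set.Ico 0 Real.pi))).withDensity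
      (fun y => ENNReal.ofReal (density ρ y))

/-! ### Pattern functions -/

/-- The generalized Laguerre polynomial
`L_j^d(s) = ∑_{i ≤ j} (-1)^i binom(j+d, j-i) s^i / i!`. -/
def laguerre (j d : ℕ) (s : ℝ) : ℝ :=
  ∑ i ∈ Finset.range (j + 1),
    (-1 : ℝ) ^ i * ((j + d).choose (j - i) : ℝ) * s ^ i / (i.factorial : ℝ)

/-- The pattern function `f_{j,j+d}`, namely
`√(j!/(j+d)!) ∫ |r| (-i r)^d e^{-r²/2} L_j^d(r²) e^{i√2 r x} dr`. By the symmetry `r ↦ -r` the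
integral is real, with `(-i)^d e^{i√2 r x}` replaced by its real part `cos(√2 r x - dπ/2)`. The
scaling is the one for which `∫ f_{j,j+d} ψ_m ψ_{m+d} = δ_{j,m}`. -/
def patternAux (j d : ℕ) (x : ℝ) : ℝ :=
  Real.sqrt ((j.factorial : ℝ) / ((j + d).factorial : ℝ)) *
    ∫ r : ℝ, |r| * r ^ d * Real.exp (-r ^ 2 / 2) * laguerre j d (r ^ 2) *
      Real.cos (Real.sqrt 2 * r * x - d * (Real.pi / 2))

/-- The pattern function `f_{j,k} = f_{k,j}`, so that
`ρ_{j,k} = ∫∫ p_ρ(x, φ) f_{j,k}(x) e^{i(j-k)φ} dx dφ/π`. -/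
def pattern (j k : ℕ) (x : ℝ) : ℝ := patternAux (min j k) (max j k - min j k) x

/-- The orthonormal basis `e_{j,k}` of the self-adjoint Hilbert-Schmidt operators, with
`E_{j,k} = |ψ_j⟩⟨ψ_k|`: `(E_{j,k} + E_{k,j})/√2` if `j < k`, `i (E_{k,j} - E_{j,k})/√2` if `k < j`,
and `E_{j,j}` if `j = k`. -/
def basisOp (i : ℕ × ℕ) : L2R →L[ℂ] L2R :=
  let E : ℕ → ℕ → (L2R →L[ℂ] L2R) := fun a b => InnerProductSpace.rankOne ℂ (fock a) (fock b)
  if i.1 < i.2 then ((Real.sqrt 2 : ℂ)⁻¹) • (E i.1 i.2 + E i.2 i.1)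
  else if i.2 < i.1 then (Complex.I * (Real.sqrt 2 : ℂ)⁻¹) • (E i.2 i.1 - E i.1 i.2)
  else E i.1 i.1

/-- The dual functions `f̃_{j,k}(x, φ)` of the basis `e_{j,k}`: `√2 Re F_{j,k}` if `j < k`,
`√2 Im F_{k,j}` if `k < j` and `F_{j,j}` if `j = k`, where
`F_{j,k}(x, φ) = f_{j,k}(x) e^{i(j-k)φ}`. -/
def dualFun (i : ℕ × ℕ) (y : ℝ × ℝ) : ℝ :=
  if i.1 < i.2 then
    Real.sqrt 2 * (pattern i.1 i.2 y.1 * Real.cos (((i.1 : ℝ) - (i.2 : ℝ)) * y.2))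
  else if i.2 < i.1 then
    Real.sqrt 2 * (pattern i.2 i.1 y.1 * Real.sin (((i.2 : ℝ) - (i.1 : ℝ)) * y.2))
  else pattern i.1 i.1 y.1

/-- `M_i = sup f̃_i - inf f̃_i` over `ℝ × [0, π]`. -/
def osc (i : ℕ × ℕ) : ℝ :=
  sSup (dualFun i '' (Set.univ ×ˢ Set.Icc 0 Real.pi)) -
    sInf (dualFun i '' (Set.univ ×ˢ Set.Icc 0 Real.pi))

/-! ### Penalized projection estimators -/

/-- The empirical coefficient `ρ̂_i = (1/n) ∑_k f̃_i(X_k, φ_k)`. -/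
def empCoeff {n : ℕ} (y : Fin n → ℝ × ℝ) (i : ℕ × ℕ) : ℝ :=
  (1 / (n : ℝ)) * ∑ k, dualFun i (y k)

/-- The element `∑_{i ∈ m} τ_i e_i` of the model spanned by the `e_i`, `i ∈ m`. -/
def modelOp (m : Finset (ℕ × ℕ)) (τ : ℕ × ℕ → ℝ) : L2R →L[ℂ] L2R :=
  ∑ i ∈ m, (τ i : ℂ) • basisOp i

/-- The projection estimator `ρ̂_m = ∑_{i ∈ m} ρ̂_i e_i`. -/
def projEst {n : ℕ} (y : Fin n → ℝ × ℝ) (m : Finset (ℕ × ℕ)) : L2R →L[ℂ] L2R :=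
  modelOp m (empCoeff y)

/-- The empirical contrast `γ_n(τ) = ‖τ‖² - 2 ∑_i τ_i ρ̂_i` of `τ = ∑_{i ∈ m} τ_i e_i`. -/
def empContrast {n : ℕ} (y : Fin n → ℝ × ℝ) (m : Finset (ℕ × ℕ)) (τ : ℕ × ℕ → ℝ) : ℝ :=
  ∑ i ∈ m, τ i ^ 2 - 2 * ∑ i ∈ m, τ i * empCoeff y i

/-- The deterministic (Hoeffding) penalty
`pen_n(m) = ∑_{i ∈ m} (1 + ε) (ln M_i + x_i / 2) M_i² / n`. -/
def penalty (ε : ℝ) (w : ℕ × ℕ → ℝ) (n : ℕ) (m : Finset (ℕ × ℕ)) : ℝ :=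
  ∑ i ∈ m, (1 + ε) * (Real.log (osc i) + w i / 2) * (osc i ^ 2 / (n : ℝ))

/-- `mhat` is a measurable model selector that, on every sample, minimizes the penalized empirical
contrast `γ_n(ρ̂_m) + pen_n(m)` over the collection of models `models`. -/
structure IsPenalizedSelector (ε : ℝ) (w : ℕ × ℕ → ℝ) (models : Set (Finset (ℕ × ℕ))) (n : ℕ)
    (mhat : (Fin n → ℝ × ℝ) → Finset (ℕ × ℕ)) : Prop where
  measurableSet_eq : ∀ m, MeasurableSet {y | mhat y = m}
  mem : ∀ y, mhat y ∈ models
  le : ∀ y, ∀ m ∈ models,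
    empContrast y (mhat y) (empCoeff y) + penalty ε w n (mhat y) ≤
      empContrast y m (empCoeff y) + penalty ε w n m

/-- The square model `I_N = {(j,k) : j < N, k < N}`. -/
def squareModel (N : ℕ) : Finset (ℕ × ℕ) := Finset.range N ×ˢ Finset.range N

/-- The squared distance `d²(ρ, m)` from `ρ` to the real span of the `e_i`, `i ∈ m`. -/
def biasSq (ρ : L2R →L[ℂ] L2R) (m : Finset (ℕ × ℕ)) : ℝ≥0∞ :=
  ⨅ τ : ℕ × ℕ → ℝ, hsSq (ρ - modelOp m τ)

end Homodyne

end

/-!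
Why the three assertions hold.

**Growth of the pattern functions.** The Hermite functions solve `y'' = (x² - (2k+1)) y` and decay at
infinity. Energy and WKB functionals of this equation (`DecayingSolution`) give
`‖ψ_k‖_∞² = O(k^{-1/6})`, the amplitude bound `ψ_k² = O(|x² - (2k+1)|^{-1/2})`, and bounds on `ψ_k'`
and `ψ_k''`. Two Hermite functions of different degree have distinct turning points, hence sup norm
bounds for `g = ψ_j ψ_k` and `g''` (`psi_mul_psi_sq_le`, `psiMulD2_sq_le`). The Fourier transform of
`g` is a Laguerre function (`overlap_eq_ell`), so that `f_{j,k}` is a multiple of `|d/dx| g`, which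
can be written as `∫ (2 g(x) - g(x+h) - g(x-h)) h⁻² dh` (`cosConst_mul_patternAux`). Such an integral
is at most a multiple of `(‖g‖_∞ ‖g''‖_∞)^{1/2}` (`abs_integral_second_difference_le`). This gives
`‖f_{j,k}‖_∞² = O((j+1)^{-1/6} (k-j+1)^{-1/4} (k+1)^{3/4})` for `j ≤ k`, and the sum over a square of
side `N` is `O(N^{7/3})`.

**Bias.** Positivity gives `|ρ_{j,k}|² ≤ ρ_{j,j} ρ_{k,k}`, so the part of `ρ` outside the square has
squared norm at most `2 ∑_{j ≥ N} ρ_{j,j}`, which Markov's inequality bounds by `2 H / N`.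

**Risk.** In the basis `e_i` the loss is a sum over the coordinates (`hsSq_projEst_sub`). The
estimated coefficients are unbiased: biorthogonality of the pattern functions and the products
`ψ_l ψ_m` proves this for the truncated densities, and Fatou's lemma carries it over to `p_ρ`, whose
total mass is one because it is the density of the law of the data (`integral_dualFun_law`). The
`M_i` are at least one (`one_le_osc`), so the penalty is nonnegative, and Hoeffding's inequality
bounds the expected excess of `(ρ̂_i - ρ_i)²` over `(ln M_i + x_i / 2) M_i² / n` by `e^{-x_i} / n`. The
oracle inequality is then checked coordinate by coordinate (`coordinate_oracle_le`): up to a constant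
depending on `ε`, the risk is at most `H / N + pen_n(I_N) + σ / n` for every `N`. By the first part
the penalty is `O(N^{7/3} ln N / n)`, and `N = ⌈(H n)^{3/10}⌉` balances it against the bias.
-/

namespace Homodyne

/-! ### Hermite functions: ladder relations and decay -/

open Polynomial in
theorem derivative_hermite_succ (n : ℕ) :
    derivative (hermite (n + 1)) = ((n + 1 : ℕ) : ℤ[X]) * hermite n := by
  induction n with
  | zero => simp [hermite_succ]
  | succ n ih =>
    rw [hermite_succ (n + 1), derivative_sub, derivative_mul, ih, derivative_X,
      derivative_natCast_mul, hermite_succ n]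
    push_cast
    ring

/-- The normalizing constant `(k! √π)^{-1/2}` of the `k`-th Hermite function. -/
noncomputable def psiNorm (k : ℕ) : ℝ := (Real.sqrt (k.factorial * Real.sqrt Real.pi))⁻¹

theorem sqrt_succ_mul_psiNorm (k : ℕ) : Real.sqrt (k + 1) * psiNorm (k + 1) = psiNorm k := by
  have h : ((k + 1).factorial : ℝ) * Real.sqrt Real.pi
      = ((k : ℝ) + 1) * (k.factorial * Real.sqrt Real.pi) := by
    rw [Nat.factorial_succ]; push_cast; ring
  have h1 : Real.sqrt ((k : ℝ) + 1) ≠ 0 := by positivity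
  unfold psiNorm
  rw [h, Real.sqrt_mul (by positivity), mul_inv, mul_inv_cancel_left₀ h1]

theorem psi_eq (k : ℕ) (x : ℝ) : psi k x =
    psiNorm k * Polynomial.aeval (Real.sqrt 2 * x) (Polynomial.hermite k) *
      Real.exp (-x ^ 2 / 2) := rfl

/-- The derivative of the Hermite function `ψ_k`, written with the annihilation operator. -/
noncomputable def dpsi (k : ℕ) (x : ℝ) : ℝ := Real.sqrt (2 * k) * psi (k - 1) x - x * psi k x

theorem hasDerivAt_gaussian (x : ℝ) :
    HasDerivAt (fun x : ℝ => Real.exp (-x ^ 2 / 2)) (-x * Real.exp (-x ^ 2 / 2)) x := by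
  have h : HasDerivAt (fun x : ℝ => -x ^ 2 / 2) (-x) x := by
    have := ((hasDerivAt_pow 2 x).neg).div_const 2
    exact this.congr_deriv (by push_cast; ring)
  exact h.exp.congr_deriv (mul_comm _ _)

theorem hasDerivAt_psi_aux (k : ℕ) (x : ℝ) :
    HasDerivAt (psi k) (psiNorm k * (Real.sqrt 2 *
      Polynomial.aeval (Real.sqrt 2 * x) (Polynomial.derivative (Polynomial.hermite k))) *
        Real.exp (-x ^ 2 / 2) - x * psi k x) x := by
  have h1 : HasDerivAt (fun x : ℝ => Real.sqrt 2 * x) (Real.sqrt 2) x := by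
    simpa using (hasDerivAt_id x).const_mul (Real.sqrt 2)
  have h2 := ((Polynomial.hermite k).hasDerivAt_aeval (Real.sqrt 2 * x)).comp x h1
  have h3 := (h2.const_mul (psiNorm k)).mul (hasDerivAt_gaussian x)
  refine h3.congr_deriv ?_
  rw [psi_eq]
  simp only [Function.comp_apply]
  ring

theorem hasDerivAt_psi (k : ℕ) (x : ℝ) : HasDerivAt (psi k) (dpsi k x) x := by
  refine (hasDerivAt_psi_aux k x).congr_deriv ?_
  cases k with
  | zero => simp [dpsi]
  | succ k =>
    simp only [dpsi, Nat.add_sub_cancel, derivative_hermite_succ, map_mul, map_natCast]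
    rw [psi_eq k, ← sqrt_succ_mul_psiNorm k, Real.sqrt_mul (by norm_num)]
    push_cast
    have h := Real.mul_self_sqrt (show (0 : ℝ) ≤ k + 1 by positivity)
    linear_combination -(psiNorm (k + 1) * Real.sqrt 2 * Real.exp (-x ^ 2 / 2) *
      Polynomial.aeval (Real.sqrt 2 * x) (Polynomial.hermite k)) * h

/-- The creation operator: `x ψ_k - ψ_k' = √(2(k+1)) ψ_{k+1}`. -/
theorem mul_psi_sub_dpsi (k : ℕ) (x : ℝ) :
    x * psi k x - dpsi k x = Real.sqrt (2 * (k + 1)) * psi (k + 1) x := by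
  rw [(hasDerivAt_psi k x).unique (hasDerivAt_psi_aux k x), psi_eq (k + 1),
    Polynomial.hermite_succ, psi_eq k, ← sqrt_succ_mul_psiNorm k, Real.sqrt_mul (by norm_num)]
  simp only [map_sub, map_mul, Polynomial.aeval_X]
  have h := Real.mul_self_sqrt (show (0 : ℝ) ≤ 2 by positivity)
  linear_combination (-x * Real.sqrt (k + 1) * psiNorm (k + 1) *
    Polynomial.aeval (Real.sqrt 2 * x) (Polynomial.hermite k) * Real.exp (-x ^ 2 / 2)) * h

/-- The three-term recurrence of the Hermite functions. -/
theorem two_mul_psi (k : ℕ) (x : ℝ) :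
    2 * (x * psi k x) =
      Real.sqrt (2 * k) * psi (k - 1) x + Real.sqrt (2 * (k + 1)) * psi (k + 1) x := by
  rw [← mul_psi_sub_dpsi, dpsi]; ring

/-- The Schrödinger equation of the harmonic oscillator, `ψ_k'' = (x² - (2k+1)) ψ_k`. -/
theorem hasDerivAt_dpsi (k : ℕ) (x : ℝ) :
    HasDerivAt (dpsi k) ((x ^ 2 - (2 * k + 1)) * psi k x) x := by
  have h := ((hasDerivAt_psi (k - 1) x).const_mul (Real.sqrt (2 * k))).sub
    ((hasDerivAt_id x).mul (hasDerivAt_psi k x))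
  refine h.congr_deriv ?_
  cases k with
  | zero => simp [dpsi]; ring
  | succ k =>
    have h1 := mul_psi_sub_dpsi k x
    have h2 := Real.mul_self_sqrt (show (0 : ℝ) ≤ 2 * (k + 1) by positivity)
    have h3 : dpsi (k + 1) x = Real.sqrt (2 * (k + 1)) * psi k x - x * psi (k + 1) x := by
      simp [dpsi]
    simp only [Nat.add_sub_cancel, id]
    push_cast
    rw [h3]
    linear_combination -Real.sqrt (2 * (k + 1)) * h1 - psi (k + 1) x * h2

theorem psi_neg (k : ℕ) (x : ℝ) : psi k (-x) = (-1) ^ k * psi k x := by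
  induction k using Nat.twoStepInduction with
  | zero => simp [psi]
  | one =>
    simp only [psi, Polynomial.hermite_one, Polynomial.aeval_X]
    ring_nf
  | more k h0 h1 =>
    have ha := two_mul_psi (k + 1) x
    have hb := two_mul_psi (k + 1) (-x)
    have h2 : Real.sqrt (2 * ((k + 1 : ℕ) + 1)) ≠ 0 := by positivity
    apply mul_left_cancel₀ h2
    simp only [Nat.add_sub_cancel] at ha hb
    rw [h0, h1] at hb
    rw [show k + 1 + 1 = k + 2 from rfl] at ha hb
    linear_combination (-1 : ℝ) ^ (k + 2) * ha - hb

theorem tendsto_psi_atTop (k : ℕ) : Filter.Tendsto (psi k) Filter.atTop (nhds 0) := by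
  have h := (Polynomial.tendsto_div_exp_atTop
    (((Polynomial.hermite k).map (Int.castRingHom ℝ)).comp
        (Polynomial.C (Real.sqrt 2) * Polynomial.X))).const_mul (psiNorm k)
  rw [mul_zero] at h
  have h2 := h.norm.mul_const (Real.exp (1 / 2))
  simp only [norm_zero, zero_mul] at h2
  refine squeeze_zero_norm (fun x => ?_) h2
  have hp : Polynomial.eval (Real.sqrt 2 * x)
      ((Polynomial.hermite k).map (Int.castRingHom ℝ))
      = Polynomial.aeval (Real.sqrt 2 * x) (Polynomial.hermite k) := by
    rw [Polynomial.eval_map, Polynomial.aeval_def]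
    rfl
  simp only [Polynomial.eval_comp, Polynomial.eval_mul, Polynomial.eval_C, Polynomial.eval_X, hp,
    psi_eq, norm_mul, norm_div, Real.norm_eq_abs, Real.abs_exp, mul_assoc, div_mul_eq_mul_div,
    mul_div_assoc, ← Real.exp_sub]
  gcongr
  nlinarith [sq_nonneg (x - 1)]

theorem tendsto_mul_psi_atTop (k : ℕ) :
    Filter.Tendsto (fun x => x * psi k x) Filter.atTop (nhds 0) := by
  have h := (((tendsto_psi_atTop (k - 1)).const_mul (Real.sqrt (2 * k))).add
    ((tendsto_psi_atTop (k + 1)).const_mul (Real.sqrt (2 * (k + 1))))).div_const 2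
  simp only [mul_zero, add_zero, zero_div] at h
  refine h.congr fun x => ?_
  rw [← two_mul_psi]; ring

theorem tendsto_dpsi_atTop (k : ℕ) : Filter.Tendsto (dpsi k) Filter.atTop (nhds 0) := by
  have h := ((tendsto_psi_atTop (k - 1)).const_mul (Real.sqrt (2 * k))).sub
    (tendsto_mul_psi_atTop k)
  rw [mul_zero, sub_zero] at h
  exact h

/-- `ψ_k(0)² = O(k^{-1/2})`, from `(k+2) ψ_{k+2}(0)² = (k+1) ψ_k(0)²`. -/
theorem psi_zero_pow_four_le (k : ℕ) : psi k 0 ^ 4 * (k + 1) ≤ 1 := by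
  induction k using Nat.twoStepInduction with
  | zero =>
    have hpi : (1 : ℝ) ≤ Real.pi := by linarith [Real.pi_gt_three]
    have h4 : Real.sqrt (Real.sqrt Real.pi) ^ 4 = Real.pi := by
      rw [show (4 : ℕ) = 2 * 2 from rfl, pow_mul, Real.sq_sqrt (by positivity),
        Real.sq_sqrt (by positivity)]
    simp [psi, inv_pow, h4]
    exact inv_le_one_of_one_le₀ hpi
  | one => simp [psi]
  | more k h0 h1 =>
    have h := two_mul_psi (k + 1) 0
    simp only [Nat.add_sub_cancel, zero_mul, mul_zero] at h
    push_cast at h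
    rw [Real.sqrt_mul (by norm_num), Real.sqrt_mul (by norm_num)] at h
    have e1 := Real.sq_sqrt (show (0 : ℝ) ≤ (k : ℝ) + 1 by positivity)
    have e2 := Real.sq_sqrt (show (0 : ℝ) ≤ (k : ℝ) + 1 + 1 by positivity)
    have h' : Real.sqrt ((k : ℝ) + 1) * psi k 0 =
        -(Real.sqrt ((k : ℝ) + 1 + 1) * psi (k + 2) 0) := by
      have : Real.sqrt 2 ≠ 0 := by positivity
      apply mul_left_cancel₀ this
      rw [show k + 1 + 1 = k + 2 from rfl] at h
      linear_combination -h
    have hsq : ((k : ℝ) + 1) * psi k 0 ^ 2 = ((k : ℝ) + 2) * psi (k + 2) 0 ^ 2 := by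
      have := congrArg (· ^ 2) h'
      simp only [mul_pow, neg_sq, e1, e2] at this
      linear_combination this
    have hk : (0 : ℝ) ≤ k := Nat.cast_nonneg k
    have h4 : ((k : ℝ) + 1) ^ 2 * psi k 0 ^ 4 = ((k : ℝ) + 2) ^ 2 * psi (k + 2) 0 ^ 4 := by
      have := congrArg (· ^ 2) hsq
      simp only [mul_pow] at this
      linear_combination this
    push_cast
    have h5 : ((k : ℝ) + 2) ^ 2 * (psi (k + 2) 0 ^ 4 * ((k : ℝ) + 2 + 1)) ≤
        ((k : ℝ) + 2) ^ 2 * 1 := by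
      calc ((k : ℝ) + 2) ^ 2 * (psi (k + 2) 0 ^ 4 * ((k : ℝ) + 2 + 1))
          = (psi k 0 ^ 4 * (k + 1)) * (((k : ℝ) + 1) * (k + 3)) := by
            linear_combination -(k + 3 : ℝ) * h4
        _ ≤ 1 * (((k : ℝ) + 1) * (k + 3)) := by gcongr
        _ ≤ ((k : ℝ) + 2) ^ 2 * 1 := by nlinarith
    exact le_of_mul_le_mul_left h5 (by positivity)

/-! ### Uniform bounds for decaying solutions of the oscillator equation -/

/-- `y` is a solution of `y'' = (x² - ν⁶) y` that decays at `+∞`, with derivative `y'`, and whose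
initial energy `y'(0)² + ν⁶ y(0)²` is at most `c ν³`. The energy level is written as the sixth
power of a number `ν ≥ 1` so that the bounds below involve integral powers of `ν` only. -/
structure DecayingSolution (c ν : ℝ) (y y' : ℝ → ℝ) : Prop where
  one_le : 1 ≤ ν
  deriv : ∀ x, HasDerivAt y (y' x) x
  deriv' : ∀ x, HasDerivAt y' ((x ^ 2 - ν ^ 6) * y x) x
  tendsto : Filter.Tendsto y Filter.atTop (nhds 0)
  tendsto_mul : Filter.Tendsto (fun x => x * y x) Filter.atTop (nhds 0)
  tendsto' : Filter.Tendsto y' Filter.atTop (nhds 0)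
  init : y' 0 ^ 2 + ν ^ 6 * y 0 ^ 2 ≤ c * ν ^ 3

theorem antitoneOn_of_hasDerivAt_nonpos {s : Set ℝ} (hs : Convex ℝ s) {f f' : ℝ → ℝ}
    (hf : ∀ x ∈ s, HasDerivAt f (f' x) x) (hf' : ∀ x ∈ s, f' x ≤ 0) : AntitoneOn f s :=
  antitoneOn_of_hasDerivWithinAt_nonpos hs
    (fun x hx => (hf x hx).continuousAt.continuousWithinAt)
    (fun x hx => (hf x (interior_subset hx)).hasDerivWithinAt)
    (fun x hx => hf' x (interior_subset hx))

theorem nonneg_of_antitoneOn_of_tendsto {f : ℝ → ℝ} {a x : ℝ} (hf : AntitoneOn f (Set.Ici a))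
    (ht : Filter.Tendsto f Filter.atTop (nhds 0)) (hx : a ≤ x) : 0 ≤ f x := by
  refine le_of_tendsto ht ?_
  filter_upwards [Filter.eventually_ge_atTop x] with t hxt
  exact hf hx (hx.trans hxt) hxt

namespace DecayingSolution

variable {c ν : ℝ} {y y' : ℝ → ℝ}

theorem hasDerivAt_energy (h : DecayingSolution c ν y y') (x : ℝ) :
    HasDerivAt (fun x => y' x ^ 2 + (ν ^ 6 - x ^ 2) * y x ^ 2) (-2 * x * y x ^ 2) x := by
  have h1 := ((h.deriv' x).pow 2).add
    (((hasDerivAt_const x (ν ^ 6)).sub (hasDerivAt_pow 2 x)).mul ((h.deriv x).pow 2))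
  refine h1.congr_deriv ?_
  simp only [Pi.pow_apply, Pi.sub_apply]
  push_cast
  ring

theorem antitoneOn_energy (h : DecayingSolution c ν y y') :
    AntitoneOn (fun x => y' x ^ 2 + (ν ^ 6 - x ^ 2) * y x ^ 2) (Set.Ici 0) :=
  antitoneOn_of_hasDerivAt_nonpos (convex_Ici 0) (fun x _ => h.hasDerivAt_energy x)
    fun x hx => by
      have : 0 ≤ x * y x ^ 2 := mul_nonneg hx (sq_nonneg _)
      linarith

theorem energy_nonneg (h : DecayingSolution c ν y y') {x : ℝ} (hx : 0 ≤ x) :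
    0 ≤ y' x ^ 2 + (ν ^ 6 - x ^ 2) * y x ^ 2 := by
  refine nonneg_of_antitoneOn_of_tendsto
    (f := fun x => y' x ^ 2 + (ν ^ 6 - x ^ 2) * y x ^ 2) h.antitoneOn_energy ?_ hx
  have := ((h.tendsto'.pow 2).add ((h.tendsto.pow 2).const_mul (ν ^ 6))).sub (h.tendsto_mul.pow 2)
  norm_num at this
  refine this.congr fun x => ?_
  ring

theorem energy_le (h : DecayingSolution c ν y y') {x : ℝ} (hx : 0 ≤ x) :
    y' x ^ 2 + (ν ^ 6 - x ^ 2) * y x ^ 2 ≤ c * ν ^ 3 := by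
  refine (h.antitoneOn_energy (Set.mem_Ici.2 le_rfl) hx hx).trans ?_
  simpa using h.init

/-- Beyond the turning point `ν³` a decaying solution and its derivative have opposite signs. -/
theorem mul_deriv_nonpos (h : DecayingSolution c ν y y') {x : ℝ} (hx : ν ^ 3 ≤ x) :
    y x * y' x ≤ 0 := by
  have hν := h.one_le
  have := nonneg_of_antitoneOn_of_tendsto (f := fun x => -(y x * y' x)) (a := ν ^ 3)
    (x := x) ?_ ?_ hx
  · linarith
  · refine antitoneOn_of_hasDerivAt_nonpos (convex_Ici _)
      (fun x _ => ((h.deriv x).mul (h.deriv' x)).neg) fun x hx => ?_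
    have : (ν ^ 3) ^ 2 ≤ x ^ 2 := pow_le_pow_left₀ (by positivity) hx 2
    nlinarith [sq_nonneg (y' x), mul_nonneg (show 0 ≤ x ^ 2 - ν ^ 6 by nlinarith) (sq_nonneg (y x))]
  · simpa using (h.tendsto.mul h.tendsto').neg

theorem antitoneOn_sq (h : DecayingSolution c ν y y') :
    AntitoneOn (fun x => y x ^ 2) (Set.Ici (ν ^ 3)) :=
  antitoneOn_of_hasDerivAt_nonpos (convex_Ici _) (fun x _ => (h.deriv x).pow 2) fun x hx => by
    have := h.mul_deriv_nonpos hx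
    simp; nlinarith

theorem antitoneOn_deriv_sq (h : DecayingSolution c ν y y') :
    AntitoneOn (fun x => y' x ^ 2) (Set.Ici (ν ^ 3)) :=
  antitoneOn_of_hasDerivAt_nonpos (convex_Ici _) (fun x _ => (h.deriv' x).pow 2) fun x hx => by
    have h1 := h.mul_deriv_nonpos hx
    have hν := h.one_le
    have : (ν ^ 3) ^ 2 ≤ x ^ 2 := pow_le_pow_left₀ (by positivity) hx 2
    have h2 : (x ^ 2 - ν ^ 6) * (y x * y' x) ≤ 0 :=
      mul_nonpos_of_nonneg_of_nonpos (by nlinarith) h1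
    simp; nlinarith

theorem deriv_sq_le (h : DecayingSolution c ν y y') {x : ℝ} (hx : 0 ≤ x) :
    y' x ^ 2 ≤ c * ν ^ 3 := by
  have hν := h.one_le
  have key : ∀ x, 0 ≤ x → x ≤ ν ^ 3 → y' x ^ 2 ≤ c * ν ^ 3 := fun x hx hx' => by
    have : x ^ 2 ≤ (ν ^ 3) ^ 2 := pow_le_pow_left₀ hx hx' 2
    have h2 : 0 ≤ (ν ^ 6 - x ^ 2) * y x ^ 2 := mul_nonneg (by nlinarith) (sq_nonneg _)
    linarith [h.energy_le hx]
  rcases le_total x (ν ^ 3) with hx' | hx'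
  · exact key x hx hx'
  · exact (h.antitoneOn_deriv_sq (Set.mem_Ici.2 le_rfl) hx' hx').trans
      (key _ (by positivity) le_rfl)

/-- The amplitude bound in the oscillatory region, at a distance from the turning point. With
`s = √(ν⁶ - x²)`, the WKB functional `s y² + y'² / s` corrected by `-x y y' / s³` has a derivative
in which only the second-order term `-(x / s³)' y y'` survives, and `(x / s³)'` is integrable as
long as `2 x ≤ s³`. -/
theorem wkb_le (h : DecayingSolution c ν y y') {x : ℝ} (hx : 0 ≤ x) (hQ : 0 < ν ^ 6 - x ^ 2)
    (hxQ : 2 * x ≤ Real.sqrt (ν ^ 6 - x ^ 2) ^ 3) :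
    Real.sqrt (ν ^ 6 - x ^ 2) * y x ^ 2 + y' x ^ 2 / Real.sqrt (ν ^ 6 - x ^ 2) ≤ 3 * c := by
  have hν := h.one_le
  set s : ℝ → ℝ := fun t => Real.sqrt (ν ^ 6 - t ^ 2) with hs
  have hQt : ∀ t ∈ Set.Icc 0 x, ν ^ 6 - x ^ 2 ≤ ν ^ 6 - t ^ 2 := fun t ht => by
    have := pow_le_pow_left₀ ht.1 ht.2 2
    linarith
  have hspos : ∀ t ∈ Set.Icc 0 x, 0 < s t := fun t ht => Real.sqrt_pos.2 (hQ.trans_le (hQt t ht))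
  have hsle : ∀ t ∈ Set.Icc 0 x, s x ≤ s t := fun t ht => Real.sqrt_le_sqrt (hQt t ht)
  have hsd : ∀ t ∈ Set.Icc 0 x, HasDerivAt s (-t / s t) t := fun t ht => by
    have h1 := ((hasDerivAt_const t (ν ^ 6)).sub (hasDerivAt_pow 2 t)).sqrt
      (hQ.trans_le (hQt t ht)).ne'
    refine h1.congr_deriv ?_
    have := (hspos t ht).ne'
    simp only [hs, Pi.sub_apply] at this ⊢
    field_simp
    push_cast
    ring
  have hssq : ∀ t ∈ Set.Icc 0 x, s t ^ 2 = ν ^ 6 - t ^ 2 := fun t ht =>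
    Real.sq_sqrt (hQ.le.trans (hQt t ht))
  set p : ℝ → ℝ := fun t => t / s t ^ 3 with hp
  set p' : ℝ → ℝ := fun t => 1 / s t ^ 3 + 3 * t ^ 2 / s t ^ 5 with hp'
  have hpd : ∀ t ∈ Set.Icc 0 x, HasDerivAt p (p' t) t := fun t ht => by
    have hs0 := (hspos t ht).ne'
    refine ((hasDerivAt_id t).div ((hsd t ht).pow 3) (pow_ne_zero 3 hs0)).congr_deriv ?_
    simp only [hp', id]
    have : (s ^ 3) t = s t ^ 3 := rfl
    rw [this]
    field_simp
    push_cast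
    ring
  set A : ℝ → ℝ := fun t => s t * y t ^ 2 + y' t ^ 2 / s t - p t * (y t * y' t) with hA
  have hAd : ∀ t ∈ Set.Icc 0 x, HasDerivAt A (-(p' t) * (y t * y' t)) t := fun t ht => by
    have hs0 := (hspos t ht).ne'
    have h1 := (((hsd t ht).mul ((h.deriv t).pow 2)).add
      (((h.deriv' t).pow 2).div (hsd t ht) hs0)).sub ((hpd t ht).mul ((h.deriv t).mul (h.deriv' t)))
    refine h1.congr_deriv ?_
    have e1 : (y' ^ 2) t = y' t ^ 2 := rfl
    have e2 : (y ^ 2) t = y t ^ 2 := rfl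
    have e3 : (y * y') t = y t * y' t := rfl
    rw [e1, e2, e3]
    simp only [hp, hp']
    have e4 : t ^ 2 - ν ^ 6 = - s t ^ 2 := by rw [hssq t ht]; ring
    rw [e4]
    field_simp
    push_cast
    ring
  have hpbd : ∀ t ∈ Set.Icc 0 x, 0 ≤ p t ∧ p t ≤ 1 / 2 := fun t ht => by
    have h0 := hspos t ht
    refine ⟨div_nonneg ht.1 (by positivity), ?_⟩
    simp only [hp]
    rw [div_le_iff₀ (by positivity)]
    have : s x ^ 3 ≤ s t ^ 3 := pow_le_pow_left₀ (Real.sqrt_nonneg _) (hsle t ht) 3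
    linarith [ht.2]
  have hp'0 : ∀ t ∈ Set.Icc 0 x, 0 ≤ p' t := fun t ht => by
    have h0 := hspos t ht
    simp only [hp']; positivity
  have hyy : ∀ t ∈ Set.Icc 0 x, |y t * y' t| ≤ (s t * y t ^ 2 + y' t ^ 2 / s t) / 2 :=
    fun t ht => by
      have h0 := hspos t ht
      have h1 : s t * y t ^ 2 + y' t ^ 2 / s t
          = (s t * |y t| - |y' t|) ^ 2 / s t + 2 * (|y t| * |y' t|) := by
        rw [← sq_abs (y t), ← sq_abs (y' t)]
        field_simp
        ring
      have h2 : 0 ≤ (s t * |y t| - |y' t|) ^ 2 / s t := by positivity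
      rw [abs_mul]; linarith
  have hAB : ∀ t ∈ Set.Icc 0 x, (s t * y t ^ 2 + y' t ^ 2 / s t) * (3 / 4) ≤ A t := fun t ht => by
    have h1 := hyy t ht
    have h2 := hpbd t ht
    have h3 : p t * (y t * y' t) ≤ 1 / 2 * |y t * y' t| :=
      (mul_le_mul_of_nonneg_left (le_abs_self _) h2.1).trans
        (mul_le_mul_of_nonneg_right h2.2 (abs_nonneg _))
    simp only [hA]
    linarith
  have hanti : AntitoneOn (fun t => A t * Real.exp (-(2 / 3) * p t)) (Set.Icc 0 x) := by
    refine antitoneOn_of_hasDerivAt_nonpos (convex_Icc _ _)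
      (fun t ht => (hAd t ht).mul ((hpd t ht).const_mul _).exp) fun t ht => ?_
    have h1 := hyy t ht
    have h2 := hAB t ht
    have h3 : -(p' t) * (y t * y' t) ≤ p' t * (2 / 3 * A t) := by
      rw [neg_mul, ← mul_neg]
      refine mul_le_mul_of_nonneg_left ?_ (hp'0 t ht)
      linarith [neg_abs_le (y t * y' t)]
    have h4 := Real.exp_pos (-(2 / 3) * p t)
    have : -(p' t) * (y t * y' t) * Real.exp (-(2 / 3) * p t) +
        A t * (Real.exp (-(2 / 3) * p t) * (-(2 / 3) * p' t)) =
      (-(p' t) * (y t * y' t) - p' t * (2 / 3 * A t)) * Real.exp (-(2 / 3) * p t) := by ring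
    rw [this]
    exact mul_nonpos_of_nonpos_of_nonneg (by linarith) h4.le
  have hx0 : x ∈ Set.Icc 0 x := ⟨hx, le_rfl⟩
  have h0x : (0 : ℝ) ∈ Set.Icc 0 x := ⟨le_rfl, hx⟩
  have h1 := hanti h0x hx0 hx
  have hs0 : s 0 = ν ^ 3 := by
    simp only [hs]
    rw [show ν ^ 6 - 0 ^ 2 = (ν ^ 3) ^ 2 by ring, Real.sqrt_sq (by positivity)]
  have hA0 : A 0 ≤ c := by
    have h2 := h.init
    simp only [hA, hp, hs0, zero_div, zero_mul, sub_zero]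
    have h3 : ν ^ 3 * y 0 ^ 2 + y' 0 ^ 2 / ν ^ 3 = (y' 0 ^ 2 + ν ^ 6 * y 0 ^ 2) / ν ^ 3 := by
      field_simp; ring
    rw [h3, div_le_iff₀ (by positivity)]
    exact h2
  have hA0' : 0 ≤ A 0 := by
    refine le_trans ?_ (hAB 0 h0x)
    have := hspos 0 h0x
    positivity
  have h2 : Real.exp (1 / 3) ≤ 3 / 2 := by
    have := Real.exp_one_lt_d9
    have h5 : Real.exp (1 / 3) ^ 3 ≤ (3 / 2 : ℝ) ^ 3 := by
      rw [← Real.exp_nat_mul]; norm_num; linarith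
    exact le_of_pow_le_pow_left₀ (by norm_num) (by norm_num) h5
  have h3 : A x ≤ A 0 * Real.exp (1 / 3) := by
    have hp0 : p 0 = 0 := by simp [hp]
    simp only [hp0, mul_zero, Real.exp_zero, mul_one] at h1
    have h4 : A x = A x * Real.exp (-(2 / 3) * p x) * Real.exp (2 / 3 * p x) := by
      rw [mul_assoc, ← Real.exp_add]; ring_nf; simp
    rw [h4]
    refine mul_le_mul h1 (Real.exp_le_exp.2 ?_) (Real.exp_pos _).le hA0'
    linarith [(hpbd x hx0).2]
  have h4 := hAB x hx0
  have h5 : A 0 * Real.exp (1 / 3) ≤ c * (3 / 2) :=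
    mul_le_mul hA0 h2 (Real.exp_pos _).le (hA0'.trans hA0)
  simp only [hs] at h4 ⊢
  linarith

/-- The width of the transition region is of order `ν²` in the variable `ν⁶ - x²`; the minimum
makes sense of it when `ν` is close to `1`. -/
theorem sq_mul_le_of_le (h : DecayingSolution c ν y y') {x : ℝ} (hx : 0 ≤ x)
    (hQ : min (ν ^ 6) (2 * ν ^ 2) ≤ ν ^ 6 - x ^ 2) :
    Real.sqrt (ν ^ 6 - x ^ 2) * y x ^ 2 + y' x ^ 2 / Real.sqrt (ν ^ 6 - x ^ 2) ≤ 3 * c := by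
  have hν := h.one_le
  have hpos : 0 < min (ν ^ 6) (2 * ν ^ 2) := by positivity
  refine h.wkb_le hx (hpos.trans_le hQ) ?_
  have hs := Real.sq_sqrt (hpos.trans_le hQ).le
  have hs0 := Real.sqrt_nonneg (ν ^ 6 - x ^ 2)
  rcases min_le_iff.1 hQ with hQ' | hQ'
  · have : x = 0 := by nlinarith
    simp [this]
  · refine le_of_sq_le_sq (a := 2 * x) ?_ (by positivity)
    calc (2 * x) ^ 2 = 4 * x ^ 2 := by ring
      _ ≤ (2 * ν ^ 2) ^ 3 := by
        have : 0 < ν ^ 2 := by positivity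
        nlinarith [pow_pos this 3]
      _ ≤ (ν ^ 6 - x ^ 2) ^ 3 := pow_le_pow_left₀ (by positivity) hQ' 3
      _ = (Real.sqrt (ν ^ 6 - x ^ 2) ^ 3) ^ 2 := by rw [← hs, Real.sqrt_sq hs0]; ring

/-- The inner end of the transition region. -/
theorem exists_transition_point (h : DecayingSolution c ν y y') :
    ∃ x₁ : ℝ, 0 ≤ x₁ ∧ x₁ ≤ ν ^ 3 ∧ ν ^ 6 - x₁ ^ 2 = min (ν ^ 6) (2 * ν ^ 2) ∧
      ν ^ 3 - x₁ ≤ 2 / ν := by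
  have hν := h.one_le
  have h0 : 0 ≤ ν ^ 6 - min (ν ^ 6) (2 * ν ^ 2) := by linarith [min_le_left (ν ^ 6) (2 * ν ^ 2)]
  have hsq := Real.sq_sqrt h0
  have hx0 := Real.sqrt_nonneg (ν ^ 6 - min (ν ^ 6) (2 * ν ^ 2))
  have hpos : 0 < min (ν ^ 6) (2 * ν ^ 2) := by positivity
  have hle : Real.sqrt (ν ^ 6 - min (ν ^ 6) (2 * ν ^ 2)) ≤ ν ^ 3 :=
    le_of_sq_le_sq (by rw [hsq]; nlinarith) (by positivity)
  refine ⟨_, hx0, hle, by rw [hsq]; ring, ?_⟩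
  have h1 : (ν ^ 3 - Real.sqrt (ν ^ 6 - min (ν ^ 6) (2 * ν ^ 2))) * ν ^ 3 ≤ 2 * ν ^ 2 := by
    nlinarith [min_le_right (ν ^ 6) (2 * ν ^ 2),
      mul_nonneg hx0 (sub_nonneg.2 hle)]
  rw [le_div_iff₀ (by positivity)]
  have h2 : 0 < ν ^ 2 := by positivity
  nlinarith

theorem nonneg_const (h : DecayingSolution c ν y y') : 0 ≤ c := by
  have hν := h.one_le
  have h1 : 0 ≤ c * ν ^ 3 := le_trans (by positivity) h.init
  exact nonneg_of_mul_nonneg_left h1 (by positivity)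

/-- The sup norm bound `y² = O(ν⁻¹)`. It follows from the amplitude bound up to the transition
region, whose width is `O(ν⁻¹)`; across it `y'² = O(ν)`, so that `y` varies by `O(ν^{-1/2})`, and
beyond the turning point `y²` decreases. -/
theorem sq_mul_le (h : DecayingSolution c ν y y') {x : ℝ} (hx : 0 ≤ x) :
    y x ^ 2 * ν ≤ 48 * c := by
  have hν := h.one_le
  have hc := h.nonneg_const
  obtain ⟨x₁, hx₁, hx₁ν, hQ₁, hlen⟩ := h.exists_transition_point
  have hνQ : ν ^ 2 ≤ min (ν ^ 6) (2 * ν ^ 2) :=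
    le_min (pow_le_pow_right₀ hν (by norm_num)) (by nlinarith [sq_nonneg ν])
  have inner : ∀ t, 0 ≤ t → t ≤ x₁ → y t ^ 2 * ν ≤ 3 * c := fun t ht ht₁ => by
    have hQ : min (ν ^ 6) (2 * ν ^ 2) ≤ ν ^ 6 - t ^ 2 := by
      rw [← hQ₁]; have := pow_le_pow_left₀ ht ht₁ 2; linarith
    have h1 := h.sq_mul_le_of_le ht hQ
    have h2 : ν ≤ Real.sqrt (ν ^ 6 - t ^ 2) := Real.le_sqrt_of_sq_le (hνQ.trans hQ)
    have h3 : 0 ≤ y' t ^ 2 / Real.sqrt (ν ^ 6 - t ^ 2) := by positivity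
    nlinarith [mul_le_mul_of_nonneg_left h2 (sq_nonneg (y t))]
  have hderiv : ∀ t, x₁ ≤ t → t ≤ ν ^ 3 → y' t ^ 2 ≤ 5 * c * ν := fun t ht htν => by
    have h0t : 0 ≤ t := hx₁.trans ht
    have h1 := h.antitoneOn_energy hx₁ h0t ht
    have h2 := h.sq_mul_le_of_le hx₁ hQ₁.ge
    have hQpos : 0 < ν ^ 6 - x₁ ^ 2 := by rw [hQ₁]; positivity
    have hs := Real.sq_sqrt hQpos.le
    have hs0 := Real.sqrt_pos.2 hQpos
    have hsle : Real.sqrt (ν ^ 6 - x₁ ^ 2) ≤ 3 / 2 * ν := by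
      rw [Real.sqrt_le_left (by positivity), hQ₁]
      exact (min_le_right _ _).trans (by nlinarith [sq_nonneg ν])
    have h3 : y' x₁ ^ 2 + (ν ^ 6 - x₁ ^ 2) * y x₁ ^ 2 = Real.sqrt (ν ^ 6 - x₁ ^ 2) *
        (Real.sqrt (ν ^ 6 - x₁ ^ 2) * y x₁ ^ 2 + y' x₁ ^ 2 / Real.sqrt (ν ^ 6 - x₁ ^ 2)) := by
      rw [mul_add, mul_div_cancel₀ _ hs0.ne', ← mul_assoc, ← sq, hs]; ring
    have h4 := mul_le_mul hsle h2 (by positivity) (by positivity)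
    have h5 : 0 ≤ (ν ^ 6 - t ^ 2) * y t ^ 2 := by
      have := pow_le_pow_left₀ h0t htν 2
      exact mul_nonneg (by nlinarith) (sq_nonneg _)
    have h6 : 0 ≤ c * ν := by positivity
    simp only at h1
    linarith
  have middle : ∀ t, x₁ ≤ t → t ≤ ν ^ 3 → y t ^ 2 * ν ≤ 48 * c := fun t ht htν => by
    have hb : ∀ u ∈ Set.Icc x₁ (ν ^ 3), ‖y' u‖ ≤ Real.sqrt (5 * c * ν) := fun u hu => by
      rw [Real.norm_eq_abs]
      exact Real.abs_le_sqrt (hderiv u hu.1 hu.2)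
    have h1 := (convex_Icc x₁ (ν ^ 3)).norm_image_sub_le_of_norm_hasDerivWithin_le
      (fun u _ => (h.deriv u).hasDerivWithinAt) hb ⟨le_rfl, hx₁ν⟩ ⟨ht, htν⟩
    rw [Real.norm_eq_abs, Real.norm_eq_abs, abs_of_nonneg (sub_nonneg.2 ht)] at h1
    have h2 : (y t - y x₁) ^ 2 * ν ≤ 20 * c := by
      have h3 : |y t - y x₁| ≤ Real.sqrt (5 * c * ν) * (2 / ν) :=
        h1.trans (mul_le_mul_of_nonneg_left (by linarith) (Real.sqrt_nonneg _))
      have h4 := pow_le_pow_left₀ (abs_nonneg _) h3 2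
      rw [sq_abs, mul_pow, Real.sq_sqrt (by positivity)] at h4
      calc (y t - y x₁) ^ 2 * ν ≤ 5 * c * ν * (2 / ν) ^ 2 * ν := by gcongr
        _ = 20 * c := by field_simp; ring
    have h5 := inner x₁ hx₁ le_rfl
    have h6 : y t ^ 2 ≤ 3 / 2 * (y t - y x₁) ^ 2 + 3 * y x₁ ^ 2 := by
      nlinarith [sq_nonneg (y t - 3 * y x₁)]
    nlinarith
  rcases le_total x x₁ with h1 | h1
  · linarith [inner x hx h1]
  rcases le_total x (ν ^ 3) with h2 | h2
  · exact middle x h1 h2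
  · exact (mul_le_mul_of_nonneg_right (h.antitoneOn_sq (Set.mem_Ici.2 le_rfl) h2 h2)
      (by positivity)).trans (middle _ hx₁ν le_rfl)

/-- `y'' = (x² - ν⁶) y` and `y` are controlled beyond the turning point: `(x² - ν⁶)² y²` is
decreasing once `x² - ν⁶ ≥ 3 ν²`, since there `|y'| ≥ √(x² - ν⁶) |y|` forces a fast decay. -/
theorem deriv2_sq_le_beyond (h : DecayingSolution c ν y y') {x : ℝ} (hx : 0 ≤ x)
    (hq : ν ^ 6 ≤ x ^ 2) : (x ^ 2 - ν ^ 6) ^ 2 * y x ^ 2 ≤ 432 * c * ν ^ 3 := by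
  have hν := h.one_le
  have hc := h.nonneg_const
  have near : ∀ t, 0 ≤ t → ν ^ 6 ≤ t ^ 2 → t ^ 2 - ν ^ 6 ≤ 3 * ν ^ 2 →
      (t ^ 2 - ν ^ 6) ^ 2 * y t ^ 2 ≤ 432 * c * ν ^ 3 := fun t ht h1 h2 => by
    calc (t ^ 2 - ν ^ 6) ^ 2 * y t ^ 2 ≤ (3 * ν ^ 2) ^ 2 * y t ^ 2 := by
          gcongr
      _ = 9 * ν ^ 3 * (y t ^ 2 * ν) := by ring
      _ ≤ 9 * ν ^ 3 * (48 * c) := mul_le_mul_of_nonneg_left (h.sq_mul_le ht) (by positivity)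
      _ = 432 * c * ν ^ 3 := by ring
  rcases le_total (x ^ 2 - ν ^ 6) (3 * ν ^ 2) with h1 | h1
  · exact near x hx hq h1
  set x₂ := Real.sqrt (ν ^ 6 + 3 * ν ^ 2) with hx₂
  have hx₂sq : x₂ ^ 2 = ν ^ 6 + 3 * ν ^ 2 := Real.sq_sqrt (by positivity)
  have hx₂0 : 0 ≤ x₂ := Real.sqrt_nonneg _
  have hx₂x : x₂ ≤ x := le_of_sq_le_sq (by linarith) hx
  have hν2 : 1 ≤ ν ^ 2 := one_le_pow₀ hν
  have hanti : AntitoneOn (fun t => (t ^ 2 - ν ^ 6) ^ 2 * y t ^ 2) (Set.Ici x₂) := by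
    refine antitoneOn_of_hasDerivAt_nonpos (convex_Ici _)
      (fun t _ => (((hasDerivAt_pow 2 t).sub_const (ν ^ 6)).pow 2).mul ((h.deriv t).pow 2))
      fun t ht => ?_
    have ht0 : 0 ≤ t := hx₂0.trans ht
    have ht2 : x₂ ^ 2 ≤ t ^ 2 := pow_le_pow_left₀ hx₂0 ht 2
    obtain ⟨q, hq⟩ : ∃ q, q = t ^ 2 - ν ^ 6 := ⟨_, rfl⟩
    have hq3 : 3 * ν ^ 2 ≤ q := by rw [hq]; linarith
    have hq0 : 0 < q := by linarith
    have htν : ν ^ 3 ≤ t := le_of_sq_le_sq (by nlinarith) ht0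
    have hyy := h.mul_deriv_nonpos htν
    have hE := h.energy_nonneg ht0
    have hlow : Real.sqrt q * y t ^ 2 ≤ -(y t * y' t) := by
      refine le_of_sq_le_sq ?_ (by linarith)
      have e : (Real.sqrt q * y t ^ 2) ^ 2 = q * y t ^ 2 * y t ^ 2 := by
        rw [mul_pow, Real.sq_sqrt hq0.le]; ring
      rw [e, neg_sq, mul_pow, mul_comm (y t ^ 2) (y' t ^ 2)]
      exact mul_le_mul_of_nonneg_right (by rw [hq]; linarith) (sq_nonneg _)
    have hthr : 2 * t ≤ q * Real.sqrt q := by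
      refine le_of_sq_le_sq ?_ (by positivity)
      rw [mul_pow, mul_pow, Real.sq_sqrt hq0.le]
      have e : t ^ 2 = q + ν ^ 6 := by rw [hq]; ring
      have e2 : ν ^ 6 ≤ (q / 3) ^ 3 := by
        calc ν ^ 6 = (ν ^ 2) ^ 3 := by ring
          _ ≤ (q / 3) ^ 3 := pow_le_pow_left₀ (by positivity) (by linarith) 3
      have e3 : 9 ≤ q ^ 2 := by nlinarith
      rw [e]
      nlinarith [mul_le_mul_of_nonneg_left e3 hq0.le]
    have e1 : ((fun x : ℝ => x ^ 2 - ν ^ 6) ^ 2) t = q ^ 2 := by rw [hq]; rfl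
    rw [e1, ← hq]
    push_cast
    norm_num
    have h7 : q ^ 2 * (Real.sqrt q * y t ^ 2) ≤ q ^ 2 * (-(y t * y' t)) := by gcongr
    have h8 : 2 * t * (q * y t ^ 2) ≤ q * Real.sqrt q * (q * y t ^ 2) := by gcongr
    nlinarith
  exact (hanti (Set.mem_Ici.2 le_rfl) hx₂x hx₂x).trans
    (near x₂ hx₂0 (by rw [hx₂sq]; nlinarith) (by rw [hx₂sq]; linarith))

theorem deriv2_sq_le (h : DecayingSolution c ν y y') {x : ℝ} (hx : 0 ≤ x) :
    ((x ^ 2 - ν ^ 6) * y x) ^ 2 ≤ 432 * c * ν ^ 9 := by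
  have hν := h.one_le
  have hc := h.nonneg_const
  rw [mul_pow]
  rcases le_total (ν ^ 6) (x ^ 2) with h1 | h1
  · refine (h.deriv2_sq_le_beyond hx h1).trans ?_
    exact mul_le_mul_of_nonneg_left (pow_le_pow_right₀ hν (by norm_num)) (by positivity)
  · have h2 := h.energy_le hx
    have h3 : (ν ^ 6 - x ^ 2) * y x ^ 2 ≤ c * ν ^ 3 := by nlinarith [sq_nonneg (y' x)]
    have h4 : (ν ^ 6 - x ^ 2) * ((ν ^ 6 - x ^ 2) * y x ^ 2) ≤ ν ^ 6 * (c * ν ^ 3) :=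
      mul_le_mul (by nlinarith [sq_nonneg x]) h3
        (mul_nonneg (by linarith) (sq_nonneg _)) (by positivity)
    have h5 : 0 ≤ c * ν ^ 9 := by positivity
    nlinarith

/-- The amplitude bound `y² = O(|x² - ν⁶|^{-1/2})` on both sides of the turning point. -/
theorem sqrt_abs_mul_sq_le (h : DecayingSolution c ν y y') {x : ℝ} (hx : 0 ≤ x) :
    Real.sqrt |x ^ 2 - ν ^ 6| * y x ^ 2 ≤ 96 * c := by
  have hν := h.one_le
  have hc := h.nonneg_const
  rcases le_total |x ^ 2 - ν ^ 6| (4 * ν ^ 2) with h1 | h1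
  · have h2 : Real.sqrt |x ^ 2 - ν ^ 6| ≤ 2 * ν := by
      rw [Real.sqrt_le_left (by positivity)]; linarith
    have h3 := h.sq_mul_le hx
    nlinarith [mul_le_mul_of_nonneg_right h2 (sq_nonneg (y x))]
  rcases le_total (ν ^ 6) (x ^ 2) with h2 | h2
  · rw [abs_of_nonneg (by linarith)] at h1 ⊢
    set q := x ^ 2 - ν ^ 6 with hq
    have hq0 : 0 < q := by nlinarith
    have h3 := h.deriv2_sq_le_beyond hx h2
    have hs := Real.sq_sqrt hq0.le
    have hs0 := Real.sqrt_pos.2 hq0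
    have h4 : 2 * ν ≤ Real.sqrt q := Real.le_sqrt_of_sq_le (by linarith)
    have h5 : (2 * ν) ^ 3 ≤ Real.sqrt q ^ 3 := pow_le_pow_left₀ (by positivity) h4 3
    have h6 : q ^ 2 * y x ^ 2 = Real.sqrt q ^ 3 * (Real.sqrt q * y x ^ 2) := by
      nth_rewrite 1 [← hs]; ring
    rw [← hq, h6] at h3
    have h7 : (2 * ν) ^ 3 * (Real.sqrt q * y x ^ 2) ≤ 432 * c * ν ^ 3 :=
      (mul_le_mul_of_nonneg_right h5 (by positivity)).trans h3
    have h8 : 0 < ν ^ 3 := by positivity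
    have h9 : ν ^ 3 * (8 * (Real.sqrt q * y x ^ 2)) ≤ ν ^ 3 * (432 * c) := by linarith
    linarith [le_of_mul_le_mul_left h9 h8]
  · rw [abs_of_nonpos (by linarith), neg_sub] at h1 ⊢
    have h3 := h.sq_mul_le_of_le hx ((min_le_right _ _).trans (by nlinarith))
    have h4 : 0 ≤ y' x ^ 2 / Real.sqrt (ν ^ 6 - x ^ 2) := by positivity
    linarith

end DecayingSolution

/-- The sixth root of the energy level `2k + 1`. -/
noncomputable def lev (k : ℕ) : ℝ := (2 * (k : ℝ) + 1) ^ (1 / 6 : ℝ)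

theorem lev_pow_six (k : ℕ) : lev k ^ 6 = 2 * k + 1 := by
  unfold lev
  rw [← Real.rpow_natCast, ← Real.rpow_mul (by positivity)]
  norm_num

theorem lev_pow_three (k : ℕ) : lev k ^ 3 = Real.sqrt (2 * k + 1) := by
  have h : 0 ≤ lev k := by unfold lev; positivity
  rw [← lev_pow_six, show lev k ^ 6 = (lev k ^ 3) ^ 2 by ring, Real.sqrt_sq (by positivity)]

theorem one_le_lev (k : ℕ) : 1 ≤ lev k := by
  unfold lev
  exact Real.one_le_rpow (by have : (0 : ℝ) ≤ k := k.cast_nonneg; linarith) (by norm_num)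

theorem lev_mono {j k : ℕ} (h : j ≤ k) : lev j ≤ lev k := by
  unfold lev
  gcongr

theorem decayingSolution_psi (k : ℕ) : DecayingSolution 4 (lev k) (psi k) (dpsi k) where
  one_le := one_le_lev k
  deriv := hasDerivAt_psi k
  deriv' x := by rw [lev_pow_six]; exact hasDerivAt_dpsi k x
  tendsto := tendsto_psi_atTop k
  tendsto_mul := tendsto_mul_psi_atTop k
  tendsto' := tendsto_dpsi_atTop k
  init := by
    rw [lev_pow_six, lev_pow_three]
    have hs := Real.sq_sqrt (show (0 : ℝ) ≤ 2 * k + 1 by positivity)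
    have h1 : (2 * (k : ℝ) + 1) * psi k 0 ^ 2 ≤ 2 * Real.sqrt (2 * k + 1) := by
      refine le_of_sq_le_sq ?_ (by positivity)
      have h := psi_zero_pow_four_le k
      have : (0 : ℝ) ≤ psi k 0 ^ 4 := by positivity
      rw [mul_pow, mul_pow, hs]
      have hk : (0 : ℝ) ≤ 2 * k + 1 := by positivity
      nlinarith
    have h2 : dpsi k 0 ^ 2 ≤ 2 * Real.sqrt (2 * k + 1) := by
      cases k with
      | zero => simp [dpsi]
      | succ k =>
        have h := psi_zero_pow_four_le k
        have e : dpsi (k + 1) 0 ^ 2 = 2 * (k + 1) * psi k 0 ^ 2 := by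
          simp only [dpsi, Nat.add_sub_cancel, zero_mul, sub_zero, mul_pow]
          rw [Real.sq_sqrt (by positivity)]
          push_cast; ring
        rw [e]
        refine le_of_sq_le_sq ?_ (by positivity)
        have hk : (0 : ℝ) ≤ k := by positivity
        rw [mul_pow (2 : ℝ) (Real.sqrt _), hs]
        push_cast
        nlinarith
    linarith

theorem psi_abs_sq (k : ℕ) (x : ℝ) : psi k |x| ^ 2 = psi k x ^ 2 := by
  rcases abs_cases x with ⟨h, -⟩ | ⟨h, -⟩ <;> rw [h]
  rw [psi_neg, mul_pow, ← pow_mul, mul_comm k, pow_mul]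
  norm_num

theorem psi_sq_mul_lev_le (k : ℕ) (x : ℝ) : psi k x ^ 2 * lev k ≤ 192 := by
  have := (decayingSolution_psi k).sq_mul_le (abs_nonneg x)
  rw [psi_abs_sq] at this
  linarith

theorem sqrt_abs_mul_psi_sq_le (k : ℕ) (x : ℝ) :
    Real.sqrt |x ^ 2 - (2 * k + 1)| * psi k x ^ 2 ≤ 384 := by
  have := (decayingSolution_psi k).sqrt_abs_mul_sq_le (abs_nonneg x)
  rw [psi_abs_sq, sq_abs, lev_pow_six] at this
  linarith

theorem dpsi_neg (k : ℕ) (x : ℝ) : dpsi k (-x) = -((-1) ^ k * dpsi k x) := by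
  have h1 := (hasDerivAt_psi k (-x)).comp x (hasDerivAt_neg x)
  have h2 := (hasDerivAt_psi k x).const_mul ((-1) ^ k)
  have : (psi k ∘ Neg.neg) = fun x => (-1) ^ k * psi k x := funext fun x => psi_neg k x
  rw [this] at h1
  have := h1.unique h2
  linarith

theorem dpsi_sq_le (k : ℕ) (x : ℝ) : dpsi k x ^ 2 ≤ 4 * lev k ^ 3 := by
  have h := (decayingSolution_psi k).deriv_sq_le (abs_nonneg x)
  rcases abs_cases x with ⟨e, -⟩ | ⟨e, -⟩ <;> rw [e] at h
  · exact h
  · rwa [dpsi_neg, neg_sq, mul_pow, ← pow_mul, mul_comm k, pow_mul, neg_one_sq, one_pow,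
      one_mul] at h

theorem deriv2_psi_sq_le (k : ℕ) (x : ℝ) :
    ((x ^ 2 - (2 * k + 1)) * psi k x) ^ 2 ≤ 1728 * lev k ^ 9 := by
  have := (decayingSolution_psi k).deriv2_sq_le (abs_nonneg x)
  rw [mul_pow, psi_abs_sq, sq_abs, lev_pow_six] at this
  rw [mul_pow]
  linarith

theorem lev_lower (k : ℕ) : ((k : ℝ) + 1) ^ (1 / 6 : ℝ) ≤ lev k := by
  unfold lev
  gcongr
  have : (0 : ℝ) ≤ k := k.cast_nonneg
  linarith

theorem psi_sq_le (k : ℕ) (x : ℝ) : psi k x ^ 2 ≤ 192 * ((k : ℝ) + 1) ^ (-(1 / 6) : ℝ) := by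
  rw [Real.rpow_neg (by positivity), ← div_eq_mul_inv, le_div_iff₀ (by positivity)]
  exact (mul_le_mul_of_nonneg_left (lev_lower k) (sq_nonneg _)).trans (psi_sq_mul_lev_le k x)

/-- The sup bound for products of Hermite functions. Midway between the squared turning points,
one of the two factors is at distance at least `k - j` from its own turning point. -/
theorem psi_mul_psi_sq_le {j k : ℕ} (hjk : j ≤ k) (x : ℝ) :
    (psi j x * psi k x) ^ 2 ≤
      150000 * (((j : ℝ) + 1) ^ (-(1 / 6) : ℝ) * ((k : ℝ) - j + 1) ^ (-(1 / 2) : ℝ)) := by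
  have hjk' : (j : ℝ) ≤ k := by exact_mod_cast hjk
  have hD0 : (0 : ℝ) ≤ (k : ℝ) - j := by linarith
  have hj := psi_sq_le j x
  have hk : psi k x ^ 2 ≤ 192 * ((j : ℝ) + 1) ^ (-(1 / 6) : ℝ) := by
    refine (psi_sq_le k x).trans (mul_le_mul_of_nonneg_left ?_ (by norm_num))
    exact Real.rpow_le_rpow_of_nonpos (by positivity) (by linarith) (by norm_num)
  have key : ∀ u v : ℝ, 0 ≤ u → 0 ≤ v → u ≤ 192 * ((j : ℝ) + 1) ^ (-(1 / 6) : ℝ) →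
      v * Real.sqrt ((k : ℝ) - j) ≤ 384 → v ≤ 192 → u * v ≤
      150000 * (((j : ℝ) + 1) ^ (-(1 / 6) : ℝ) * ((k : ℝ) - j + 1) ^ (-(1 / 2) : ℝ)) := by
    intro u v hu hv h1 h2 h3
    have h4 : v ≤ 600 * ((k : ℝ) - j + 1) ^ (-(1 / 2) : ℝ) := by
      rw [Real.rpow_neg (by positivity), ← Real.sqrt_eq_rpow, ← div_eq_mul_inv,
        le_div_iff₀ (by positivity)]
      have h5 : Real.sqrt ((k : ℝ) - j + 1) ≤ Real.sqrt ((k : ℝ) - j) + 1 := by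
        rw [Real.sqrt_le_left (by positivity)]
        nlinarith [Real.sq_sqrt hD0, Real.sqrt_nonneg ((k : ℝ) - j)]
      nlinarith
    calc u * v ≤ (192 * ((j : ℝ) + 1) ^ (-(1 / 6) : ℝ)) *
          (600 * ((k : ℝ) - j + 1) ^ (-(1 / 2) : ℝ)) := mul_le_mul h1 h4 hv (hu.trans h1)
      _ = 115200 * (((j : ℝ) + 1) ^ (-(1 / 6) : ℝ) * ((k : ℝ) - j + 1) ^ (-(1 / 2) : ℝ)) := by ring
      _ ≤ _ := by gcongr; norm_num
  have hle1 : ∀ k : ℕ, psi k x ^ 2 ≤ 192 := fun k => by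
    nlinarith [psi_sq_mul_lev_le k x, one_le_lev k, sq_nonneg (psi k x)]
  have hsq : (psi j x * psi k x) ^ 2 = psi j x ^ 2 * psi k x ^ 2 := mul_pow _ _ _
  rcases le_total (x ^ 2) (j + k + 1) with hx | hx
  · rw [hsq]
    refine key _ _ (sq_nonneg _) (sq_nonneg _) hj ?_ (hle1 k)
    rw [mul_comm]
    refine le_trans ?_ (sqrt_abs_mul_psi_sq_le k x)
    gcongr
    rw [abs_of_nonpos] <;> linarith
  · rw [hsq, mul_comm]
    refine key _ _ (sq_nonneg _) (sq_nonneg _) hk ?_ (hle1 j)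
    rw [mul_comm]
    refine le_trans ?_ (sqrt_abs_mul_psi_sq_le j x)
    gcongr
    rw [abs_of_nonneg] <;> linarith

/-- The second derivative of `ψ_j ψ_k`. -/
noncomputable def psiMulD2 (j k : ℕ) (x : ℝ) : ℝ :=
  (x ^ 2 - (2 * j + 1)) * psi j x * psi k x + 2 * (dpsi j x * dpsi k x) +
    psi j x * ((x ^ 2 - (2 * k + 1)) * psi k x)

theorem hasDerivAt_psi_mul_psi (j k : ℕ) (x : ℝ) :
    HasDerivAt (fun x => psi j x * psi k x) (dpsi j x * psi k x + psi j x * dpsi k x) x :=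
  (hasDerivAt_psi j x).mul (hasDerivAt_psi k x)

theorem hasDerivAt_deriv_psi_mul_psi (j k : ℕ) (x : ℝ) :
    HasDerivAt (fun x => dpsi j x * psi k x + psi j x * dpsi k x) (psiMulD2 j k x) x := by
  refine (((hasDerivAt_dpsi j x).mul (hasDerivAt_psi k x)).add
    ((hasDerivAt_psi j x).mul (hasDerivAt_dpsi k x))).congr_deriv ?_
  unfold psiMulD2; ring

/-- Each summand is estimated by `ψ² = O(ν⁻¹)`, `ψ'² = O(ν³)` and `ψ''² = O(ν⁹)`, where `ν⁶` is the
energy level. -/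
theorem psiMulD2_sq_le {j k : ℕ} (hjk : j ≤ k) (x : ℝ) :
    psiMulD2 j k x ^ 2 ≤
      6000000 * (((j : ℝ) + 1) ^ (-(1 / 6) : ℝ) * ((k : ℝ) + 1) ^ (3 / 2 : ℝ)) := by
  have hj1 := one_le_lev j
  have hk1 := one_le_lev k
  have hjk1 := lev_mono hjk
  have a1 := psi_sq_mul_lev_le j x
  have a2 := psi_sq_mul_lev_le k x
  have b1 := dpsi_sq_le j x
  have b2 := dpsi_sq_le k x
  have c1 := deriv2_psi_sq_le j x
  have c2 := deriv2_psi_sq_le k x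
  have ha1 : psi j x ^ 2 ≤ 192 / lev j := by rwa [le_div_iff₀ (by positivity)]
  have ha2 : psi k x ^ 2 ≤ 192 / lev j := by
    rw [le_div_iff₀ (by positivity)]
    exact (mul_le_mul_of_nonneg_left hjk1 (sq_nonneg _)).trans a2
  have hj9 : lev j ^ 9 ≤ lev k ^ 9 := pow_le_pow_left₀ (by positivity) hjk1 9
  have t1 : ((x ^ 2 - (2 * j + 1)) * psi j x) ^ 2 * psi k x ^ 2
      ≤ (1728 * lev k ^ 9) * (192 / lev j) :=
    mul_le_mul (c1.trans (by gcongr)) ha2 (sq_nonneg _) (by positivity)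
  have t3 : psi j x ^ 2 * ((x ^ 2 - (2 * k + 1)) * psi k x) ^ 2
      ≤ (192 / lev j) * (1728 * lev k ^ 9) :=
    mul_le_mul ha1 c2 (sq_nonneg _) (by positivity)
  have t2 : dpsi j x ^ 2 * dpsi k x ^ 2 ≤ 16 * (lev k ^ 9 / lev j) := by
    have h1 : dpsi j x ^ 2 * dpsi k x ^ 2 ≤ (4 * lev j ^ 3) * (4 * lev k ^ 3) :=
      mul_le_mul b1 b2 (sq_nonneg _) (by positivity)
    have h2 : lev j ^ 3 * lev k ^ 3 ≤ lev k ^ 9 / lev j := by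
      rw [le_div_iff₀ (by positivity)]
      calc lev j ^ 3 * lev k ^ 3 * lev j = lev j ^ 4 * lev k ^ 3 := by ring
        _ ≤ lev k ^ 4 * lev k ^ 3 := by gcongr
        _ = lev k ^ 7 := by ring
        _ ≤ lev k ^ 9 := pow_le_pow_right₀ hk1 (by norm_num)
    linarith
  have hmain : psiMulD2 j k x ^ 2 ≤ 2000000 * (lev k ^ 9 / lev j) := by
    have h0 : psiMulD2 j k x ^ 2 ≤ 3 * (((x ^ 2 - (2 * j + 1)) * psi j x) ^ 2 * psi k x ^ 2 +
        4 * (dpsi j x ^ 2 * dpsi k x ^ 2) +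
        psi j x ^ 2 * ((x ^ 2 - (2 * k + 1)) * psi k x) ^ 2) := by
      unfold psiMulD2
      rw [← mul_pow, ← mul_pow, ← mul_pow]
      generalize (x ^ 2 - (2 * j + 1)) * psi j x * psi k x = u
      generalize dpsi j x * dpsi k x = v
      generalize psi j x * ((x ^ 2 - (2 * k + 1)) * psi k x) = w
      nlinarith [sq_nonneg (u - 2 * v), sq_nonneg (u - w), sq_nonneg (2 * v - w)]
    have e1 : (1728 * lev k ^ 9) * (192 / lev j) = 331776 * (lev k ^ 9 / lev j) := by ring
    have e2 : (192 / lev j) * (1728 * lev k ^ 9) = 331776 * (lev k ^ 9 / lev j) := by ring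
    rw [e1] at t1
    rw [e2] at t3
    have : 0 ≤ lev k ^ 9 / lev j := by positivity
    linarith
  have h9 : lev k ^ 9 ≤ 3 * ((k : ℝ) + 1) ^ (3 / 2 : ℝ) := by
    have e : lev k ^ 9 = (2 * (k : ℝ) + 1) ^ (3 / 2 : ℝ) := by
      unfold lev
      rw [← Real.rpow_natCast, ← Real.rpow_mul (by positivity)]
      norm_num
    have h2 : (2 : ℝ) ^ (3 / 2 : ℝ) ≤ 3 := by
      have : ((2 : ℝ) ^ (3 / 2 : ℝ)) ^ 2 = 8 := by
        rw [← Real.rpow_natCast, ← Real.rpow_mul (by positivity)]; norm_num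
      exact le_of_sq_le_sq (by rw [this]; norm_num) (by norm_num)
    rw [e]
    calc (2 * (k : ℝ) + 1) ^ (3 / 2 : ℝ) ≤ (2 * ((k : ℝ) + 1)) ^ (3 / 2 : ℝ) := by
          gcongr; linarith
      _ = 2 ^ (3 / 2 : ℝ) * ((k : ℝ) + 1) ^ (3 / 2 : ℝ) :=
        Real.mul_rpow (by norm_num) (by positivity)
      _ ≤ _ := by gcongr
  refine hmain.trans ?_
  rw [Real.rpow_neg (by positivity)]
  have h10 : lev k ^ 9 / lev j ≤ 3 * ((k : ℝ) + 1) ^ (3 / 2 : ℝ) / ((j : ℝ) + 1) ^ (1 / 6 : ℝ) :=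
    div_le_div₀ (by positivity) h9 (by positivity) (lev_lower j)
  calc 2000000 * (lev k ^ 9 / lev j) ≤
      2000000 * (3 * ((k : ℝ) + 1) ^ (3 / 2 : ℝ) / ((j : ℝ) + 1) ^ (1 / 6 : ℝ)) := by gcongr
    _ = _ := by rw [div_eq_mul_inv]; ring

/-! ### Laguerre functions -/

theorem integrable_pow_mul_exp (n : ℕ) :
    Integrable (fun r : ℝ => r ^ n * Real.exp (-r ^ 2 / 2)) := by
  have h := integrable_rpow_mul_exp_neg_mul_sq (b := 1 / 2) (by norm_num) (s := (n : ℝ))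
    (by have : (0 : ℝ) ≤ n := Nat.cast_nonneg n
        linarith)
  refine h.congr (Filter.Eventually.of_forall fun r => ?_)
  simp only [Real.rpow_natCast]
  congr 2
  ring

theorem integral_abs_mul_pow_mul_exp (n : ℕ) :
    ∫ r : ℝ, |r| * (r ^ 2) ^ n * Real.exp (-r ^ 2) = n.factorial := by
  have h1 : (fun r : ℝ => |r| * (r ^ 2) ^ n * Real.exp (-r ^ 2))
      = fun r => (fun t : ℝ => t * (t ^ 2) ^ n * Real.exp (-t ^ 2)) |r| := by
    ext r; simp
  have h2 : ∫ r in Set.Ioi (0 : ℝ), r * (r ^ 2) ^ n * Real.exp (-r ^ 2)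
      = ∫ r in Set.Ioi (0 : ℝ), r ^ ((2 * n + 1 : ℕ) : ℝ) * Real.exp (-r ^ (2 : ℝ)) := by
    refine setIntegral_congr_fun measurableSet_Ioi fun r _ => ?_
    simp only [Real.rpow_natCast, Real.rpow_two]
    ring
  rw [h1, integral_comp_abs (f := fun t : ℝ => t * (t ^ 2) ^ n * Real.exp (-t ^ 2)), h2,
    integral_rpow_mul_exp_neg_rpow (by norm_num) (lt_of_lt_of_le (by norm_num) (Nat.cast_nonneg _))]
  have : (((2 * n + 1 : ℕ) : ℝ) + 1) / 2 = n + 1 := by push_cast; ring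
  rw [this, Real.Gamma_nat_eq_factorial]
  ring

/-- The Laguerre function
`√(j!/(j+d)!) r^d e^{-r²/2} L_j^d(r²)`, which up to the phase `i^d` is the characteristic function
of `ψ_j ψ_{j+d}`. -/
noncomputable def ell (j d : ℕ) (r : ℝ) : ℝ :=
  Real.sqrt ((j.factorial : ℝ) / ((j + d).factorial : ℝ)) *
    (r ^ d * Real.exp (-r ^ 2 / 2) * laguerre j d (r ^ 2))

theorem continuous_ell (j d : ℕ) : Continuous (ell j d) := by
  unfold ell laguerre
  fun_prop

theorem integrable_pow_mul_ell (n j d : ℕ) : Integrable (fun r : ℝ => r ^ n * ell j d r) := by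
  have h : (fun r : ℝ => r ^ n * ell j d r) = fun r => ∑ i ∈ Finset.range (j + 1),
      (Real.sqrt ((j.factorial : ℝ) / ((j + d).factorial : ℝ)) *
        ((-1 : ℝ) ^ i * ((j + d).choose (j - i) : ℝ) / (i.factorial : ℝ))) *
          (r ^ (n + d + 2 * i) * Real.exp (-r ^ 2 / 2)) := by
    ext r
    simp only [ell, laguerre, Finset.mul_sum]
    refine Finset.sum_congr rfl fun i _ => ?_
    rw [pow_add, pow_add, pow_mul]
    ring
  rw [h]
  exact integrable_finsetSum _ fun i _ => (integrable_pow_mul_exp _).const_mul _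

theorem integrable_ell (j d : ℕ) : Integrable (ell j d) := by
  simpa using integrable_pow_mul_ell 0 j d

theorem integrable_abs_mul_ell (j d : ℕ) : Integrable (fun r : ℝ => |r| * ell j d r) := by
  refine (integrable_pow_mul_ell 1 j d).mono
    (by have := continuous_ell j d; fun_prop) (Filter.Eventually.of_forall fun r => ?_)
  simp

/-- The finite-difference identity behind the orthogonality of the Laguerre polynomials: the sum is
the `m`-th difference of a monic polynomial of degree `i`. -/
theorem sum_laguerre_coeff (m d i : ℕ) (hi : i ≤ m) :
    ∑ l ∈ Finset.range (m + 1), (-1 : ℝ) ^ l * ((m + d).choose (m - l) : ℝ) / (l.factorial : ℝ) *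
      ((d + i + l).factorial : ℝ) = if i = m then (-1) ^ m * ((m + d).factorial : ℝ) else 0 := by
  set P : Polynomial ℝ := (ascPochhammer ℝ i).comp (Polynomial.X + Polynomial.C ((d : ℝ) + 1))
    with hP
  have hmonic : P.Monic := (monic_ascPochhammer ℝ i).comp_X_add_C _
  have hdeg : P.natDegree = i := by
    rw [hP, Polynomial.natDegree_comp, Polynomial.natDegree_X_add_C, mul_one,
      ascPochhammer_natDegree]
  have heval : ∀ l : ℕ, P.eval (l : ℝ) * ((d + l).factorial : ℝ) = ((d + i + l).factorial : ℝ) := by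
    intro l
    have e : (l : ℝ) + ((d : ℝ) + 1) = ((d + l + 1 : ℕ) : ℝ) := by push_cast; ring
    rw [hP, Polynomial.eval_comp, Polynomial.eval_add, Polynomial.eval_X, Polynomial.eval_C, e,
      ← ascPochhammer_eval_cast, ascPochhammer_nat_eq_ascFactorial, mul_comm]
    rw [show d + i + l = d + l + i by ring]
    exact_mod_cast Nat.factorial_mul_ascFactorial (d + l) i
  have hterm : ∀ l ∈ Finset.range (m + 1),
      (-1 : ℝ) ^ l * ((m + d).choose (m - l) : ℝ) / (l.factorial : ℝ) *
        ((d + i + l).factorial : ℝ) =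
      (-1) ^ m * ((m + d).factorial : ℝ) / m.factorial *
        (((-1) ^ (m - l) * (m.choose l : ℤ)) • P.eval (0 + l • (1 : ℝ))) := by
    intro l hl
    have hlm : l ≤ m := by simpa [Nat.lt_succ_iff] using hl
    obtain ⟨t, rfl⟩ := Nat.exists_eq_add_of_le hlm
    rw [Nat.cast_choose ℝ (show l + t - l ≤ l + t + d by omega), ← heval, zsmul_eq_mul,
      show l + t - l = t by omega, show l + t + d - t = d + l by omega]
    push_cast
    rw [Nat.cast_choose ℝ (show l ≤ l + t by omega), show l + t - l = t by omega]
    have f1 : ((l + t).factorial : ℝ) ≠ 0 := by positivity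
    have f2 : ((d + l).factorial : ℝ) ≠ 0 := by positivity
    have f3 : ((l + t + d).factorial : ℝ) ≠ 0 := by positivity
    have f4 : (t.factorial : ℝ) ≠ 0 := by positivity
    have f5 : (l.factorial : ℝ) ≠ 0 := by positivity
    have f6 : (-1 : ℝ) ^ (l + t) * (-1) ^ t = (-1) ^ l := by
      rw [pow_add, mul_assoc, ← mul_pow]; norm_num
    simp only [nsmul_eq_mul, mul_one, zero_add]
    rw [← f6]
    field_simp
  rw [Finset.sum_congr rfl hterm, ← Finset.mul_sum,
    ← fwdDiff_iter_eq_sum_shift (1 : ℝ) (fun x => P.eval x) m 0]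
  split_ifs with him
  · have h := congrFun (Polynomial.fwdDiff_iter_degree_eq_factorial P) 0
    rw [hdeg, him] at h
    rw [h, hmonic.leadingCoeff]
    have f1 : (m.factorial : ℝ) ≠ 0 := by positivity
    simp
    field_simp
  · have h := Polynomial.fwdDiff_iter_eq_zero_of_degree_lt (P := P) (n := m)
      (by rw [hdeg]; omega)
    rw [h]
    simp

theorem integrable_abs_mul_pow_mul_exp (n : ℕ) :
    Integrable (fun r : ℝ => |r| * (r ^ 2) ^ n * Real.exp (-r ^ 2)) := by
  by_contra h
  have h1 := integral_abs_mul_pow_mul_exp n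
  rw [integral_undef h] at h1
  have : (n.factorial : ℝ) ≠ 0 := by positivity
  exact this h1.symm

/-- Orthonormality of the Laguerre functions for the weight `|r|`, ordered case. -/
theorem integral_ell_mul_ell_of_le {j m : ℕ} (d : ℕ) (hjm : j ≤ m) :
    ∫ r : ℝ, |r| * ell j d r * ell m d r = if j = m then 1 else 0 := by
  set κ := Real.sqrt ((j.factorial : ℝ) / ((j + d).factorial : ℝ)) *
    Real.sqrt ((m.factorial : ℝ) / ((m + d).factorial : ℝ)) with hκ
  set a : ℕ → ℕ → ℝ := fun m i => (-1 : ℝ) ^ i * ((m + d).choose (m - i) : ℝ) / (i.factorial : ℝ)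
    with ha
  have h1 : (fun r : ℝ => |r| * ell j d r * ell m d r) = fun r =>
      ∑ i ∈ Finset.range (j + 1), ∑ l ∈ Finset.range (m + 1),
        (κ * a j i * a m l) * (|r| * (r ^ 2) ^ (d + i + l) * Real.exp (-r ^ 2)) := by
    ext r
    have he : Real.exp (-r ^ 2 / 2) * Real.exp (-r ^ 2 / 2) = Real.exp (-r ^ 2) := by
      rw [← Real.exp_add]; congr 1; ring
    have hL : ∀ m, laguerre m d (r ^ 2) = ∑ i ∈ Finset.range (m + 1), a m i * (r ^ 2) ^ i := by
      intro m
      refine Finset.sum_congr rfl fun i _ => ?_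
      simp only [ha]; ring
    have h2 : |r| * ell j d r * ell m d r =
        κ * (|r| * (r ^ 2) ^ d * Real.exp (-r ^ 2)) *
          (laguerre j d (r ^ 2) * laguerre m d (r ^ 2)) := by
      rw [← he]
      simp only [ell, hκ]
      ring
    rw [h2, hL, hL, Finset.sum_mul_sum, Finset.mul_sum]
    refine Finset.sum_congr rfl fun i _ => ?_
    rw [Finset.mul_sum]
    refine Finset.sum_congr rfl fun l _ => ?_
    rw [pow_add, pow_add]
    ring
  rw [h1, integral_finsetSum _ fun i _ => integrable_finsetSum _ fun l _ =>
    (integrable_abs_mul_pow_mul_exp _).const_mul _]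
  have h3 : ∀ i ∈ Finset.range (j + 1),
      ∫ r : ℝ, ∑ l ∈ Finset.range (m + 1),
        (κ * a j i * a m l) * (|r| * (r ^ 2) ^ (d + i + l) * Real.exp (-r ^ 2)) =
      κ * a j i * (if i = m then (-1) ^ m * ((m + d).factorial : ℝ) else 0) := by
    intro i hi
    rw [integral_finsetSum _ fun l _ => (integrable_abs_mul_pow_mul_exp _).const_mul _,
      ← sum_laguerre_coeff m d i (by have := Finset.mem_range.1 hi; omega), Finset.mul_sum]
    refine Finset.sum_congr rfl fun l _ => ?_
    rw [integral_const_mul, integral_abs_mul_pow_mul_exp]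
    ring
  rw [Finset.sum_congr rfl h3]
  split_ifs with hjm'
  · subst hjm'
    rw [Finset.sum_eq_single_of_mem j (Finset.self_mem_range_succ j)
      (fun b _ hb => by simp [hb])]
    have hκ' : κ = (j.factorial : ℝ) / ((j + d).factorial : ℝ) := Real.mul_self_sqrt (by positivity)
    have f1 : (j.factorial : ℝ) ≠ 0 := by positivity
    have f2 : ((j + d).factorial : ℝ) ≠ 0 := by positivity
    have f3 : (-1 : ℝ) ^ j * (-1) ^ j = 1 := by rw [← mul_pow]; norm_num
    simp only [if_true, hκ', ha, Nat.sub_self, Nat.choose_zero_right, Nat.cast_one]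
    field_simp
    linear_combination f3
  · refine Finset.sum_eq_zero fun i hi => ?_
    rw [if_neg (by have := Finset.mem_range.1 hi; omega), mul_zero]

theorem integral_ell_mul_ell (j m d : ℕ) :
    ∫ r : ℝ, |r| * ell j d r * ell m d r = if j = m then 1 else 0 := by
  rcases le_total j m with h | h
  · exact integral_ell_mul_ell_of_le d h
  · rw [← if_congr (eq_comm (a := m) (b := j)) rfl rfl, ← integral_ell_mul_ell_of_le d h]
    refine integral_congr_ae (Filter.Eventually.of_forall fun r => ?_)
    simp only
    ring

/-! ### Characteristic functions of products of Hermite functions -/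

theorem memLp_psi_real (k : ℕ) : MemLp (psi k) 2 (volume : Measure ℝ) := by
  simpa using (memLp_psi k).re

theorem memLp_mul_psi (k : ℕ) : MemLp (fun x => x * psi k x) 2 (volume : Measure ℝ) := by
  have h := (((memLp_psi_real (k - 1)).const_mul (Real.sqrt (2 * k))).add
    ((memLp_psi_real (k + 1)).const_mul (Real.sqrt (2 * (k + 1))))).const_mul (1 / 2)
  convert h using 2 with x
  have := two_mul_psi k x
  simp only [Pi.add_apply]
  linarith

theorem memLp_dpsi (k : ℕ) : MemLp (dpsi k) 2 (volume : Measure ℝ) :=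
  ((memLp_psi_real (k - 1)).const_mul (Real.sqrt (2 * k))).sub (memLp_mul_psi k)

theorem integrable_psi_mul_psi (j k : ℕ) : Integrable (fun x => psi j x * psi k x) :=
  (memLp_psi_real j).integrable_mul (memLp_psi_real k)

theorem integrable_ofReal_mul_cexp {f : ℝ → ℝ} (hf : Integrable f) (c : ℝ) :
    Integrable (fun x : ℝ => (f x : ℂ) * Complex.exp ((c * x : ℝ) * Complex.I)) := by
  have h : Integrable (fun x : ℝ => (f x : ℂ)) := hf.ofReal
  refine h.mono (h.aestronglyMeasurable.mul (by fun_prop))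
    (Filter.Eventually.of_forall fun x => ?_)
  rw [norm_mul, Complex.norm_exp_ofReal_mul_I, mul_one]

/-- The characteristic function `∫ ψ_m ψ_n e^{i√2 r x} dx`. -/
noncomputable def overlap (m n : ℕ) (r : ℝ) : ℂ :=
  ∫ x : ℝ, ((psi m x * psi n x : ℝ) : ℂ) * Complex.exp ((Real.sqrt 2 * r * x : ℝ) * Complex.I)

theorem overlap_comm (m n : ℕ) (r : ℝ) : overlap m n r = overlap n m r := by
  simp only [overlap, mul_comm (psi m _)]

/-- The commutation relation of the annihilation operator with the multiplication by
`e^{i√2 r x}`. -/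
theorem sqrt_mul_overlap_succ (m n : ℕ) (r : ℝ) :
    (Real.sqrt (m + 1) : ℂ) * overlap (m + 1) n r =
      (Real.sqrt n : ℂ) * overlap m (n - 1) r + Complex.I * r * overlap m n r := by
  set e : ℝ → ℂ := fun x => Complex.exp ((Real.sqrt 2 * r * x : ℝ) * Complex.I) with he
  have hed : ∀ x, HasDerivAt e (Real.sqrt 2 * r * Complex.I * e x) x := fun x => by
    have h1 : HasDerivAt (fun x : ℝ => ((Real.sqrt 2 * r * x : ℝ) : ℂ) * Complex.I)
        (Real.sqrt 2 * r * Complex.I) x := by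
      have := (((hasDerivAt_id x).const_mul (Real.sqrt 2 * r)).ofReal_comp).mul_const Complex.I
      simpa using this
    exact h1.cexp.congr_deriv (mul_comm _ _)
  have i1 := integrable_ofReal_mul_cexp ((memLp_dpsi m).integrable_mul (memLp_psi_real n))
    (Real.sqrt 2 * r)
  have i2 := integrable_ofReal_mul_cexp ((memLp_psi_real m).integrable_mul (memLp_dpsi n))
    (Real.sqrt 2 * r)
  have i3 := integrable_ofReal_mul_cexp (integrable_psi_mul_psi m n) (Real.sqrt 2 * r)
  have i4 := integrable_ofReal_mul_cexp (integrable_psi_mul_psi (m + 1) n) (Real.sqrt 2 * r)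
  have i5 := integrable_ofReal_mul_cexp (integrable_psi_mul_psi m (n - 1)) (Real.sqrt 2 * r)
  simp only [Pi.mul_apply] at i1 i2
  have hd : ∀ x, HasDerivAt (fun x => ((psi m x * psi n x : ℝ) : ℂ) * e x)
      (((dpsi m x * psi n x : ℝ) : ℂ) * e x + ((psi m x * dpsi n x : ℝ) : ℂ) * e x +
        (Real.sqrt 2 * r * Complex.I) * (((psi m x * psi n x : ℝ) : ℂ) * e x)) x := fun x => by
    refine ((hasDerivAt_psi_mul_psi m n x).ofReal_comp.mul (hed x)).congr_deriv ?_
    push_cast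
    ring
  have hzero := integral_eq_zero_of_hasDerivAt_of_integrable hd
    ((i1.add i2).add (i3.const_mul _)) i3
  have hkey : ∫ x, ((Real.sqrt (2 * n) : ℂ) * (((psi m x * psi (n - 1) x : ℝ) : ℂ) * e x) +
        (Real.sqrt 2 * r * Complex.I) * (((psi m x * psi n x : ℝ) : ℂ) * e x) -
        (Real.sqrt (2 * (m + 1)) : ℂ) * (((psi (m + 1) x * psi n x : ℝ) : ℂ) * e x)) = 0 := by
    rw [← hzero]
    refine integral_congr_ae (Filter.Eventually.of_forall fun x => ?_)
    have h1 : ((x * psi m x - dpsi m x : ℝ) : ℂ) =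
        (Real.sqrt (2 * (m + 1)) : ℂ) * psi (m + 1) x := by
      exact_mod_cast mul_psi_sub_dpsi m x
    have h2 : ((dpsi n x : ℝ) : ℂ) = (Real.sqrt (2 * n) : ℂ) * psi (n - 1) x - x * psi n x := by
      simp [dpsi]
    push_cast at h1 ⊢
    linear_combination ((psi n x : ℂ) * e x) * h1 - (psi m x : ℂ) * e x * h2
  have i53 := (i5.const_mul (Real.sqrt (2 * n) : ℂ)).add
    (i3.const_mul (Real.sqrt 2 * r * Complex.I))
  simp only [Pi.add_def] at i53
  rw [integral_sub i53 (i4.const_mul _), integral_add (i5.const_mul _) (i3.const_mul _),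
    integral_const_mul, integral_const_mul, integral_const_mul] at hkey
  change (Real.sqrt (2 * n) : ℂ) * overlap m (n - 1) r + _ * overlap m n r -
    _ * overlap (m + 1) n r = 0 at hkey
  have h2 : (Real.sqrt 2 : ℂ) ≠ 0 := by
    exact_mod_cast (show Real.sqrt 2 ≠ 0 by positivity)
  rw [Real.sqrt_mul (by norm_num), Real.sqrt_mul (by norm_num)] at hkey
  apply mul_left_cancel₀ h2
  push_cast at hkey
  linear_combination -hkey

theorem overlap_zero_zero (r : ℝ) : overlap 0 0 r = Real.exp (-r ^ 2 / 2) := by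
  have hpi := Real.pi_pos
  have h1 : ∀ x : ℝ, ((psi 0 x * psi 0 x : ℝ) : ℂ) *
      Complex.exp ((Real.sqrt 2 * r * x : ℝ) * Complex.I) =
      ((Real.sqrt Real.pi)⁻¹ : ℝ) * (Complex.exp (Complex.I * (Real.sqrt 2 * r : ℝ) * x) *
        Complex.exp (-1 * (x : ℂ) ^ 2)) := fun x => by
    have h2 : psi 0 x * psi 0 x = (Real.sqrt Real.pi)⁻¹ * Real.exp (-x ^ 2) := by
      have e1 : Real.exp (-x ^ 2 / 2) * Real.exp (-x ^ 2 / 2) = Real.exp (-x ^ 2) := by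
        rw [← Real.exp_add]; congr 1; ring
      have e2 : (Real.sqrt (Real.sqrt Real.pi))⁻¹ * (Real.sqrt (Real.sqrt Real.pi))⁻¹
          = (Real.sqrt Real.pi)⁻¹ := by
        rw [← mul_inv, Real.mul_self_sqrt (by positivity)]
      simp only [psi, Polynomial.hermite_zero, Nat.factorial_zero, Nat.cast_one, one_mul,
        map_one, mul_one]
      rw [← e1, ← e2]; ring
    rw [h2]
    push_cast
    ring_nf
  simp only [overlap, h1]
  rw [integral_const_mul, fourierIntegral_gaussian (by norm_num)]
  have h3 : ((Real.pi : ℂ) / 1) ^ (1 / 2 : ℂ) = (Real.sqrt Real.pi : ℂ) := by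
    rw [div_one, Real.sqrt_eq_rpow, Complex.ofReal_cpow hpi.le]
    norm_num
  rw [h3, ← mul_assoc, ← Complex.ofReal_mul, inv_mul_cancel₀ (by positivity)]
  have h4 : ((Real.sqrt 2 * r : ℝ) : ℂ) ^ 2 = ((2 * r ^ 2 : ℝ) : ℂ) := by
    rw [← Complex.ofReal_pow, mul_pow, Real.sq_sqrt (by norm_num)]
  rw [h4]
  push_cast
  rw [one_mul]
  congr 1
  ring

/-- `z^{m-l} / (m-l)!`, understood as zero if `m < l`. -/
noncomputable def divPow (z : ℂ) (m l : ℕ) : ℂ :=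
  if l ≤ m then z ^ (m - l) / ((m - l).factorial : ℂ) else 0

theorem succ_mul_divPow (z : ℂ) (m l : ℕ) :
    (m + 1 : ℂ) * divPow z (m + 1) l = z * divPow z m l + l * divPow z (m + 1) l := by
  unfold divPow
  rcases lt_trichotomy l (m + 1) with h | h | h
  · have hl : l ≤ m := by omega
    obtain ⟨t, rfl⟩ := Nat.exists_eq_add_of_le hl
    rw [if_pos hl, if_pos (by omega), show l + t + 1 - l = t + 1 by omega,
      show l + t - l = t by omega, Nat.factorial_succ]
    have h1 : (t.factorial : ℂ) ≠ 0 := by exact_mod_cast t.factorial_ne_zero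
    have h2 : (t : ℂ) + 1 ≠ 0 := by exact_mod_cast t.succ_ne_zero
    push_cast
    field_simp
    ring
  · subst h
    simp
  · rw [if_neg (by omega), if_neg (by omega)]
    simp

/-- The coefficients of the generating function `e^{zs + zt + st}`. -/
noncomputable def genCoeff (z : ℂ) (m n : ℕ) : ℂ :=
  ∑ l ∈ Finset.range (m + 1), divPow z m l * divPow z n l / (l.factorial : ℂ)

theorem succ_mul_genCoeff (z : ℂ) (m n : ℕ) :
    (m + 1 : ℂ) * genCoeff z (m + 1) n =
      (if n = 0 then 0 else genCoeff z m (n - 1)) + z * genCoeff z m n := by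
  have h1 : (m + 1 : ℂ) * genCoeff z (m + 1) n =
      z * (∑ l ∈ Finset.range (m + 2), divPow z m l * divPow z n l / (l.factorial : ℂ)) +
      ∑ l ∈ Finset.range (m + 2), l * divPow z (m + 1) l * divPow z n l / (l.factorial : ℂ) := by
    rw [genCoeff, Finset.mul_sum, Finset.mul_sum, ← Finset.sum_add_distrib]
    refine Finset.sum_congr rfl fun l _ => ?_
    linear_combination (divPow z n l / (l.factorial : ℂ)) * succ_mul_divPow z m l
  have h2 : ∑ l ∈ Finset.range (m + 2), divPow z m l * divPow z n l / (l.factorial : ℂ)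
      = genCoeff z m n := by
    rw [Finset.sum_range_succ, genCoeff]
    simp [divPow]
  have h3 : ∑ l ∈ Finset.range (m + 2), l * divPow z (m + 1) l * divPow z n l / (l.factorial : ℂ)
      = if n = 0 then 0 else genCoeff z m (n - 1) := by
    rw [Finset.sum_range_succ']
    simp only [Nat.cast_zero, zero_mul, zero_div, add_zero]
    split_ifs with hn
    · subst hn
      exact Finset.sum_eq_zero fun l _ => by simp [divPow]
    · obtain ⟨n, rfl⟩ := Nat.exists_eq_succ_of_ne_zero hn
      refine Finset.sum_congr rfl fun l _ => ?_
      have e : ∀ m l, divPow z (m + 1) (l + 1) = divPow z m l := fun m l => by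
        simp [divPow]
      rw [Nat.succ_eq_add_one, e, e, Nat.factorial_succ, Nat.add_sub_cancel]
      have f1 : (l.factorial : ℂ) ≠ 0 := by exact_mod_cast l.factorial_ne_zero
      have f2 : (l : ℂ) + 1 ≠ 0 := by exact_mod_cast l.succ_ne_zero
      push_cast
      field_simp
  rw [h1, h2, h3, add_comm]

theorem ofReal_sqrt_factorial_succ (n : ℕ) :
    (Real.sqrt (n + 1) : ℂ) * Real.sqrt n.factorial = Real.sqrt (n + 1).factorial := by
  rw [← Complex.ofReal_mul, ← Real.sqrt_mul (by positivity), Nat.factorial_succ]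
  push_cast
  rfl

theorem ofReal_sqrt_mul_self {a : ℝ} (ha : 0 ≤ a) : (Real.sqrt a : ℂ) * Real.sqrt a = a := by
  rw [← Complex.ofReal_mul, Real.mul_self_sqrt ha]

/-- Both sides satisfy the recurrence `sqrt_mul_overlap_succ` with the same initial value. -/
theorem overlap_eq (m n : ℕ) (r : ℝ) : overlap m n r =
    Real.exp (-r ^ 2 / 2) * (Real.sqrt m.factorial * Real.sqrt n.factorial) *
      genCoeff (Complex.I * r) m n := by
  have hs : ∀ n : ℕ, (Real.sqrt ((n : ℝ) + 1) : ℂ) ≠ 0 := fun n => by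
    exact_mod_cast (show Real.sqrt ((n : ℝ) + 1) ≠ 0 by positivity)
  induction m generalizing n with
  | zero =>
    rw [overlap_comm]
    induction n with
    | zero => simp [overlap_zero_zero, genCoeff, divPow]
    | succ n ih =>
      apply mul_left_cancel₀ (hs n)
      rw [sqrt_mul_overlap_succ, ih, ← ofReal_sqrt_factorial_succ]
      have f1 : (n.factorial : ℂ) ≠ 0 := by exact_mod_cast n.factorial_ne_zero
      have f2 : (n : ℂ) + 1 ≠ 0 := by exact_mod_cast n.succ_ne_zero
      have f3 := ofReal_sqrt_mul_self (show (0 : ℝ) ≤ n + 1 by positivity)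
      push_cast at f3
      have f4 : ((n + 1).factorial : ℂ) = (n + 1) * n.factorial := by
        rw [Nat.factorial_succ]; push_cast; ring
      simp only [genCoeff, divPow, zero_add, Finset.sum_range_one]
      simp
      rw [f4]
      field_simp
      rw [pow_succ]
      linear_combination (-(Complex.I * r) ^ n * (Complex.I * r) * Real.sqrt n.factorial) * f3
  | succ m ih =>
    apply mul_left_cancel₀ (hs m)
    have f3 := ofReal_sqrt_mul_self (show (0 : ℝ) ≤ m + 1 by positivity)
    push_cast at f3
    have hg := succ_mul_genCoeff (Complex.I * r) m n
    rw [sqrt_mul_overlap_succ, ih, ih, ← ofReal_sqrt_factorial_succ]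
    rcases Nat.eq_zero_or_pos n with hn | hn
    · subst hn
      simp only [if_true] at hg
      simp only [Nat.cast_zero, Real.sqrt_zero, Complex.ofReal_zero, zero_mul, zero_add] at hg ⊢
      linear_combination (-((Real.exp (-r ^ 2 / 2) : ℝ) : ℂ) *
        (Real.sqrt m.factorial * Real.sqrt (Nat.factorial 0))) * hg -
        ((Real.exp (-r ^ 2 / 2) : ℝ) : ℂ) * (Real.sqrt m.factorial * Real.sqrt (Nat.factorial 0)) *
        genCoeff (Complex.I * r) (m + 1) 0 * f3
    · obtain ⟨n, rfl⟩ := Nat.exists_eq_succ_of_ne_zero hn.ne'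
      have f5 := ofReal_sqrt_factorial_succ n
      rw [if_neg (by omega)] at hg
      simp only [Nat.succ_eq_add_one, Nat.add_sub_cancel] at hg ⊢
      rw [← f5, show ((n + 1 : ℕ) : ℝ) = (n : ℝ) + 1 by push_cast; ring]
      linear_combination (-((Real.exp (-r ^ 2 / 2) : ℝ) : ℂ) *
        (Real.sqrt m.factorial * (Real.sqrt (n + 1) * Real.sqrt n.factorial))) * hg -
        ((Real.exp (-r ^ 2 / 2) : ℝ) : ℂ) *
        (Real.sqrt m.factorial * (Real.sqrt (n + 1) * Real.sqrt n.factorial)) *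
        genCoeff (Complex.I * r) (m + 1) (n + 1) * f3

/-- The characteristic function of `ψ_j ψ_{j+d}` is a Laguerre function. -/
theorem overlap_eq_ell (j d : ℕ) (r : ℝ) : overlap j (j + d) r = Complex.I ^ d * ell j d r := by
  have hc : (Real.sqrt j.factorial : ℝ) * Real.sqrt (j + d).factorial =
      Real.sqrt ((j.factorial : ℝ) / ((j + d).factorial : ℝ)) * (j + d).factorial := by
    rw [Real.sqrt_div (by positivity), div_mul_eq_mul_div, mul_div_assoc, Real.div_sqrt]
  have hg : genCoeff (Complex.I * r) j (j + d) * (j + d).factorial =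
      Complex.I ^ d * (r : ℂ) ^ d * (laguerre j d (r ^ 2) : ℂ) := by
    rw [genCoeff, laguerre, ← Finset.sum_range_reflect, Finset.sum_mul]
    push_cast
    rw [Finset.mul_sum]
    refine Finset.sum_congr rfl fun i hi => ?_
    obtain ⟨t, rfl⟩ := Nat.exists_eq_add_of_le (Nat.lt_succ_iff.1 (Finset.mem_range.1 hi))
    rw [show i + t - i = t by omega,
      Nat.cast_choose ℂ (show t ≤ i + t + d by omega), divPow, divPow, if_pos (by omega),
      if_pos (by omega), show i + t - t = i by omega, show i + t + d - t = i + d by omega]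
    have h1 : (Complex.I * (r : ℂ)) ^ i * (Complex.I * r) ^ (i + d) =
        Complex.I ^ d * (r : ℂ) ^ d * ((-1) ^ i * ((r : ℂ) ^ 2) ^ i) := by
      rw [pow_add, ← mul_assoc, ← mul_pow (Complex.I * (r : ℂ)), mul_pow _ _ d]
      rw [show Complex.I * (r : ℂ) * (Complex.I * r) = -1 * (r : ℂ) ^ 2 by
        linear_combination (r : ℂ) ^ 2 * Complex.I_mul_I, mul_pow]
      ring
    have f1 : ((i + d).factorial : ℂ) ≠ 0 := by exact_mod_cast Nat.factorial_ne_zero _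
    have f2 : (t.factorial : ℂ) ≠ 0 := by exact_mod_cast Nat.factorial_ne_zero _
    have f3 : (i.factorial : ℂ) ≠ 0 := by exact_mod_cast Nat.factorial_ne_zero _
    field_simp
    linear_combination ((i + t + d).factorial : ℂ) * h1
  have hc' : (Real.sqrt j.factorial : ℂ) * Real.sqrt (j + d).factorial =
      Real.sqrt ((j.factorial : ℝ) / ((j + d).factorial : ℝ)) * (j + d).factorial := by
    exact_mod_cast hc
  rw [overlap_eq, hc', ell]
  push_cast
  linear_combination (Complex.exp (-r ^ 2 / 2) *
    Real.sqrt ((j.factorial : ℝ) / ((j + d).factorial : ℝ))) * hg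

theorem ell_zero_right (j d : ℕ) : ell j d 0 = if d = 0 then 1 else 0 := by
  rcases Nat.eq_zero_or_pos d with h | h
  · subst h
    have : laguerre j 0 (0 ^ 2) = 1 := by
      rw [laguerre, Finset.sum_eq_single_of_mem 0 (by simp) (fun b _ hb => by simp [hb])]
      simp
    rw [ell, this]
    have f1 : (j.factorial : ℝ) ≠ 0 := by positivity
    simp [f1]
  · simp [ell, h.ne']

/-- The Hermite functions are orthonormal. -/
theorem integral_psi_mul_psi (j k : ℕ) :
    ∫ x, psi j x * psi k x = if j = k then 1 else 0 := by
  have key : ∀ j d : ℕ, ∫ x, psi j x * psi (j + d) x = if d = 0 then 1 else 0 := by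
    intro j d
    have h := overlap_eq_ell j d 0
    simp only [overlap, mul_zero, zero_mul, Complex.ofReal_zero, Complex.exp_zero, mul_one] at h
    rw [integral_complex_ofReal, ell_zero_right] at h
    split_ifs at h ⊢ with hd
    · subst hd
      simp only [pow_zero, Complex.ofReal_one, mul_one] at h
      exact_mod_cast h
    · simp only [Complex.ofReal_zero, mul_zero] at h
      exact_mod_cast h
  rcases le_total j k with h | h
  · obtain ⟨d, rfl⟩ := Nat.exists_eq_add_of_le h
    rw [key]
    simp
  · obtain ⟨d, rfl⟩ := Nat.exists_eq_add_of_le h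
    simp_rw [mul_comm (psi (k + d) _)]
    rw [key]
    simp

/-! ### Pattern functions: inversion, biorthogonality, symmetry -/

theorem patternAux_eq (j d : ℕ) (x : ℝ) : patternAux j d x =
    ∫ r : ℝ, |r| * ell j d r * Real.cos (Real.sqrt 2 * r * x - d * (Real.pi / 2)) := by
  rw [patternAux, ← integral_const_mul]
  refine integral_congr_ae (Filter.Eventually.of_forall fun r => ?_)
  simp only [ell]
  ring

theorem cexp_sub_mul_I_pow (d : ℕ) (θ : ℝ) :
    Complex.exp (((θ - d * (Real.pi / 2) : ℝ) : ℂ) * Complex.I) * Complex.I ^ d =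
      Complex.exp ((θ : ℂ) * Complex.I) := by
  have h : Complex.I ^ d = Complex.exp (((d * (Real.pi / 2) : ℝ) : ℂ) * Complex.I) := by
    have : (((d * (Real.pi / 2) : ℝ) : ℂ) * Complex.I) = d * ((Real.pi / 2 : ℂ) * Complex.I) := by
      push_cast; ring
    rw [this, Complex.exp_nat_mul, Complex.exp_pi_div_two_mul_I]
  rw [h, ← Complex.exp_add]
  congr 1
  push_cast
  ring

theorem re_ofReal_mul_cexp (a θ : ℝ) :
    ((a : ℂ) * Complex.exp ((θ : ℂ) * Complex.I)).re = a * Real.cos θ := by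
  rw [Complex.re_ofReal_mul, Complex.exp_ofReal_mul_I_re]

theorem integral_psi_mul_psi_mul_cos (m d : ℕ) (r : ℝ) :
    ∫ x, psi m x * psi (m + d) x * Real.cos (Real.sqrt 2 * r * x - d * (Real.pi / 2)) =
      ell m d r := by
  have hI : Complex.I ^ d ≠ 0 := pow_ne_zero d Complex.I_ne_zero
  have h : ∫ x, ((psi m x * psi (m + d) x : ℝ) : ℂ) *
      Complex.exp (((Real.sqrt 2 * r * x - d * (Real.pi / 2) : ℝ) : ℂ) * Complex.I) =
      ell m d r := by
    apply mul_right_cancel₀ hI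
    rw [← integral_mul_const, mul_comm (ell m d r : ℂ), ← overlap_eq_ell, overlap]
    refine integral_congr_ae (Filter.Eventually.of_forall fun x => ?_)
    simp only
    rw [mul_assoc, cexp_sub_mul_I_pow]
  have hint : Integrable (fun x => ((psi m x * psi (m + d) x : ℝ) : ℂ) *
      Complex.exp (((Real.sqrt 2 * r * x - d * (Real.pi / 2) : ℝ) : ℂ) * Complex.I)) := by
    have := (integrable_ofReal_mul_cexp (integrable_psi_mul_psi m (m + d))
      (Real.sqrt 2 * r)).mul_const (Complex.I ^ d)⁻¹
    refine this.congr (Filter.Eventually.of_forall fun x => ?_)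
    simp only
    rw [← cexp_sub_mul_I_pow d, ← mul_assoc, mul_inv_cancel_right₀ hI]
  have h2 := congrArg Complex.re h
  rw [Complex.ofReal_re] at h2
  have h3 := integral_re hint
  simp only [RCLike.re_to_complex] at h3
  rw [← h2, ← h3]
  refine integral_congr_ae (Filter.Eventually.of_forall fun x => ?_)
  simp only
  exact (re_ofReal_mul_cexp _ _).symm

/-- Fourier inversion of `integral_psi_mul_psi_mul_cos`. -/
theorem integral_ell_mul_cos (j d : ℕ) (x : ℝ) :
    ∫ r, ell j d r * Real.cos (Real.sqrt 2 * r * x - d * (Real.pi / 2)) =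
      Real.sqrt 2 * Real.pi * (psi j x * psi (j + d) x) := by
  set g : ℝ → ℂ := fun x => ((psi j x * psi (j + d) x : ℝ) : ℂ) with hg
  set a : ℝ := -(Real.sqrt 2 * Real.pi) with ha
  have hpi := Real.pi_pos
  have ha0 : a ≠ 0 := neg_ne_zero.2 (by positivity)
  have h2 : Real.sqrt 2 * Real.sqrt 2 = 2 := Real.mul_self_sqrt (by norm_num)
  have hF : FourierTransform.fourier g = fun w : ℝ => Complex.I ^ d * (ell j d (a * w) : ℂ) := by
    ext w
    rw [Real.fourier_real_eq_integral_exp_smul, ← overlap_eq_ell, overlap]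
    refine integral_congr_ae (Filter.Eventually.of_forall fun v => ?_)
    simp only [hg, smul_eq_mul]
    rw [mul_comm]
    congr 4
    simp only [ha]
    linear_combination (Real.pi * w * v) * h2
  have hcont : Continuous g := by
    have h1 := continuous_psi j
    have h3 := continuous_psi (j + d)
    simp only [hg]
    fun_prop
  have hFi : Integrable (FourierTransform.fourier g) := by
    rw [hF]
    have h1 : Integrable (fun r : ℝ => (ell j d r : ℂ)) := (integrable_ell j d).ofReal
    exact (h1.comp_mul_left' ha0).const_mul _
  have hgi : Integrable g := (integrable_psi_mul_psi j (j + d)).ofReal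
  have hinv := congrFun (hcont.fourierInv_fourier_eq hgi hFi) x
  set F : ℝ → ℂ := fun r => (ell j d r : ℂ) *
    Complex.exp (((-(Real.sqrt 2 * r * x - d * (Real.pi / 2)) : ℝ) : ℂ) * Complex.I) with hFdef
  rw [Real.fourierInv_eq', hF] at hinv
  have h3 : ∀ w : ℝ, Complex.exp (((2 * Real.pi * inner ℝ w x : ℝ) : ℂ) * Complex.I) •
      (Complex.I ^ d * (ell j d (a * w) : ℂ)) = F (a * w) := fun w => by
    have h4 := cexp_sub_mul_I_pow d (-(Real.sqrt 2 * (a * w) * x - d * (Real.pi / 2)))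
    simp only [hFdef, smul_eq_mul]
    rw [← h4]
    have h5 : 2 * Real.pi * inner ℝ w x =
        -(Real.sqrt 2 * (a * w) * x - d * (Real.pi / 2)) - d * (Real.pi / 2) := by
      have : inner ℝ w x = w * x := by simp [mul_comm]
      rw [this, ha]
      linear_combination (-Real.pi * w * x) * h2
    rw [h5]
    ring
  simp_rw [h3] at hinv
  rw [Measure.integral_comp_mul_left F a] at hinv
  have hFint : Integrable F := by
    refine ((integrable_ell j d).ofReal (𝕜 := ℂ)).mono (by have := continuous_ell j d; fun_prop)
      (Filter.Eventually.of_forall fun r => ?_)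
    simp only [hFdef]
    rw [norm_mul, Complex.norm_exp_ofReal_mul_I, mul_one]
    rfl
  have h6 := integral_re hFint
  simp only [RCLike.re_to_complex] at h6
  have h7 : ∀ r, (F r).re = ell j d r * Real.cos (Real.sqrt 2 * r * x - d * (Real.pi / 2)) :=
    fun r => by
      simp only [hFdef]
      rw [re_ofReal_mul_cexp, Real.cos_neg]
  simp_rw [h7] at h6
  rw [h6]
  have h8 : |a⁻¹| = (Real.sqrt 2 * Real.pi)⁻¹ := by
    rw [abs_inv, ha, abs_neg, abs_of_pos (by positivity)]
  have h9 := congrArg Complex.re hinv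
  rw [h8, Complex.smul_re, smul_eq_mul] at h9
  simp only [hg, Complex.ofReal_re] at h9
  rw [← h9, mul_inv_cancel_left₀ (by positivity)]

theorem integrable_prod_mul_of_bounded {f g : ℝ → ℝ} (hf : Integrable f) (hg : Integrable g)
    {h : ℝ × ℝ → ℝ} (hc : Continuous h) (hb : ∀ p, |h p| ≤ 1) :
    Integrable (fun p : ℝ × ℝ => f p.1 * g p.2 * h p) (volume.prod volume) := by
  have h1 := hf.mul_prod hg
  refine h1.mono (h1.aestronglyMeasurable.mul hc.aestronglyMeasurable)
    (Filter.Eventually.of_forall fun p => ?_)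
  rw [norm_mul]
  exact mul_le_of_le_one_right (norm_nonneg _) (hb p)

/-- Biorthogonality of the pattern functions and the products of Hermite functions. -/
theorem integral_patternAux_mul (j m d : ℕ) :
    ∫ x, patternAux j d x * (psi m x * psi (m + d) x) = if j = m then 1 else 0 := by
  rw [← integral_ell_mul_ell j m d]
  simp_rw [patternAux_eq, ← integral_mul_const]
  have hi := integrable_prod_mul_of_bounded (integrable_psi_mul_psi m (m + d))
    (integrable_abs_mul_ell j d)
    (h := fun p => Real.cos (Real.sqrt 2 * p.2 * p.1 - d * (Real.pi / 2))) (by fun_prop)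
    (fun p => Real.abs_cos_le_one _)
  rw [integral_integral_swap (f := fun x r => |r| * ell j d r *
    Real.cos (Real.sqrt 2 * r * x - d * (Real.pi / 2)) * (psi m x * psi (m + d) x))
    (hi.congr (Filter.Eventually.of_forall fun p => by simp only [Function.uncurry]; ring))]
  refine integral_congr_ae (Filter.Eventually.of_forall fun r => ?_)
  simp only
  rw [← integral_psi_mul_psi_mul_cos m d r, ← integral_const_mul]
  refine integral_congr_ae (Filter.Eventually.of_forall fun x => ?_)
  simp only
  ring

theorem patternAux_neg (j d : ℕ) (x : ℝ) : patternAux j d (-x) = (-1) ^ d * patternAux j d x := by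
  rw [patternAux_eq, patternAux_eq, ← integral_const_mul, ← integral_neg_eq_self]
  refine integral_congr_ae (Filter.Eventually.of_forall fun r => ?_)
  simp only [ell, abs_neg, neg_sq, neg_pow r d, mul_neg, neg_mul, neg_neg]
  ring

theorem continuous_patternAux (j d : ℕ) : Continuous (patternAux j d) := by
  have : patternAux j d = fun x => ∫ r : ℝ, |r| * ell j d r *
      Real.cos (Real.sqrt 2 * r * x - d * (Real.pi / 2)) := funext fun x => patternAux_eq j d x
  rw [this]
  have hc := continuous_ell j d
  refine continuous_of_dominated (bound := fun r => ‖|r| * ell j d r‖)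
    (fun x => by fun_prop) (fun x => Filter.Eventually.of_forall fun r => ?_)
    (integrable_abs_mul_ell j d).norm (Filter.Eventually.of_forall fun r => by fun_prop)
  rw [norm_mul]
  exact mul_le_of_le_one_right (norm_nonneg _) (Real.abs_cos_le_one _)

/-! ### An interpolation inequality for the operator `|d/dx|` -/

theorem one_sub_cos_div_sq_le (r h : ℝ) :
    |(1 - Real.cos (r * h)) / h ^ 2| ≤ (1 + r ^ 2) * (4 * (1 + h ^ 2)⁻¹) := by
  have h1 : 0 ≤ 1 - Real.cos (r * h) := by linarith [Real.cos_le_one (r * h)]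
  have h2 : 1 - Real.cos (r * h) ≤ 2 := by linarith [Real.neg_one_le_cos (r * h)]
  have h3 : 1 - Real.cos (r * h) ≤ (r * h) ^ 2 / 2 := by
    linarith [Real.one_sub_sq_div_two_le_cos (x := r * h)]
  rw [abs_of_nonneg (by positivity)]
  rcases eq_or_ne h 0 with rfl | hh
  · simp; positivity
  have hh2 : 0 < h ^ 2 := by positivity
  rw [div_le_iff₀ hh2, ← div_eq_mul_inv, mul_div_assoc', div_mul_eq_mul_div,
    le_div_iff₀ (by positivity)]
  rcases le_total (h ^ 2) 1 with h4 | h4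
  · nlinarith [sq_nonneg r, mul_nonneg (sq_nonneg r) hh2.le]
  · nlinarith [sq_nonneg r, mul_nonneg (sq_nonneg r) hh2.le]

theorem integrable_one_sub_cos_div_sq : Integrable (fun h : ℝ => (1 - Real.cos h) / h ^ 2) := by
  refine ((integrable_inv_one_add_sq.const_mul 4).const_mul (1 + (1 : ℝ) ^ 2)).mono
    (Measurable.aestronglyMeasurable (by fun_prop)) (Filter.Eventually.of_forall fun h => ?_)
  have := one_sub_cos_div_sq_le 1 h
  rw [one_mul] at this
  rw [Real.norm_eq_abs]
  exact this.trans (le_abs_self _)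

/-- The constant `∫ (1 - cos h) / h² dh`; its value `π` is irrelevant. -/
noncomputable def cosConst : ℝ := ∫ h : ℝ, (1 - Real.cos h) / h ^ 2

theorem cosConst_pos : 0 < cosConst := by
  unfold cosConst
  rw [integral_pos_iff_support_of_nonneg (fun h => ?_) integrable_one_sub_cos_div_sq]
  · refine lt_of_lt_of_le ?_ (measure_mono (s := Set.Ioo (0 : ℝ) 1) fun h hh => ?_)
    · simp
    · have h1 : Real.cos h < 1 := by
        rw [← Real.cos_zero]
        exact Real.cos_lt_cos_of_nonneg_of_le_pi le_rfl (by linarith [hh.2, Real.pi_gt_three]) hh.1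
      exact (div_pos (by linarith) (pow_pos hh.1 2)).ne'
  · exact div_nonneg (by linarith [Real.cos_le_one h]) (sq_nonneg _)

theorem integral_one_sub_cos_mul_div_sq (a : ℝ) :
    ∫ h : ℝ, (1 - Real.cos (a * h)) / h ^ 2 = |a| * cosConst := by
  rcases eq_or_ne a 0 with rfl | ha
  · simp
  have h1 : ∀ h : ℝ, (1 - Real.cos (a * h)) / h ^ 2 =
      a ^ 2 * ((1 - Real.cos (a * h)) / (a * h) ^ 2) := fun h => by
    rcases eq_or_ne h 0 with rfl | hh
    · simp
    · field_simp
  simp_rw [h1]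
  rw [integral_const_mul, Measure.integral_comp_mul_left (fun t => (1 - Real.cos t) / t ^ 2) a,
    smul_eq_mul, ← mul_assoc, abs_inv, ← sq_abs a, sq]
  rw [mul_assoc |a|, mul_inv_cancel₀ (abs_ne_zero.2 ha), mul_one]
  rfl

theorem abs_second_difference_le {g g' g'' : ℝ → ℝ} {B : ℝ} (hg : ∀ x, HasDerivAt g (g' x) x)
    (hg' : ∀ x, HasDerivAt g' (g'' x) x) (hB : ∀ x, |g'' x| ≤ B) (x h : ℝ) :
    |2 * g x - g (x + h) - g (x - h)| ≤ B * h ^ 2 := by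
  have hpos : ∀ h, 0 ≤ h → |2 * g x - g (x + h) - g (x - h)| ≤ B * h ^ 2 := by
    intro h hh
    have hd : ∀ t, HasDerivAt (fun t => 2 * g x - g (x + t) - g (x - t))
        (-g' (x + t) + g' (x - t)) t := fun t => by
      have h1 := (hg (x + t)).comp t ((hasDerivAt_id t).const_add x)
      have h2 := (hg (x - t)).comp t ((hasDerivAt_id t).const_sub x)
      refine (((hasDerivAt_const t (2 * g x)).sub h1).sub h2).congr_deriv ?_
      ring
    have hbd : ∀ t, 0 ≤ t → |(-g' (x + t) + g' (x - t))| ≤ 2 * B * t := fun t ht => by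
      have := convex_univ.norm_image_sub_le_of_norm_hasDerivWithin_le
        (fun u _ => (hg' u).hasDerivWithinAt) (fun u _ => hB u) (Set.mem_univ (x - t))
        (Set.mem_univ (x + t))
      rw [Real.norm_eq_abs, Real.norm_eq_abs, show x + t - (x - t) = 2 * t by ring,
        abs_of_nonneg (show 0 ≤ 2 * t by linarith), abs_sub_comm] at this
      rw [show -g' (x + t) + g' (x - t) = g' (x - t) - g' (x + t) by ring]
      linarith
    have hsq : ∀ t, HasDerivAt (fun t => B * t ^ 2) (2 * B * t) t := fun t => by
      refine ((hasDerivAt_pow 2 t).const_mul B).congr_deriv ?_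
      push_cast; ring
    have m1 := antitoneOn_of_hasDerivAt_nonpos (convex_Ici 0) (fun t _ => (hd t).sub (hsq t))
      fun t ht => by linarith [(abs_le.1 (hbd t ht)).2]
    have m2 := antitoneOn_of_hasDerivAt_nonpos (convex_Ici 0)
      (fun t _ => ((hd t).neg).sub (hsq t)) fun t ht => by linarith [(abs_le.1 (hbd t ht)).1]
    have e1 := m1 (Set.mem_Ici.2 le_rfl) (Set.mem_Ici.2 hh) hh
    have e2 := m2 (Set.mem_Ici.2 le_rfl) (Set.mem_Ici.2 hh) hh
    simp at e1 e2
    rw [abs_le]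
    constructor <;> linarith
  rcases le_total 0 h with hh | hh
  · exact hpos h hh
  · have := hpos (-h) (by linarith)
    rw [show x + -h = x - h by ring, show x - -h = x + h by ring, neg_sq] at this
    rwa [show 2 * g x - g (x + h) - g (x - h) = 2 * g x - g (x - h) - g (x + h) by ring]

/-- The operator `g ↦ ∫ (2 g(x) - g(x+h) - g(x-h)) / h² dh`, a multiple of `|d/dx|`, is controlled
by the geometric mean of the sup norms of `g` and `g''`. -/
theorem abs_integral_second_difference_le {g g' g'' : ℝ → ℝ} {G B : ℝ}
    (hg : ∀ x, HasDerivAt g (g' x) x) (hg' : ∀ x, HasDerivAt g' (g'' x) x)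
    (hG : 0 < G) (hB : 0 < B) (hgG : ∀ x, |g x| ≤ G) (hgB : ∀ x, |g'' x| ≤ B) (x : ℝ) :
    |∫ h : ℝ, (2 * g x - g (x + h) - g (x - h)) / h ^ 2| ≤ 8 * Real.pi * Real.sqrt (G * B) := by
  set a := Real.sqrt (B / G) with ha
  have ha0 : 0 < a := Real.sqrt_pos.2 (by positivity)
  have hasq : a ^ 2 = B / G := Real.sq_sqrt (by positivity)
  have hint : Integrable (fun h : ℝ => 8 * B * (1 + (a * h) ^ 2)⁻¹) :=
    (integrable_inv_one_add_sq.comp_mul_left' ha0.ne').const_mul _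
  have h1 : ∀ h : ℝ, ‖(2 * g x - g (x + h) - g (x - h)) / h ^ 2‖ ≤ 8 * B * (1 + (a * h) ^ 2)⁻¹ := by
    intro h
    rcases eq_or_ne h 0 with rfl | hh
    · simp; positivity
    have hh2 : 0 < h ^ 2 := by positivity
    rw [Real.norm_eq_abs, abs_div, abs_of_pos hh2, mul_pow, hasq, div_le_iff₀ hh2,
      ← div_eq_mul_inv, div_mul_eq_mul_div, le_div_iff₀ (by positivity)]
    have hT := abs_second_difference_le hg hg' hgB x h
    have hS : |2 * g x - g (x + h) - g (x - h)| ≤ 4 * G := by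
      have := hgG x
      have := hgG (x + h)
      have := hgG (x - h)
      simp only [abs_le] at *
      constructor <;> linarith
    have e : |2 * g x - g (x + h) - g (x - h)| * (1 + B / G * h ^ 2) =
        |2 * g x - g (x + h) - g (x - h)| +
          |2 * g x - g (x + h) - g (x - h)| / G * (B * h ^ 2) := by ring
    have h5 : |2 * g x - g (x + h) - g (x - h)| / G ≤ 4 := by rwa [div_le_iff₀ hG]
    rw [e]
    have h6 : 0 ≤ B * h ^ 2 := by positivity
    nlinarith
  refine (norm_integral_le_of_norm_le hint (Filter.Eventually.of_forall h1)).trans (le_of_eq ?_)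
  rw [integral_const_mul, Measure.integral_comp_mul_left (fun t => (1 + t ^ 2)⁻¹) a,
    integral_univ_inv_one_add_sq, smul_eq_mul, abs_of_pos (by positivity)]
  have : B * a⁻¹ = Real.sqrt (G * B) := by
    rw [ha, Real.sqrt_div hB.le, inv_div, Real.sqrt_mul hG.le]
    have h2 := Real.mul_self_sqrt hB.le
    have h3 : Real.sqrt B ≠ 0 := by positivity
    field_simp
    linear_combination -h2
  linear_combination 8 * Real.pi * this

/-! ### Sup norms of the pattern functions -/

/-- The pattern function is a multiple of `|d/dx|` applied to the product of the Hermite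
functions. -/
theorem cosConst_mul_patternAux (j d : ℕ) (x : ℝ) :
    2 * cosConst * patternAux j d x = Real.pi *
      ∫ h : ℝ, (2 * (psi j x * psi (j + d) x) - psi j (x + h) * psi (j + d) (x + h) -
        psi j (x - h) * psi (j + d) (x - h)) / h ^ 2 := by
  set C : ℝ → ℝ → ℝ := fun r x => Real.cos (Real.sqrt 2 * r * x - d * (Real.pi / 2)) with hC
  have hcl := continuous_ell j d
  have s2 : 0 < Real.sqrt 2 := by positivity
  have hfub : Integrable (Function.uncurry fun r h : ℝ =>
      ell j d r * C r x * ((1 - Real.cos (Real.sqrt 2 * r * h)) / h ^ 2))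
      (volume.prod volume) := by
    have h1 : Integrable (fun r : ℝ => (1 + 2 * r ^ 2) * ell j d r) := by
      have := (integrable_ell j d).add ((integrable_pow_mul_ell 2 j d).const_mul 2)
      refine this.congr (Filter.Eventually.of_forall fun r => ?_)
      simp only [Pi.add_apply]; ring
    refine (h1.mul_prod (integrable_inv_one_add_sq.const_mul 4)).mono ?_
      (Filter.Eventually.of_forall fun p => ?_)
    · refine Measurable.aestronglyMeasurable ?_
      simp only [Function.uncurry_def, hC]
      fun_prop
    · simp only [Function.uncurry, norm_mul, Real.norm_eq_abs]
      have h2 := one_sub_cos_div_sq_le (Real.sqrt 2 * p.1) p.2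
      rw [mul_pow, Real.sq_sqrt (by norm_num)] at h2
      have h3 : |C p.1 x| ≤ 1 := Real.abs_cos_le_one _
      have h4 : (0 : ℝ) ≤ 1 + 2 * p.1 ^ 2 := by positivity
      have h5 : (0 : ℝ) ≤ (1 + p.2 ^ 2)⁻¹ := by positivity
      rw [abs_of_nonneg h4, abs_of_nonneg h5, abs_of_pos (show (0 : ℝ) < 4 by norm_num)]
      calc |ell j d p.1| * |C p.1 x| * |(1 - Real.cos (Real.sqrt 2 * p.1 * p.2)) / p.2 ^ 2|
          ≤ |ell j d p.1| * 1 * ((1 + 2 * p.1 ^ 2) * (4 * (1 + p.2 ^ 2)⁻¹)) := by gcongr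
        _ = _ := by ring
  have hLHS : Real.sqrt 2 * cosConst * patternAux j d x =
      ∫ r, ∫ h, ell j d r * C r x * ((1 - Real.cos (Real.sqrt 2 * r * h)) / h ^ 2) := by
    rw [patternAux_eq, ← integral_const_mul]
    refine integral_congr_ae (Filter.Eventually.of_forall fun r => ?_)
    simp only
    rw [integral_const_mul, integral_one_sub_cos_mul_div_sq, abs_mul, abs_of_pos s2]
    simp only [hC]
    ring
  rw [integral_integral_swap hfub] at hLHS
  have hinner : ∀ h, ∫ r, ell j d r * C r x * ((1 - Real.cos (Real.sqrt 2 * r * h)) / h ^ 2) =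
      Real.sqrt 2 * Real.pi / 2 * ((2 * (psi j x * psi (j + d) x) -
        psi j (x + h) * psi (j + d) (x + h) - psi j (x - h) * psi (j + d) (x - h)) / h ^ 2) := by
    intro h
    have hi : ∀ x, Integrable (fun r => ell j d r * C r x) := fun x => by
      refine (integrable_ell j d).mono (by fun_prop) (Filter.Eventually.of_forall fun r => ?_)
      rw [norm_mul]
      exact mul_le_of_le_one_right (norm_nonneg _) (Real.abs_cos_le_one _)
    have h1 : ∀ r, ell j d r * C r x * ((1 - Real.cos (Real.sqrt 2 * r * h)) / h ^ 2) =
        (2 * h ^ 2)⁻¹ * (2 * (ell j d r * C r x) - ell j d r * C r (x + h) -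
          ell j d r * C r (x - h)) := fun r => by
      have h2 : 2 * (C r x * Real.cos (Real.sqrt 2 * r * h)) = C r (x + h) + C r (x - h) := by
        simp only [hC]
        rw [two_mul, show Real.sqrt 2 * r * (x + h) - d * (Real.pi / 2) =
            (Real.sqrt 2 * r * x - d * (Real.pi / 2)) + Real.sqrt 2 * r * h by ring,
          show Real.sqrt 2 * r * (x - h) - d * (Real.pi / 2) =
            (Real.sqrt 2 * r * x - d * (Real.pi / 2)) - Real.sqrt 2 * r * h by ring,
          Real.cos_add (_ - _), Real.cos_sub (_ - _)]
        ring
      rw [mul_inv]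
      linear_combination (-(2 : ℝ)⁻¹ * (h ^ 2)⁻¹ * ell j d r) * h2
    simp_rw [h1]
    have hi2 := ((hi x).const_mul 2).sub (hi (x + h))
    simp only [Pi.sub_def] at hi2
    rw [integral_const_mul, integral_sub hi2 (hi (x - h)),
      integral_sub ((hi x).const_mul 2) (hi (x + h)), integral_const_mul]
    simp only [hC]
    rw [integral_ell_mul_cos, integral_ell_mul_cos, integral_ell_mul_cos, mul_inv]
    ring
  simp_rw [hinner] at hLHS
  rw [integral_const_mul] at hLHS
  apply mul_left_cancel₀ s2.ne'
  linear_combination 2 * hLHS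

/-- The bound `(min + 1)^{-1/6} (|j - k| + 1)^{-1/4} (max + 1)^{3/4}` on the order of magnitude of
`‖f_{j,k}‖_∞²`. -/
noncomputable def patternBound (j k : ℕ) : ℝ :=
  ((min j k : ℕ) + 1 : ℝ) ^ (-(1 / 6) : ℝ) * ((max j k - min j k : ℕ) + 1 : ℝ) ^ (-(1 / 4) : ℝ) *
    ((max j k : ℕ) + 1 : ℝ) ^ (3 / 4 : ℝ)

theorem patternBound_pos (j k : ℕ) : 0 < patternBound j k := by
  unfold patternBound; positivity

theorem patternBound_comm (j k : ℕ) : patternBound j k = patternBound k j := by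
  unfold patternBound; rw [min_comm, max_comm]

/-- The interpolation inequality for `g = ψ_j ψ_{j+d}`, with the sup bounds on `g` and `g''`. -/
theorem patternAux_sq_le : ∃ C : ℝ, 0 < C ∧ ∀ (j d : ℕ) (x : ℝ),
    patternAux j d x ^ 2 ≤ C * patternBound j (j + d) := by
  have hc := cosConst_pos
  have hpi := Real.pi_pos
  refine ⟨(4 * Real.pi ^ 2 / cosConst) ^ 2 * 1000000, by positivity, fun j d x => ?_⟩
  set p := ((j : ℝ) + 1) ^ (-(1 / 6) : ℝ) with hp
  set q := ((d : ℝ) + 1) ^ (-(1 / 4) : ℝ) with hq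
  set s := (((j + d : ℕ) : ℝ) + 1) ^ (3 / 4 : ℝ) with hs
  have hp0 : 0 < p := by positivity
  have hq0 : 0 < q := by positivity
  have hs0 : 0 < s := by positivity
  have hb : patternBound j (j + d) = p * q * s := by
    simp only [patternBound, hp, hq, hs]
    rw [min_eq_left (by omega), max_eq_right (by omega), Nat.add_sub_cancel_left]
  have hq2 : (((j + d : ℕ) : ℝ) - j + 1) ^ (-(1 / 2) : ℝ) = q ^ 2 := by
    rw [hq, ← Real.rpow_natCast, ← Real.rpow_mul (by positivity)]
    push_cast
    norm_num
  have hs2 : (((j + d : ℕ) : ℝ) + 1) ^ (3 / 2 : ℝ) = s ^ 2 := by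
    rw [hs, ← Real.rpow_natCast, ← Real.rpow_mul (by positivity)]
    norm_num
  have hG : ∀ x, |psi j x * psi (j + d) x| ≤ Real.sqrt (150000 * (p * q ^ 2)) := fun x => by
    refine Real.abs_le_sqrt ?_
    rw [← hq2]
    exact psi_mul_psi_sq_le (by omega) x
  have hB : ∀ x, |psiMulD2 j (j + d) x| ≤ Real.sqrt (6000000 * (p * s ^ 2)) := fun x => by
    refine Real.abs_le_sqrt ?_
    rw [← hs2]
    exact psiMulD2_sq_le (by omega) x
  have h1 := abs_integral_second_difference_le (hasDerivAt_psi_mul_psi j (j + d))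
    (hasDerivAt_deriv_psi_mul_psi j (j + d)) (Real.sqrt_pos.2 (by positivity))
    (Real.sqrt_pos.2 (by positivity)) hG hB x
  have h2 := cosConst_mul_patternAux j d x
  set I := ∫ h : ℝ, (2 * (psi j x * psi (j + d) x) - psi j (x + h) * psi (j + d) (x + h) -
        psi j (x - h) * psi (j + d) (x - h)) / h ^ 2 with hI
  have hGB : Real.sqrt (150000 * (p * q ^ 2)) * Real.sqrt (6000000 * (p * s ^ 2)) ≤
      1000000 * (p * q * s) := by
    rw [← Real.sqrt_mul (by positivity), Real.sqrt_le_left (by positivity)]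
    have : 0 ≤ (p * q * s) ^ 2 := by positivity
    nlinarith
  have h3 : patternAux j d x = Real.pi / (2 * cosConst) * I := by
    field_simp
    linear_combination h2
  have h4 : |I| ^ 2 ≤ (8 * Real.pi) ^ 2 * (1000000 * (p * q * s)) := by
    refine (pow_le_pow_left₀ (abs_nonneg _) h1 2).trans ?_
    rw [mul_pow, Real.sq_sqrt (by positivity)]
    gcongr
  rw [h3, mul_pow, ← sq_abs I, hb]
  calc (Real.pi / (2 * cosConst)) ^ 2 * |I| ^ 2 ≤
      (Real.pi / (2 * cosConst)) ^ 2 * ((8 * Real.pi) ^ 2 * (1000000 * (p * q * s))) := by gcongr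
    _ = _ := by field_simp; ring

theorem pattern_sq_le : ∃ C : ℝ, 0 < C ∧ ∀ (j k : ℕ) (x : ℝ),
    pattern j k x ^ 2 ≤ C * patternBound j k := by
  obtain ⟨C, hC, h⟩ := patternAux_sq_le
  refine ⟨C, hC, fun j k x => ?_⟩
  rcases le_total j k with hjk | hjk <;> obtain ⟨d, rfl⟩ := Nat.exists_eq_add_of_le hjk
  · rw [pattern, min_eq_left hjk, max_eq_right hjk, Nat.add_sub_cancel_left]
    exact h _ _ x
  · rw [pattern, min_eq_right hjk, max_eq_left hjk, Nat.add_sub_cancel_left, patternBound_comm]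
    exact h _ _ x

theorem sum_rpow_neg_le {a : ℝ} (ha0 : 0 ≤ a) (ha1 : a < 1) (n : ℕ) :
    ∑ i ∈ Finset.range n, ((i : ℝ) + 1) ^ (-a) ≤ (n : ℝ) ^ (1 - a) / (1 - a) := by
  have ha : 0 < 1 - a := by linarith
  induction n with
  | zero => simp; rw [Real.zero_rpow ha.ne']; simp
  | succ n ih =>
    rw [Finset.sum_range_succ]
    have hn : (0 : ℝ) < (n : ℝ) + 1 := by positivity
    have h1 := rpow_one_add_le_one_add_mul_self (s := -((n : ℝ) + 1)⁻¹) (p := 1 - a)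
      (neg_le_neg (inv_le_one_of_one_le₀ (by linarith [(n.cast_nonneg : (0 : ℝ) ≤ n)])))
      ha.le (by linarith)
    have h2 : 1 + -((n : ℝ) + 1)⁻¹ = n / (n + 1) := by field_simp; ring
    rw [h2, Real.div_rpow (by positivity) hn.le, div_le_iff₀ (by positivity)] at h1
    have h3 : ((n : ℝ) + 1) ^ (1 - a) = ((n : ℝ) + 1) * ((n : ℝ) + 1) ^ (-a) := by
      rw [sub_eq_add_neg, Real.rpow_add hn, Real.rpow_one]
    have h4 : (1 + (1 - a) * -((n : ℝ) + 1)⁻¹) * ((n : ℝ) + 1) ^ (1 - a) =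
        ((n : ℝ) + 1) ^ (1 - a) - (1 - a) * ((n : ℝ) + 1) ^ (-a) := by
      rw [h3]; field_simp; ring
    rw [h4] at h1
    push_cast
    rw [le_div_iff₀ ha] at ih ⊢
    linarith

/-- The exponent is `2 - 1/6 - 1/4 + 3/4`: the negative powers are summed over the smaller index and
over the difference of the indices, the positive one is at most `N^{3/4}`. -/
theorem sum_patternBound_le : ∃ C : ℝ, 0 < C ∧ ∀ N : ℕ,
    ∑ j ∈ Finset.range N, ∑ k ∈ Finset.range N, patternBound j k ≤ C * (N : ℝ) ^ (7 / 3 : ℝ) := by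
  refine ⟨4, by norm_num, fun N => ?_⟩
  rcases Nat.eq_zero_or_pos N with hN | hN
  · subst hN
    simp
  have hN' : (0 : ℝ) < N := by exact_mod_cast hN
  set u : ℕ → ℕ → ℝ := fun j k => if j ≤ k then
    ((j : ℝ) + 1) ^ (-(1 / 6) : ℝ) * ((k - j : ℕ) + 1 : ℝ) ^ (-(1 / 4) : ℝ) * (N : ℝ) ^ (3 / 4 : ℝ)
    else 0 with hu
  have hu0 : ∀ j k, 0 ≤ u j k := fun j k => by
    simp only [hu]; split_ifs <;> positivity
  have hle : ∀ j k, k < N → j ≤ k → patternBound j k ≤ u j k := fun j k hk hjk => by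
    simp only [hu, patternBound]
    rw [if_pos hjk, min_eq_left hjk, max_eq_right hjk]
    gcongr
    exact_mod_cast hk
  have h1 : ∀ j ∈ Finset.range N, ∀ k ∈ Finset.range N, patternBound j k ≤ u j k + u k j := by
    intro j hj k hk
    rw [Finset.mem_range] at hj hk
    rcases le_total j k with h | h
    · linarith [hle j k hk h, hu0 k j]
    · rw [patternBound_comm]
      linarith [hle k j hj h, hu0 j k]
  have h2 : ∑ j ∈ Finset.range N, ∑ k ∈ Finset.range N, u j k ≤ 2 * (N : ℝ) ^ (7 / 3 : ℝ) := by
    have hq := sum_rpow_neg_le (a := 1 / 4) (by norm_num) (by norm_num) N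
    have hp := sum_rpow_neg_le (a := 1 / 6) (by norm_num) (by norm_num) N
    have h3 : ∀ j ∈ Finset.range N, ∑ k ∈ Finset.range N, u j k ≤
        ((j : ℝ) + 1) ^ (-(1 / 6) : ℝ) * ((N : ℝ) ^ (1 - 1 / 4 : ℝ) / (1 - 1 / 4) *
          (N : ℝ) ^ (3 / 4 : ℝ)) := by
      intro j hj
      have hjN : j ≤ N := (Finset.mem_range.1 hj).le
      have h4 : ∑ k ∈ Finset.range N, u j k = ∑ k ∈ Finset.Ico j N, u j k := by
        symm
        refine Finset.sum_subset (fun k hk => ?_) fun k hk hk' => ?_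
        · rw [Finset.mem_Ico] at hk; exact Finset.mem_range.2 hk.2
        · rw [Finset.mem_range] at hk
          rw [Finset.mem_Ico] at hk'
          simp only [hu]
          rw [if_neg (by omega)]
      rw [h4, Finset.sum_Ico_eq_sum_range]
      have h5 : ∀ i, u j (j + i) = ((j : ℝ) + 1) ^ (-(1 / 6) : ℝ) *
          (((i : ℝ) + 1) ^ (-(1 / 4) : ℝ) * (N : ℝ) ^ (3 / 4 : ℝ)) := fun i => by
        simp only [hu]
        rw [if_pos (by omega), Nat.add_sub_cancel_left]
        ring
      simp_rw [h5]
      rw [← Finset.mul_sum, ← Finset.sum_mul]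
      gcongr
      refine le_trans (Finset.sum_le_sum_of_subset_of_nonneg (Finset.range_mono (Nat.sub_le N j))
        fun i _ _ => by positivity) hq
    refine (Finset.sum_le_sum h3).trans ?_
    rw [← Finset.sum_mul]
    calc (∑ j ∈ Finset.range N, ((j : ℝ) + 1) ^ (-(1 / 6) : ℝ)) *
          ((N : ℝ) ^ (1 - 1 / 4 : ℝ) / (1 - 1 / 4) * (N : ℝ) ^ (3 / 4 : ℝ))
        ≤ ((N : ℝ) ^ (1 - 1 / 6 : ℝ) / (1 - 1 / 6)) *
          ((N : ℝ) ^ (1 - 1 / 4 : ℝ) / (1 - 1 / 4) * (N : ℝ) ^ (3 / 4 : ℝ)) := by gcongr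
      _ = (8 / 5) * ((N : ℝ) ^ (1 - 1 / 6 : ℝ) * (N : ℝ) ^ (1 - 1 / 4 : ℝ) *
          (N : ℝ) ^ (3 / 4 : ℝ)) := by ring
      _ = (8 / 5) * (N : ℝ) ^ (7 / 3 : ℝ) := by
        rw [← Real.rpow_add hN', ← Real.rpow_add hN']; norm_num
      _ ≤ _ := by gcongr; norm_num
  calc ∑ j ∈ Finset.range N, ∑ k ∈ Finset.range N, patternBound j k
      ≤ ∑ j ∈ Finset.range N, ∑ k ∈ Finset.range N, (u j k + u k j) :=
        Finset.sum_le_sum fun j hj => Finset.sum_le_sum fun k hk => h1 j hj k hk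
    _ = ∑ j ∈ Finset.range N, ∑ k ∈ Finset.range N, u j k +
        ∑ j ∈ Finset.range N, ∑ k ∈ Finset.range N, u j k := by
        simp_rw [Finset.sum_add_distrib]
        congr 1
        exact Finset.sum_comm
    _ ≤ 4 * (N : ℝ) ^ (7 / 3 : ℝ) := by linarith

theorem exists_sum_iSup_pattern_le : ∃ C : ℝ, 0 < C ∧ ∀ N : ℕ, 1 ≤ N →
    ∑ j ∈ Finset.range (N + 1), ∑ k ∈ Finset.range (N + 1),
      (⨆ x : ℝ, ENNReal.ofReal |pattern j k x|) ^ 2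
        ≤ ENNReal.ofReal (C * (N : ℝ) ^ (7 / 3 : ℝ)) := by
  obtain ⟨C, hC, hpat⟩ := pattern_sq_le
  obtain ⟨C', hC', hsum⟩ := sum_patternBound_le
  refine ⟨C * (C' * 2 ^ (7 / 3 : ℝ)), by positivity, fun N hN => ?_⟩
  have hN' : (1 : ℝ) ≤ N := by exact_mod_cast hN
  have h1 : ∀ j k, (⨆ x : ℝ, ENNReal.ofReal |pattern j k x|) ^ 2 ≤
      ENNReal.ofReal (C * patternBound j k) := fun j k => by
    have hb := patternBound_pos j k
    have h2 : (⨆ x : ℝ, ENNReal.ofReal |pattern j k x|) ≤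
        ENNReal.ofReal (Real.sqrt (C * patternBound j k)) :=
      iSup_le fun x => ENNReal.ofReal_le_ofReal (Real.abs_le_sqrt (hpat j k x))
    refine (pow_le_pow_left' h2 2).trans ?_
    rw [← ENNReal.ofReal_pow (Real.sqrt_nonneg _), Real.sq_sqrt (by positivity)]
  have hnn : ∀ j k, 0 ≤ C * patternBound j k := fun j k => by
    have := patternBound_pos j k
    positivity
  refine (Finset.sum_le_sum fun j _ => Finset.sum_le_sum fun k _ => h1 j k).trans ?_
  simp_rw [← ENNReal.ofReal_sum_of_nonneg (fun k _ => hnn _ k)]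
  rw [← ENNReal.ofReal_sum_of_nonneg fun j _ => Finset.sum_nonneg fun k _ => hnn j k]
  refine ENNReal.ofReal_le_ofReal ?_
  simp_rw [← Finset.mul_sum]
  rw [mul_assoc, mul_assoc]
  gcongr
  refine (hsum (N + 1)).trans ?_
  gcongr
  rw [← Real.mul_rpow (by norm_num) (by positivity)]
  gcongr
  push_cast
  linarith

/-! ### Matrix entries of states and of model elements -/

theorem inner_fock (j k : ℕ) : inner ℂ (fock j) (fock k) = if j = k then (1 : ℂ) else 0 := by
  rw [L2.inner_def]
  have h1 : ∫ a, inner ℂ (fock j a) (fock k a) = ∫ x, ((psi j x * psi k x : ℝ) : ℂ) := by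
    refine integral_congr_ae ?_
    filter_upwards [(memLp_psi j).coeFn_toLp, (memLp_psi k).coeFn_toLp] with x hj hk
    simp only [fock]
    rw [hj, hk, RCLike.inner_apply]
    simp [mul_comm]
  rw [h1, integral_complex_ofReal, integral_psi_mul_psi]
  split_ifs <;> simp

theorem entry_sub (S T : L2R →L[ℂ] L2R) (j k : ℕ) :
    entry (S - T) j k = entry S j k - entry T j k := by
  simp [entry, inner_sub_right]

theorem entry_add (S T : L2R →L[ℂ] L2R) (j k : ℕ) :
    entry (S + T) j k = entry S j k + entry T j k := by
  simp [entry, inner_add_right]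

theorem entry_smul (c : ℂ) (T : L2R →L[ℂ] L2R) (j k : ℕ) :
    entry (c • T) j k = c * entry T j k := by
  simp [entry, inner_smul_right]

theorem entry_sum {ι : Type*} (s : Finset ι) (T : ι → L2R →L[ℂ] L2R) (j k : ℕ) :
    entry (∑ i ∈ s, T i) j k = ∑ i ∈ s, entry (T i) j k := by
  simp [entry, inner_sum]

theorem entry_rankOne (a b j k : ℕ) :
    entry (InnerProductSpace.rankOne ℂ (fock a) (fock b)) j k =
      if a = j ∧ b = k then 1 else 0 := by
  rw [entry, InnerProductSpace.rankOne_apply, inner_smul_right, inner_fock, inner_fock]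
  by_cases h1 : a = j <;> by_cases h2 : b = k <;> simp [h1, h2, eq_comm]

/-- The matrix of the self-adjoint operator `∑_i a_i e_i`. -/
noncomputable def matOf (a : ℕ × ℕ → ℝ) (j k : ℕ) : ℂ :=
  if j < k then (Real.sqrt 2 : ℂ)⁻¹ * (a (j, k) + Complex.I * a (k, j))
  else if k < j then (Real.sqrt 2 : ℂ)⁻¹ * (a (k, j) - Complex.I * a (j, k))
  else a (j, j)

theorem matOf_sub (a b : ℕ × ℕ → ℝ) (j k : ℕ) :
    matOf (fun i => a i - b i) j k = matOf a j k - matOf b j k := by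
  unfold matOf
  split_ifs <;> push_cast <;> ring

theorem norm_inv_sqrt_two_mul_sq (x y : ℝ) :
    ‖(Real.sqrt 2 : ℂ)⁻¹ * (x + Complex.I * y)‖ ^ 2 = (x ^ 2 + y ^ 2) / 2 := by
  rw [norm_mul, mul_pow, norm_inv, Complex.norm_real, Real.norm_eq_abs, inv_pow, sq_abs,
    Real.sq_sqrt (by norm_num), ← Complex.normSq_eq_norm_sq, mul_comm Complex.I,
    Complex.normSq_add_mul_I]
  ring

theorem norm_matOf_sq (a : ℕ × ℕ → ℝ) (j k : ℕ) :
    ‖matOf a j k‖ ^ 2 = (a (j, k) ^ 2 + a (k, j) ^ 2) / 2 := by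
  unfold matOf
  split_ifs with h1 h2
  · exact norm_inv_sqrt_two_mul_sq _ _
  · have := norm_inv_sqrt_two_mul_sq (a (k, j)) (-a (j, k))
    push_cast at this
    rw [mul_neg, ← sub_eq_add_neg] at this
    rw [this]
    ring
  · obtain rfl : j = k := by omega
    rw [Complex.norm_real, Real.norm_eq_abs, sq_abs]
    ring

theorem hsSq_eq_tsum {T : L2R →L[ℂ] L2R} {a : ℕ × ℕ → ℝ} (h : ∀ j k, entry T j k = matOf a j k) :
    hsSq T = ∑' i, ENNReal.ofReal (a i ^ 2) := by
  have h1 : ∀ i : ℕ × ℕ, ENNReal.ofReal (‖entry T i.1 i.2‖ ^ 2) =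
      2⁻¹ * ENNReal.ofReal (a i ^ 2) + 2⁻¹ * ENNReal.ofReal (a i.swap ^ 2) := fun i => by
    have e2 : (2⁻¹ : ℝ≥0∞) = ENNReal.ofReal 2⁻¹ := by
      rw [ENNReal.ofReal_inv_of_pos (by norm_num)]; norm_num
    rw [h, norm_matOf_sq, e2, ← ENNReal.ofReal_mul (by norm_num),
      ← ENNReal.ofReal_mul (by norm_num), ← ENNReal.ofReal_add (by positivity) (by positivity)]
    congr 1
    rw [Prod.swap]
    ring
  unfold hsSq
  simp_rw [h1]
  rw [ENNReal.tsum_add, ENNReal.tsum_mul_left, ENNReal.tsum_mul_left]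
  have h2 : ∑' i : ℕ × ℕ, ENNReal.ofReal (a i.swap ^ 2) = ∑' i, ENNReal.ofReal (a i ^ 2) :=
    (Equiv.prodComm ℕ ℕ).tsum_eq (fun i => ENNReal.ofReal (a i ^ 2))
  rw [h2, ← add_mul, ENNReal.inv_two_add_inv_two, one_mul]

theorem entry_basisOp_of_lt {j k : ℕ} (h : j < k) (i : ℕ × ℕ) : entry (basisOp i) j k =
    (if i = (j, k) then (Real.sqrt 2 : ℂ)⁻¹ else 0) +
      (if i = (k, j) then Complex.I * (Real.sqrt 2 : ℂ)⁻¹ else 0) := by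
  obtain ⟨a, b⟩ := i
  simp only [basisOp, Prod.mk.injEq]
  split_ifs with h1 h2 h3 h4 <;>
    simp only [entry_smul, entry_add, entry_sub, entry_rankOne] <;>
    split_ifs <;> first | omega | simp

theorem entry_basisOp_of_gt {j k : ℕ} (h : k < j) (i : ℕ × ℕ) : entry (basisOp i) j k =
    (if i = (k, j) then (Real.sqrt 2 : ℂ)⁻¹ else 0) +
      (if i = (j, k) then -(Complex.I * (Real.sqrt 2 : ℂ)⁻¹) else 0) := by
  obtain ⟨a, b⟩ := i
  simp only [basisOp, Prod.mk.injEq]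
  split_ifs with h1 h2 h3 h4 <;>
    simp only [entry_smul, entry_add, entry_sub, entry_rankOne] <;>
    split_ifs <;> first | omega | simp

theorem entry_basisOp_self (j : ℕ) (i : ℕ × ℕ) : entry (basisOp i) j j =
    if i = (j, j) then 1 else 0 := by
  obtain ⟨a, b⟩ := i
  simp only [basisOp, Prod.mk.injEq]
  split_ifs with h1 h2 h3 h4 <;>
    simp only [entry_smul, entry_add, entry_sub, entry_rankOne] <;>
    split_ifs <;> first | omega | simp

theorem entry_modelOp (m : Finset (ℕ × ℕ)) (τ : ℕ × ℕ → ℝ) (j k : ℕ) :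
    entry (modelOp m τ) j k = matOf (fun i => if i ∈ m then τ i else 0) j k := by
  rw [modelOp, entry_sum]
  simp only [entry_smul]
  rcases lt_trichotomy j k with h | rfl | h
  · simp only [entry_basisOp_of_lt h, mul_add, Finset.sum_add_distrib, mul_ite, mul_zero,
      Finset.sum_ite_eq', matOf, if_pos h]
    split_ifs <;> push_cast <;> ring_nf
  · simp only [entry_basisOp_self, mul_ite, mul_one, mul_zero, Finset.sum_ite_eq', matOf,
      lt_irrefl, if_false]
    split_ifs <;> simp
  · simp only [entry_basisOp_of_gt h, mul_add, Finset.sum_add_distrib, mul_ite, mul_zero,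
      Finset.sum_ite_eq', matOf, if_pos h, if_neg h.not_gt]
    split_ifs <;> push_cast <;> ring_nf

/-- The coefficients `c_i` of a self-adjoint operator in the basis `(e_i)`. -/
noncomputable def coef (T : L2R →L[ℂ] L2R) (i : ℕ × ℕ) : ℝ :=
  if i.1 < i.2 then Real.sqrt 2 * (entry T i.1 i.2).re
  else if i.2 < i.1 then Real.sqrt 2 * (entry T i.2 i.1).im
  else (entry T i.1 i.1).re

theorem entry_conj {T : L2R →L[ℂ] L2R} (hT : T.IsPositive) (j k : ℕ) :
    starRingEnd ℂ (entry T j k) = entry T k j := by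
  rw [entry, entry, inner_conj_symm]
  exact hT.isSymmetric (fock k) (fock j)

theorem entry_self_eq {T : L2R →L[ℂ] L2R} (hT : T.IsPositive) (j : ℕ) :
    entry T j j = ((entry T j j).re : ℂ) := by
  have := entry_conj hT j j
  exact (Complex.conj_eq_iff_re.1 this).symm

theorem entry_self_nonneg {T : L2R →L[ℂ] L2R} (hT : T.IsPositive) (j : ℕ) :
    0 ≤ (entry T j j).re :=
  hT.re_inner_nonneg_right (fock j)

theorem entry_eq_matOf {T : L2R →L[ℂ] L2R} (hT : T.IsPositive) (j k : ℕ) :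
    entry T j k = matOf (coef T) j k := by
  have h2 : (Real.sqrt 2 : ℂ) ≠ 0 := by exact_mod_cast (show Real.sqrt 2 ≠ 0 by positivity)
  unfold matOf
  split_ifs with h1 h3
  · simp only [coef]
    rw [if_pos h1, if_neg (by omega), if_pos h1]
    push_cast
    field_simp
    rw [mul_comm Complex.I, Complex.re_add_im]
  · simp only [coef]
    rw [if_pos h3, if_neg (by omega), if_pos h3, ← entry_conj hT k j]
    push_cast
    field_simp
    apply Complex.ext <;> simp
  · obtain rfl : j = k := by omega
    simp only [coef, lt_irrefl, if_false]
    exact entry_self_eq hT j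

/-- The Cauchy-Schwarz inequality `|ρ_{j,k}|² ≤ ρ_{j,j} ρ_{k,k}`. -/
theorem norm_entry_sq_le {T : L2R →L[ℂ] L2R} (hT : T.IsPositive) (j k : ℕ) :
    ‖entry T j k‖ ^ 2 ≤ (entry T j j).re * (entry T k k).re := by
  set z := entry T j k with hz
  rcases eq_or_ne z 0 with h0 | h0
  · rw [h0]
    simpa using mul_nonneg (entry_self_nonneg hT j) (entry_self_nonneg hT k)
  have hq : ∀ t : ℝ, 0 ≤ (entry T j j).re * ‖z‖ ^ 2 * (t * t) + 2 * ‖z‖ ^ 2 * t +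
      (entry T k k).re := fun t => by
    have h1 := hT.re_inner_nonneg_right (((t : ℂ) * z) • fock j + fock k)
    have e1 : inner ℂ (fock j) (T (fock k)) = z := rfl
    have e2 : inner ℂ (fock k) (T (fock j)) = starRingEnd ℂ z := (entry_conj hT j k).symm
    have e3 : inner ℂ (fock j) (T (fock j)) = ((entry T j j).re : ℂ) := entry_self_eq hT j
    have e4 : inner ℂ (fock k) (T (fock k)) = ((entry T k k).re : ℂ) := entry_self_eq hT k
    simp only [map_add, map_smul, inner_add_left, inner_add_right, inner_smul_left,
      inner_smul_right, e1, e2, e3, e4, map_mul, Complex.conj_ofReal] at h1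
    have e5 : starRingEnd ℂ z * z = ((‖z‖ ^ 2 : ℝ) : ℂ) := by
      rw [mul_comm, Complex.mul_conj, Complex.normSq_eq_norm_sq]
    have e6 : (t : ℂ) * z * (t * starRingEnd ℂ z * ((entry T j j).re : ℂ)) +
        t * z * starRingEnd ℂ z + (t * starRingEnd ℂ z * z + ((entry T k k).re : ℂ)) =
        (((entry T j j).re * ‖z‖ ^ 2 * (t * t) + 2 * ‖z‖ ^ 2 * t + (entry T k k).re : ℝ) : ℂ) := by
      push_cast at e5 ⊢
      linear_combination (t * t * ((entry T j j).re : ℂ) + 2 * t) * e5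
    have e7 := congrArg Complex.re e6
    rw [Complex.ofReal_re] at e7
    rw [← e7]
    refine le_of_le_of_eq h1 ?_
    simp only [RCLike.re_to_complex, ← Complex.add_re]
    congr 1
    ring
  have h2 := discrim_le_zero hq
  have h3 : 0 < ‖z‖ ^ 2 := by positivity
  unfold discrim at h2
  nlinarith

/-! ### Bias of the square models -/

theorem hasSum_entry_re {ρ : L2R →L[ℂ] L2R} (hρ : IsDensityOperator ρ) :
    HasSum (fun k => (entry ρ k k).re) 1 := by
  simpa using Complex.hasSum_re hρ.trace_eq_one

theorem tsum_ofReal_entry {ρ : L2R →L[ℂ] L2R} (hρ : IsDensityOperator ρ) :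
    ∑' k, ENNReal.ofReal (entry ρ k k).re = 1 := by
  have h := hasSum_entry_re hρ
  rw [← ENNReal.ofReal_tsum_of_nonneg (fun k => entry_self_nonneg hρ.isPositive k) h.summable,
    h.tsum_eq, ENNReal.ofReal_one]

theorem tsum_mul_entry_le {ρ : L2R →L[ℂ] L2R} (hρ : IsDensityOperator ρ) {H : ℝ} (hH : 0 ≤ H)
    (hE : energy ρ ≤ ENNReal.ofReal (H + 1 / 2)) :
    ∑' j : ℕ, ENNReal.ofReal (j * (entry ρ j j).re) ≤ ENNReal.ofReal H := by
  have h1 : energy ρ = ∑' j : ℕ, ENNReal.ofReal (j * (entry ρ j j).re) +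
      ENNReal.ofReal (1 / 2) := by
    have h2 : ∀ j : ℕ, ENNReal.ofReal (((j : ℝ) + 1 / 2) * (entry ρ j j).re) =
        ENNReal.ofReal (j * (entry ρ j j).re) +
          ENNReal.ofReal (1 / 2) * ENNReal.ofReal (entry ρ j j).re := fun j => by
      have := entry_self_nonneg hρ.isPositive j
      rw [← ENNReal.ofReal_mul (by norm_num), ← ENNReal.ofReal_add (by positivity) (by positivity)]
      congr 1; ring
    unfold energy
    simp_rw [h2]
    rw [ENNReal.tsum_add, ENNReal.tsum_mul_left, tsum_ofReal_entry hρ, mul_one]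
  rw [h1, ENNReal.ofReal_add hH (by norm_num)] at hE
  exact (ENNReal.add_le_add_iff_right ENNReal.ofReal_ne_top).1 hE

/-- The tail of the diagonal of a state of bounded energy, by Markov's inequality. -/
theorem tsum_tail_le {ρ : L2R →L[ℂ] L2R} (hρ : IsDensityOperator ρ) {H : ℝ} (hH : 0 ≤ H)
    (hE : energy ρ ≤ ENNReal.ofReal (H + 1 / 2)) {N : ℕ} (hN : 1 ≤ N) :
    ∑' j : ℕ, (if N ≤ j then ENNReal.ofReal (entry ρ j j).re else 0) ≤ ENNReal.ofReal (H / N) := by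
  have hN' : (0 : ℝ) < N := by exact_mod_cast hN
  have h1 : ∀ j : ℕ, (if N ≤ j then ENNReal.ofReal (entry ρ j j).re else 0) ≤
      ENNReal.ofReal (N : ℝ)⁻¹ * ENNReal.ofReal (j * (entry ρ j j).re) := fun j => by
    have h0 := entry_self_nonneg hρ.isPositive j
    split_ifs with hj
    · rw [← ENNReal.ofReal_mul (by positivity)]
      refine ENNReal.ofReal_le_ofReal ?_
      have : (1 : ℝ) ≤ (N : ℝ)⁻¹ * j := by
        rw [← div_eq_inv_mul, le_div_iff₀ hN', one_mul]
        exact_mod_cast hj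
      nlinarith
    · exact zero_le
  refine (ENNReal.tsum_le_tsum h1).trans ?_
  rw [ENNReal.tsum_mul_left, div_eq_inv_mul, ENNReal.ofReal_mul (by positivity)]
  gcongr
  exact tsum_mul_entry_le hρ hH hE

/-- The part of the operator left out by the square model. -/
theorem tsum_coef_sq_not_mem_le {ρ : L2R →L[ℂ] L2R} (hρ : IsDensityOperator ρ) {H : ℝ}
    (hH : 0 ≤ H) (hE : energy ρ ≤ ENNReal.ofReal (H + 1 / 2)) {N : ℕ} (hN : 1 ≤ N) :
    hsSq (ρ - modelOp (squareModel N) (coef ρ)) ≤ ENNReal.ofReal (2 * H / N) := by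
  have h1 : ∀ i : ℕ × ℕ, ENNReal.ofReal (‖entry (ρ - modelOp (squareModel N) (coef ρ)) i.1 i.2‖ ^ 2)
      ≤ (if N ≤ i.1 then ENNReal.ofReal (entry ρ i.1 i.1).re else 0) *
          ENNReal.ofReal (entry ρ i.2 i.2).re +
        ENNReal.ofReal (entry ρ i.1 i.1).re *
          (if N ≤ i.2 then ENNReal.ofReal (entry ρ i.2 i.2).re else 0) := fun ⟨j, k⟩ => by
    have hj0 := entry_self_nonneg hρ.isPositive j
    have hcs : ENNReal.ofReal (‖entry ρ j k‖ ^ 2) ≤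
        ENNReal.ofReal (entry ρ j j).re * ENNReal.ofReal (entry ρ k k).re := by
      rw [← ENNReal.ofReal_mul hj0]
      exact ENNReal.ofReal_le_ofReal (norm_entry_sq_le hρ.isPositive j k)
    simp only [entry_sub, entry_modelOp]
    by_cases hjk : j < N ∧ k < N
    · have h2 : matOf (fun i => if i ∈ squareModel N then coef ρ i else 0) j k = entry ρ j k := by
        rw [entry_eq_matOf hρ.isPositive]
        simp only [matOf, squareModel, Finset.mem_product, Finset.mem_range]
        simp only [hjk.1, hjk.2, and_self, if_true]
      rw [h2]
      simp
    · have h2 : matOf (fun i => if i ∈ squareModel N then coef ρ i else 0) j k = 0 := by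
        have h3 : ¬ (k < N ∧ j < N) := fun h => hjk ⟨h.2, h.1⟩
        simp only [matOf, squareModel, Finset.mem_product, Finset.mem_range]
        split_ifs with h4 h5 h6
        · simp
        · simp
        · omega
        · simp
      rw [h2, sub_zero]
      refine hcs.trans ?_
      by_cases hj : N ≤ j
      · rw [if_pos hj]
        exact le_self_add
      · rw [if_neg hj, if_pos (by omega), zero_mul, zero_add]
  unfold hsSq
  refine (ENNReal.tsum_le_tsum h1).trans ?_
  rw [ENNReal.tsum_add]
  have h3 : ∀ f g : ℕ → ℝ≥0∞, ∑' i : ℕ × ℕ, f i.1 * g i.2 = (∑' j, f j) * ∑' k, g k := by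
    intro f g
    rw [ENNReal.tsum_prod (f := fun a b => f a * g b)]
    simp_rw [ENNReal.tsum_mul_left]
    rw [ENNReal.tsum_mul_right]
  rw [h3 (fun j => if N ≤ j then ENNReal.ofReal (entry ρ j j).re else 0)
      (fun k => ENNReal.ofReal (entry ρ k k).re),
    h3 (fun k => ENNReal.ofReal (entry ρ k k).re)
      (fun j => if N ≤ j then ENNReal.ofReal (entry ρ j j).re else 0),
    tsum_ofReal_entry hρ, mul_one, one_mul]
  have h4 := tsum_tail_le hρ hH hE hN
  refine (add_le_add h4 h4).trans (le_of_eq ?_)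
  rw [← ENNReal.ofReal_add (by positivity) (by positivity)]
  congr 1
  ring

theorem biasSq_squareModel_le {ρ : L2R →L[ℂ] L2R} (hρ : IsDensityOperator ρ) {H : ℝ}
    (hH : 0 ≤ H) (hE : energy ρ ≤ ENNReal.ofReal (H + 1 / 2)) {N : ℕ} (hN : 1 ≤ N) :
    biasSq ρ (squareModel N) ≤ ENNReal.ofReal (2 * H / N) :=
  (iInf_le _ (coef ρ)).trans (tsum_coef_sq_not_mem_le hρ hH hE hN)

/-! ### Biorthogonality under the reference measure -/

/-- The uniform distribution of the phase. -/
noncomputable def phase : Measure ℝ :=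
  ENNReal.ofReal (Real.pi⁻¹) • (volume : Measure ℝ).restrict (Set.Ico 0 Real.pi)

instance : IsProbabilityMeasure phase := by
  constructor
  have hpi := Real.pi_pos
  simp only [phase, Measure.smul_apply, Measure.restrict_apply_univ, Real.volume_Ico, sub_zero,
    smul_eq_mul]
  rw [← ENNReal.ofReal_mul (by positivity), inv_mul_cancel₀ hpi.ne', ENNReal.ofReal_one]

theorem ae_phase_mem : ∀ᵐ φ ∂phase, φ ∈ Set.Ico 0 Real.pi :=
  Measure.ae_smul_measure (ae_restrict_mem measurableSet_Ico) _

/-- The reference measure `dx dφ / π`. -/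
noncomputable def refMeasure : Measure (ℝ × ℝ) := (volume : Measure ℝ).prod phase

instance : SFinite refMeasure := by unfold refMeasure; infer_instance

theorem law_eq (ρ : L2R →L[ℂ] L2R) :
    law ρ = refMeasure.withDensity fun y => ENNReal.ofReal (density ρ y) := rfl

theorem integral_phase_exp_of_even {e : ℤ} (he : Even e) (he0 : e ≠ 0) :
    ∫ φ, Complex.exp (((e * φ : ℝ) : ℂ) * Complex.I) ∂phase = 0 := by
  have hpi := Real.pi_pos
  have hc : (e : ℂ) * Complex.I ≠ 0 := mul_ne_zero (by exact_mod_cast he0) Complex.I_ne_zero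
  rw [phase, integral_smul_measure, integral_Ico_eq_integral_Ioc,
    ← intervalIntegral.integral_of_le hpi.le]
  have h1 : ∀ φ : ℝ, Complex.exp (((e * φ : ℝ) : ℂ) * Complex.I) =
      Complex.exp ((e : ℂ) * Complex.I * φ) := fun φ => by
    congr 1; push_cast; ring
  simp_rw [h1]
  rw [integral_exp_mul_complex hc]
  obtain ⟨t, ht⟩ := he
  have h2 : Complex.exp ((e : ℂ) * Complex.I * (Real.pi : ℝ)) = 1 := by
    rw [Complex.exp_eq_one_iff]
    refine ⟨t, ?_⟩
    rw [ht]; push_cast; ring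
  rw [h2]
  simp

theorem pattern_neg (j k : ℕ) (x : ℝ) :
    pattern j k (-x) = (-1) ^ (j + k) * pattern j k x := by
  rw [pattern, patternAux_neg, pattern]
  congr 1
  have : j + k = (max j k - min j k) + 2 * min j k := by omega
  rw [this, pow_add, pow_mul, neg_one_sq, one_pow, mul_one]

theorem continuous_pattern (j k : ℕ) : Continuous (pattern j k) := continuous_patternAux _ _

/-- The parity of the pattern functions takes care of the odd frequencies, which do not integrate to
zero over the half period `[0, π)`. -/
theorem integral_pattern_mul_of_odd {j k l m : ℕ} (h : Odd (j + k + (l + m))) :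
    ∫ x, pattern j k x * (psi l x * psi m x) = 0 := by
  have h1 : ∫ x, pattern j k x * (psi l x * psi m x) =
      -∫ x, pattern j k x * (psi l x * psi m x) := by
    rw [← integral_neg, ← integral_neg_eq_self]
    refine integral_congr_ae (Filter.Eventually.of_forall fun x => ?_)
    simp only [pattern_neg, psi_neg]
    have h2 : (-1 : ℝ) ^ (j + k) * ((-1) ^ l * (-1) ^ m) = -1 := by
      rw [← pow_add, ← pow_add]
      exact h.neg_one_pow
    linear_combination (pattern j k x * (psi l x * psi m x)) * h2
  linarith

/-- The function `F_{j,k}(x, φ) = f_{j,k}(x) e^{i(j-k)φ}` dual to the matrix entry `ρ_{j,k}`. -/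
noncomputable def patternC (j k : ℕ) (y : ℝ × ℝ) : ℂ :=
  (pattern j k y.1 : ℂ) * Complex.exp (((((j : ℝ) - k) * y.2 : ℝ) : ℂ) * Complex.I)

/-- The contribution `ψ_l(x) ψ_m(x) e^{-i(l-m)φ}` of the matrix unit `E_{l,m}` to the density. -/
noncomputable def unitDensity (l m : ℕ) (y : ℝ × ℝ) : ℂ :=
  ((psi l y.1 * psi m y.1 : ℝ) : ℂ) *
    Complex.exp (((((m : ℝ) - l) * y.2 : ℝ) : ℂ) * Complex.I)

theorem continuous_patternC (j k : ℕ) : Continuous (patternC j k) := by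
  have := continuous_pattern j k
  unfold patternC
  fun_prop

theorem continuous_unitDensity (l m : ℕ) : Continuous (unitDensity l m) := by
  have := continuous_psi l
  have := continuous_psi m
  unfold unitDensity
  fun_prop

theorem conj_unitDensity (l m : ℕ) (y : ℝ × ℝ) :
    starRingEnd ℂ (unitDensity l m y) = unitDensity m l y := by
  simp only [unitDensity, map_mul, Complex.conj_ofReal, ← Complex.exp_conj, Complex.conj_I]
  congr 2
  · ring
  · push_cast; ring

theorem norm_unitDensity (l m : ℕ) (y : ℝ × ℝ) :
    ‖unitDensity l m y‖ = |psi l y.1 * psi m y.1| := by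
  rw [unitDensity, norm_mul, Complex.norm_exp_ofReal_mul_I, mul_one, Complex.norm_real,
    Real.norm_eq_abs]

theorem integrable_unitDensity (l m : ℕ) : Integrable (unitDensity l m) refMeasure := by
  have h : Integrable (fun y : ℝ × ℝ => (psi l y.1 * psi m y.1) * (1 : ℝ)) refMeasure :=
    (integrable_psi_mul_psi l m).mul_prod (integrable_const 1)
  refine h.mono (continuous_unitDensity l m).aestronglyMeasurable
    (Filter.Eventually.of_forall fun y => ?_)
  rw [norm_unitDensity, mul_one, Real.norm_eq_abs]

/-- Biorthogonality of the dual functions and the matrix units. -/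
theorem integral_patternC_mul_unitDensity {j k : ℕ} (hjk : j ≤ k) (l m : ℕ) :
    ∫ y, patternC j k y * unitDensity l m y ∂refMeasure =
      if l = j ∧ m = k then 1 else 0 := by
  set e : ℤ := (j : ℤ) - k - (l - m) with he
  have h1 : ∀ y : ℝ × ℝ, patternC j k y * unitDensity l m y =
      ((pattern j k y.1 * (psi l y.1 * psi m y.1) : ℝ) : ℂ) *
        Complex.exp (((e * y.2 : ℝ) : ℂ) * Complex.I) := fun y => by
    have h2 : (e : ℝ) = (j - k) + (m - l) := by rw [he]; push_cast; ring
    rw [patternC, unitDensity, h2, add_mul, Complex.ofReal_add, add_mul, Complex.exp_add]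
    push_cast
    ring
  simp_rw [h1]
  rw [refMeasure, integral_prod_mul
    (fun x => ((pattern j k x * (psi l x * psi m x) : ℝ) : ℂ))
    (fun φ : ℝ => Complex.exp (((e * φ : ℝ) : ℂ) * Complex.I)), integral_complex_ofReal]
  rcases eq_or_ne e 0 with h0 | h0
  · have hlm : l ≤ m := by omega
    obtain ⟨d, rfl⟩ := Nat.exists_eq_add_of_le hjk
    obtain ⟨d', rfl⟩ := Nat.exists_eq_add_of_le hlm
    obtain rfl : d' = d := by omega
    have h2 := integral_patternAux_mul j l d'
    simp only [pattern, min_eq_left hjk, max_eq_right hjk, Nat.add_sub_cancel_left]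
    rw [h2, h0]
    by_cases h3 : j = l
    · simp [h3]
    · rw [if_neg h3, if_neg (fun h => h3 h.1.symm)]
      simp
  · have hne : ¬ (l = j ∧ m = k) := by
      rintro ⟨rfl, rfl⟩
      exact h0 (by rw [he]; ring)
    rw [if_neg hne]
    rcases Int.even_or_odd e with h2 | h2
    · rw [integral_phase_exp_of_even h2 h0, mul_zero]
    · rw [integral_pattern_mul_of_odd, Complex.ofReal_zero, zero_mul]
      rw [← Int.odd_coe_nat]
      have : ((j + k + (l + m) : ℕ) : ℤ) = e + 2 * (k + l) := by rw [he]; push_cast; ring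
      rw [this]
      exact h2.add_even (even_two_mul _)

theorem integral_unitDensity (l m : ℕ) :
    ∫ y, unitDensity l m y ∂refMeasure = if l = m then 1 else 0 := by
  simp only [unitDensity, refMeasure]
  rw [integral_prod_mul (fun x => ((psi l x * psi m x : ℝ) : ℂ))
    (fun φ : ℝ => Complex.exp (((((m : ℝ) - l) * φ : ℝ) : ℂ) * Complex.I)),
    integral_complex_ofReal, integral_psi_mul_psi]
  split_ifs with h
  · subst h
    simp
  · simp

/-! ### Truncated densities -/

/-- The density of the compression of `ρ` to the first `N` Fock states. -/
noncomputable def truncDensity (ρ : L2R →L[ℂ] L2R) (N : ℕ) (y : ℝ × ℝ) : ℂ :=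
  ∑ i ∈ squareModel N, entry ρ i.1 i.2 * unitDensity i.1 i.2 y

theorem density_eq (ρ : L2R →L[ℂ] L2R) (y : ℝ × ℝ) :
    density ρ y = (∑' i : ℕ × ℕ, entry ρ i.1 i.2 * unitDensity i.1 i.2 y).re := by
  unfold density
  congr 2
  ext i
  rw [unitDensity, mul_assoc, mul_assoc, ← mul_assoc (psi i.1 y.1 : ℂ)]
  congr 2
  · push_cast; ring
  · congr 1; push_cast; ring

theorem continuous_truncDensity (ρ : L2R →L[ℂ] L2R) (N : ℕ) : Continuous (truncDensity ρ N) := by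
  unfold truncDensity
  exact continuous_finsetSum _ fun i _ => continuous_const.mul (continuous_unitDensity _ _)

/-- The truncated density is a diagonal value of the quadratic form of `ρ`. -/
theorem truncDensity_eq_inner (ρ : L2R →L[ℂ] L2R) (N : ℕ) (y : ℝ × ℝ) :
    truncDensity ρ N y =
      inner ℂ (∑ l ∈ Finset.range N, ((psi l y.1 : ℂ) *
          Complex.exp (((l * y.2 : ℝ) : ℂ) * Complex.I)) • fock l)
        (ρ (∑ l ∈ Finset.range N, ((psi l y.1 : ℂ) *
          Complex.exp (((l * y.2 : ℝ) : ℂ) * Complex.I)) • fock l)) := by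
  simp only [map_sum, map_smul, sum_inner, inner_sum, inner_smul_left, inner_smul_right]
  rw [truncDensity, squareModel, Finset.sum_product]
  simp only [Finset.mul_sum]
  rw [Finset.sum_comm]
  refine Finset.sum_congr rfl fun m _ => Finset.sum_congr rfl fun l _ => ?_
  change _ = _ * (_ * entry ρ l m)
  have h1 : Complex.exp (((((m : ℝ) - l) * y.2 : ℝ) : ℂ) * Complex.I) =
      starRingEnd ℂ (Complex.exp (((l * y.2 : ℝ) : ℂ) * Complex.I)) *
        Complex.exp (((m * y.2 : ℝ) : ℂ) * Complex.I) := by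
    rw [← Complex.exp_conj, ← Complex.exp_add]
    simp only [map_mul, Complex.conj_ofReal, Complex.conj_I]
    congr 1
    push_cast
    ring
  simp only [unitDensity, h1, map_mul, Complex.conj_ofReal]
  push_cast
  ring

theorem truncDensity_eq_re {ρ : L2R →L[ℂ] L2R} (hρ : ρ.IsPositive) (N : ℕ) (y : ℝ × ℝ) :
    truncDensity ρ N y = ((truncDensity ρ N y).re : ℂ) := by
  refine (Complex.conj_eq_iff_re.1 ?_).symm
  rw [truncDensity_eq_inner, inner_conj_symm]
  exact hρ.isSymmetric _ _

theorem truncDensity_re_nonneg {ρ : L2R →L[ℂ] L2R} (hρ : ρ.IsPositive) (N : ℕ) (y : ℝ × ℝ) :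
    0 ≤ (truncDensity ρ N y).re := by
  rw [truncDensity_eq_inner]
  exact hρ.re_inner_nonneg_right _

theorem integrable_truncDensity (ρ : L2R →L[ℂ] L2R) (N : ℕ) :
    Integrable (truncDensity ρ N) refMeasure := by
  unfold truncDensity
  exact integrable_finsetSum _ fun i _ => (integrable_unitDensity _ _).const_mul _

theorem integral_truncDensity (ρ : L2R →L[ℂ] L2R) (N : ℕ) :
    ∫ y, truncDensity ρ N y ∂refMeasure = ∑ l ∈ Finset.range N, entry ρ l l := by
  unfold truncDensity
  rw [integral_finsetSum _ fun i _ => (integrable_unitDensity _ _).const_mul _]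
  simp_rw [integral_const_mul, integral_unitDensity]
  rw [squareModel, Finset.sum_product]
  refine Finset.sum_congr rfl fun l hl => ?_
  simp only [mul_ite, mul_one, mul_zero, Finset.sum_ite_eq, if_pos hl]

/-- Summability of the Fock amplitudes at a point: finiteness of the energy compensates for the
slow decay of the Hermite functions. -/
theorem summable_sqrt_entry_mul_psi {ρ : L2R →L[ℂ] L2R} (hρ : IsDensityOperator ρ) {H : ℝ}
    (hH : 0 ≤ H) (hE : energy ρ ≤ ENNReal.ofReal (H + 1 / 2)) (x : ℝ) :
    Summable (fun l => Real.sqrt (entry ρ l l).re * |psi l x|) := by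
  have h0 : ∀ l, 0 ≤ (entry ρ l l).re := entry_self_nonneg hρ.isPositive
  have h1 : Summable (fun l : ℕ => (l : ℝ) * (entry ρ l l).re) := by
    have h2 := ne_top_of_le_ne_top ENNReal.ofReal_ne_top (tsum_mul_entry_le hρ hH hE)
    have h3 := ENNReal.summable_toReal h2
    refine h3.congr fun l => ?_
    rw [ENNReal.toReal_ofReal (mul_nonneg l.cast_nonneg (h0 l))]
  have h4 : Summable (fun l : ℕ => ((l : ℝ) + 1) ^ (-(7 / 6) : ℝ)) := by
    have := (summable_nat_add_iff 1).2 (Real.summable_nat_rpow (p := -(7 / 6)).2 (by norm_num))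
    simpa using this
  refine Summable.of_nonneg_of_le (fun l => by positivity) (fun l => ?_)
    ((h1.add (hasSum_entry_re hρ).summable).add (h4.mul_left 192))
  have h5 := psi_sq_le l x
  have hl : (0 : ℝ) < (l : ℝ) + 1 := by positivity
  have h6 : psi l x ^ 2 / (l + 1) ≤ 192 * ((l : ℝ) + 1) ^ (-(7 / 6) : ℝ) := by
    rw [div_le_iff₀ hl]
    have : ((l : ℝ) + 1) ^ (-(7 / 6) : ℝ) * ((l : ℝ) + 1) = ((l : ℝ) + 1) ^ (-(1 / 6) : ℝ) := by
      nth_rewrite 2 [← Real.rpow_one ((l : ℝ) + 1)]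
      rw [← Real.rpow_add hl]
      norm_num
    rw [mul_assoc, this]
    exact h5
  have h7 : Real.sqrt (entry ρ l l).re * |psi l x| ≤
      ((l : ℝ) + 1) * (entry ρ l l).re + psi l x ^ 2 / (l + 1) := by
    have h8 := Real.sq_sqrt (h0 l)
    have h9 : ((l : ℝ) + 1) * (entry ρ l l).re + psi l x ^ 2 / (l + 1) =
        (((l : ℝ) + 1) * Real.sqrt (entry ρ l l).re - |psi l x|) ^ 2 / (l + 1) +
          2 * (Real.sqrt (entry ρ l l).re * |psi l x|) := by
      rw [← sq_abs (psi l x)]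
      nth_rewrite 1 [← h8]
      field_simp
      ring
    rw [h9]
    have : 0 ≤ (((l : ℝ) + 1) * Real.sqrt (entry ρ l l).re - |psi l x|) ^ 2 / (l + 1) := by
      positivity
    have : 0 ≤ Real.sqrt (entry ρ l l).re * |psi l x| := by positivity
    linarith
  linarith

theorem summable_entry_mul_unitDensity {ρ : L2R →L[ℂ] L2R} (hρ : IsDensityOperator ρ) {H : ℝ}
    (hH : 0 ≤ H) (hE : energy ρ ≤ ENNReal.ofReal (H + 1 / 2)) (y : ℝ × ℝ) :
    Summable (fun i : ℕ × ℕ => entry ρ i.1 i.2 * unitDensity i.1 i.2 y) := by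
  have hs := summable_sqrt_entry_mul_psi hρ hH hE y.1
  refine Summable.of_norm_bounded
    (hs.mul_of_nonneg hs (fun l => by positivity) fun l => by positivity) fun i => ?_
  rw [norm_mul, norm_unitDensity, abs_mul]
  have h1 : ‖entry ρ i.1 i.2‖ ≤
      Real.sqrt (entry ρ i.1 i.1).re * Real.sqrt (entry ρ i.2 i.2).re := by
    rw [← Real.sqrt_mul (entry_self_nonneg hρ.isPositive _)]
    exact Real.le_sqrt_of_sq_le (norm_entry_sq_le hρ.isPositive _ _)
  calc ‖entry ρ i.1 i.2‖ * (|psi i.1 y.1| * |psi i.2 y.1|)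
      ≤ Real.sqrt (entry ρ i.1 i.1).re * Real.sqrt (entry ρ i.2 i.2).re *
        (|psi i.1 y.1| * |psi i.2 y.1|) := by gcongr
    _ = _ := by ring

theorem tendsto_squareModel_atTop : Filter.Tendsto squareModel Filter.atTop Filter.atTop := by
  refine Filter.tendsto_atTop_finset_of_monotone (fun a b hab => ?_) fun i => ?_
  · exact Finset.product_subset_product (Finset.range_mono hab) (Finset.range_mono hab)
  · refine ⟨i.1 + i.2 + 1, ?_⟩
    simp only [squareModel, Finset.mem_product, Finset.mem_range]
    omega

theorem tendsto_truncDensity {ρ : L2R →L[ℂ] L2R} (hρ : IsDensityOperator ρ) {H : ℝ}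
    (hH : 0 ≤ H) (hE : energy ρ ≤ ENNReal.ofReal (H + 1 / 2)) (y : ℝ × ℝ) :
    Filter.Tendsto (fun N => (truncDensity ρ N y).re) Filter.atTop (nhds (density ρ y)) := by
  rw [density_eq]
  exact (Complex.continuous_re.tendsto _).comp
    ((summable_entry_mul_unitDensity hρ hH hE y).hasSum.comp tendsto_squareModel_atTop)

theorem measurable_density {ρ : L2R →L[ℂ] L2R} (hρ : IsDensityOperator ρ) {H : ℝ}
    (hH : 0 ≤ H) (hE : energy ρ ≤ ENNReal.ofReal (H + 1 / 2)) : Measurable (density ρ) :=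
  measurable_of_tendsto_metrizable
    (fun N => (Complex.continuous_re.comp (continuous_truncDensity ρ N)).measurable)
    (tendsto_pi_nhds.2 fun y => tendsto_truncDensity hρ hH hE y)

theorem density_nonneg {ρ : L2R →L[ℂ] L2R} (hρ : IsDensityOperator ρ) {H : ℝ}
    (hH : 0 ≤ H) (hE : energy ρ ≤ ENNReal.ofReal (H + 1 / 2)) (y : ℝ × ℝ) : 0 ≤ density ρ y :=
  ge_of_tendsto' (tendsto_truncDensity hρ hH hE y)
    fun N => truncDensity_re_nonneg hρ.isPositive N y

/-! ### Unbiasedness -/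

theorem dualFun_eq_of_lt {i : ℕ × ℕ} (h : i.1 < i.2) (y : ℝ × ℝ) :
    dualFun i y = Real.sqrt 2 * (patternC i.1 i.2 y).re := by
  rw [dualFun, if_pos h, patternC, re_ofReal_mul_cexp]

theorem dualFun_eq_of_gt {i : ℕ × ℕ} (h : i.2 < i.1) (y : ℝ × ℝ) :
    dualFun i y = Real.sqrt 2 * (patternC i.2 i.1 y).im := by
  rw [dualFun, if_neg h.not_gt, if_pos h, patternC, Complex.im_ofReal_mul,
    Complex.exp_ofReal_mul_I_im]

theorem dualFun_eq_self {i : ℕ × ℕ} (h : i.1 = i.2) (y : ℝ × ℝ) :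
    dualFun i y = (patternC i.1 i.1 y).re := by
  rw [dualFun, if_neg h.not_lt, if_neg h.not_gt, patternC, re_ofReal_mul_cexp]
  simp

theorem continuous_dualFun (i : ℕ × ℕ) : Continuous (dualFun i) := by
  rcases lt_trichotomy i.1 i.2 with h | h | h
  · rw [funext (dualFun_eq_of_lt h)]
    exact continuous_const.mul (Complex.continuous_re.comp (continuous_patternC _ _))
  · rw [funext (dualFun_eq_self h)]
    exact Complex.continuous_re.comp (continuous_patternC _ _)
  · rw [funext (dualFun_eq_of_gt h)]
    exact continuous_const.mul (Complex.continuous_im.comp (continuous_patternC _ _))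

theorem norm_patternC (j k : ℕ) (y : ℝ × ℝ) : ‖patternC j k y‖ = |pattern j k y.1| := by
  rw [patternC, norm_mul, Complex.norm_exp_ofReal_mul_I, mul_one, Complex.norm_real,
    Real.norm_eq_abs]

theorem pattern_comm (j k : ℕ) : pattern j k = pattern k j := by
  unfold pattern
  rw [min_comm, max_comm]

theorem abs_dualFun_le (i : ℕ × ℕ) (y : ℝ × ℝ) :
    |dualFun i y| ≤ Real.sqrt 2 * |pattern i.1 i.2 y.1| := by
  have h1 : (1 : ℝ) ≤ Real.sqrt 2 := Real.one_le_sqrt.2 (by norm_num)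
  rcases lt_trichotomy i.1 i.2 with h | h | h
  · rw [dualFun_eq_of_lt h, abs_mul, abs_of_nonneg (Real.sqrt_nonneg 2), ← norm_patternC]
    gcongr
    exact Complex.abs_re_le_norm _
  · rw [dualFun_eq_self h, ← h, ← norm_patternC]
    nlinarith [Complex.abs_re_le_norm (patternC i.1 i.1 y), norm_nonneg (patternC i.1 i.1 y)]
  · rw [dualFun_eq_of_gt h, abs_mul, abs_of_nonneg (Real.sqrt_nonneg 2), pattern_comm,
      ← norm_patternC]
    gcongr
    exact Complex.abs_im_le_norm _

theorem dualFun_sq_le : ∃ C : ℝ, 0 < C ∧ ∀ (i : ℕ × ℕ) (y : ℝ × ℝ),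
    dualFun i y ^ 2 ≤ C * patternBound i.1 i.2 := by
  obtain ⟨C, hC, h⟩ := pattern_sq_le
  refine ⟨2 * C, by positivity, fun i y => ?_⟩
  have h1 := pow_le_pow_left₀ (abs_nonneg _) (abs_dualFun_le i y) 2
  rw [sq_abs, mul_pow, Real.sq_sqrt (by norm_num), sq_abs] at h1
  linarith [h i.1 i.2 y.1]

theorem exists_abs_dualFun_le (i : ℕ × ℕ) : ∃ B : ℝ, ∀ y, |dualFun i y| ≤ B := by
  obtain ⟨C, -, h⟩ := dualFun_sq_le
  exact ⟨_, fun y => Real.abs_le_sqrt (h i y)⟩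

theorem integrable_patternC_mul_unitDensity (j k l m : ℕ) :
    Integrable (fun y => patternC j k y * unitDensity l m y) refMeasure := by
  obtain ⟨C, -, h⟩ := pattern_sq_le
  refine (integrable_unitDensity l m).bdd_mul (c := Real.sqrt (C * patternBound j k))
    (continuous_patternC j k).aestronglyMeasurable (Filter.Eventually.of_forall fun y => ?_)
  rw [norm_patternC]
  exact Real.abs_le_sqrt (h j k y.1)

theorem integrable_patternC_mul_truncDensity (ρ : L2R →L[ℂ] L2R) (j k N : ℕ) :
    Integrable (fun y => patternC j k y * truncDensity ρ N y) refMeasure := by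
  have h1 : ∀ y, patternC j k y * truncDensity ρ N y = ∑ i ∈ squareModel N,
      entry ρ i.1 i.2 * (patternC j k y * unitDensity i.1 i.2 y) := fun y => by
    rw [truncDensity, Finset.mul_sum]
    exact Finset.sum_congr rfl fun i _ => by ring
  simp_rw [h1]
  exact integrable_finsetSum _ fun i _ => (integrable_patternC_mul_unitDensity _ _ _ _).const_mul _

theorem integral_patternC_mul_truncDensity (ρ : L2R →L[ℂ] L2R) {j k N : ℕ} (hjk : j ≤ k)
    (hk : k < N) : ∫ y, patternC j k y * truncDensity ρ N y ∂refMeasure = entry ρ j k := by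
  have h1 : ∀ y, patternC j k y * truncDensity ρ N y = ∑ i ∈ squareModel N,
      entry ρ i.1 i.2 * (patternC j k y * unitDensity i.1 i.2 y) := fun y => by
    rw [truncDensity, Finset.mul_sum]
    exact Finset.sum_congr rfl fun i _ => by ring
  simp_rw [h1]
  rw [integral_finsetSum _ fun i _ => (integrable_patternC_mul_unitDensity _ _ _ _).const_mul _]
  simp_rw [integral_const_mul, integral_patternC_mul_unitDensity hjk]
  rw [Finset.sum_eq_single_of_mem (j, k)]
  · simp
  · simp only [squareModel, Finset.mem_product, Finset.mem_range]
    omega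
  · rintro ⟨l, m⟩ - hne
    rw [if_neg (fun h => hne (Prod.ext h.1 h.2)), mul_zero]

theorem integral_dualFun_mul_truncDensity {ρ : L2R →L[ℂ] L2R} (hρ : ρ.IsPositive) {i : ℕ × ℕ}
    {N : ℕ} (h1 : i.1 < N) (h2 : i.2 < N) :
    ∫ y, dualFun i y * (truncDensity ρ N y).re ∂refMeasure = coef ρ i := by
  have hre : ∀ z y, z * truncDensity ρ N y = z * ((truncDensity ρ N y).re : ℂ) := fun z y => by
    rw [← truncDensity_eq_re hρ]
  rcases lt_trichotomy i.1 i.2 with h | h | h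
  · have e : ∀ y, dualFun i y * (truncDensity ρ N y).re =
        Real.sqrt 2 * (patternC i.1 i.2 y * truncDensity ρ N y).re := fun y => by
      rw [dualFun_eq_of_lt h, hre, Complex.re_mul_ofReal, mul_assoc]
    have h3 := integral_re (integrable_patternC_mul_truncDensity ρ i.1 i.2 N)
    rw [integral_patternC_mul_truncDensity ρ h.le h2] at h3
    simp only [RCLike.re_to_complex] at h3
    simp_rw [e]
    rw [integral_const_mul, h3, coef, if_pos h]
  · have e : ∀ y, dualFun i y * (truncDensity ρ N y).re =
        (patternC i.1 i.1 y * truncDensity ρ N y).re := fun y => by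
      rw [dualFun_eq_self h, hre, Complex.re_mul_ofReal]
    have h3 := integral_re (integrable_patternC_mul_truncDensity ρ i.1 i.1 N)
    rw [integral_patternC_mul_truncDensity ρ le_rfl h1] at h3
    simp only [RCLike.re_to_complex] at h3
    simp_rw [e]
    rw [h3, coef, if_neg h.not_lt, if_neg h.not_gt]
  · have e : ∀ y, dualFun i y * (truncDensity ρ N y).re =
        Real.sqrt 2 * (patternC i.2 i.1 y * truncDensity ρ N y).im := fun y => by
      rw [dualFun_eq_of_gt h, hre, Complex.im_mul_ofReal, mul_assoc]
    have h3 := integral_im (integrable_patternC_mul_truncDensity ρ i.2 i.1 N)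
    rw [integral_patternC_mul_truncDensity ρ h.le h1] at h3
    simp only [RCLike.im_to_complex] at h3
    simp_rw [e]
    rw [integral_const_mul, h3, coef, if_neg h.not_gt, if_pos h]

/-- Fatou's lemma for the truncated densities. -/
theorem integral_mul_density_le {ρ : L2R →L[ℂ] L2R} (hρ : IsDensityOperator ρ) {H : ℝ}
    (hH : 0 ≤ H) (hE : energy ρ ≤ ENNReal.ofReal (H + 1 / 2)) {F : ℝ × ℝ → ℝ}
    (hF : Measurable F) (hF0 : ∀ y, 0 ≤ F y) {L : ℝ} (hL0 : 0 ≤ L) {N₀ : ℕ}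
    (hint : ∀ N, Integrable (fun y => F y * (truncDensity ρ N y).re) refMeasure)
    (hL : ∀ N, N₀ ≤ N → ∫ y, F y * (truncDensity ρ N y).re ∂refMeasure ≤ L) :
    ∫ y, F y * density ρ y ∂refMeasure ≤ L := by
  have hm := measurable_density hρ hH hE
  rw [integral_eq_lintegral_of_nonneg_ae
    (Filter.Eventually.of_forall fun y => mul_nonneg (hF0 y) (density_nonneg hρ hH hE y))
    (hF.mul hm).aestronglyMeasurable]
  refine ENNReal.toReal_le_of_le_ofReal hL0 ?_
  have h1 : ∀ y, ENNReal.ofReal (F y * density ρ y) =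
      Filter.liminf (fun N => ENNReal.ofReal (F y * (truncDensity ρ N y).re)) Filter.atTop :=
    fun y => ((ENNReal.continuous_ofReal.tendsto _).comp
      ((tendsto_truncDensity hρ hH hE y).const_mul (F y))).liminf_eq.symm
  simp_rw [h1]
  refine (lintegral_liminf_le fun N => (hF.mul (Complex.continuous_re.comp
    (continuous_truncDensity ρ N)).measurable).ennreal_ofReal).trans ?_
  refine Filter.liminf_le_of_frequently_le' (Filter.Eventually.frequently ?_)
  filter_upwards [Filter.eventually_ge_atTop N₀] with N hN
  change ∫⁻ y, ENNReal.ofReal (F y * (truncDensity ρ N y).re) ∂refMeasure ≤ _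
  rw [← ofReal_integral_eq_lintegral_ofReal (hint N) (Filter.Eventually.of_forall fun y =>
    mul_nonneg (hF0 y) (truncDensity_re_nonneg hρ.isPositive N y))]
  exact ENNReal.ofReal_le_ofReal (hL N hN)

/-- The dual functions are unbiased estimators of the coefficients. With `p_N` the truncated
densities, Fatou's lemma applied to `(B ± f̃_i) p_N`, where `B` bounds `|f̃_i|`, gives both
inequalities because `p_ρ` has total mass one. -/
theorem integral_dualFun_law {ρ : L2R →L[ℂ] L2R} (hρ : IsDensityOperator ρ) {H : ℝ}
    (hH : 0 ≤ H) (hE : energy ρ ≤ ENNReal.ofReal (H + 1 / 2)) [IsProbabilityMeasure (law ρ)]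
    (i : ℕ × ℕ) : ∫ y, dualFun i y ∂(law ρ) = coef ρ i := by
  have hm := measurable_density hρ hH hE
  have hp0 := density_nonneg hρ hH hE
  have hmass : ∫⁻ y, ENNReal.ofReal (density ρ y) ∂refMeasure = 1 := by
    have := measure_univ (μ := law ρ)
    rwa [law_eq, withDensity_apply _ MeasurableSet.univ, Measure.restrict_univ] at this
  have hp_int : Integrable (density ρ) refMeasure := by
    refine ⟨hm.aestronglyMeasurable, ?_⟩
    rw [hasFiniteIntegral_iff_ofReal (Filter.Eventually.of_forall hp0), hmass]
    exact ENNReal.one_lt_top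
  have hp1 : ∫ y, density ρ y ∂refMeasure = 1 := by
    rw [integral_eq_lintegral_of_nonneg_ae (Filter.Eventually.of_forall hp0)
      hm.aestronglyMeasurable, hmass, ENNReal.toReal_one]
  obtain ⟨B, hB⟩ := exists_abs_dualFun_le i
  have hB0 : 0 ≤ B := (abs_nonneg _).trans (hB (0, 0))
  have hfp : Integrable (fun y => dualFun i y * density ρ y) refMeasure :=
    hp_int.bdd_mul (c := B) (continuous_dualFun i).aestronglyMeasurable
      (Filter.Eventually.of_forall hB)
  have hpN : ∀ N, Integrable (fun y => (truncDensity ρ N y).re) refMeasure := fun N =>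
    (integrable_truncDensity ρ N).re
  have hfpN : ∀ N, Integrable (fun y => dualFun i y * (truncDensity ρ N y).re) refMeasure :=
    fun N => (hpN N).bdd_mul (c := B) (continuous_dualFun i).aestronglyMeasurable
      (Filter.Eventually.of_forall hB)
  have hmassN : ∀ N, ∫ y, (truncDensity ρ N y).re ∂refMeasure ≤ 1 := fun N => by
    have h1 := integral_re (integrable_truncDensity ρ N)
    rw [integral_truncDensity] at h1
    simp only [RCLike.re_to_complex, Complex.re_sum] at h1
    rw [h1]
    exact sum_le_hasSum _ (fun k _ => entry_self_nonneg hρ.isPositive k) (hasSum_entry_re hρ)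
  have hlaw : ∫ y, dualFun i y ∂(law ρ) = ∫ y, dualFun i y * density ρ y ∂refMeasure := by
    rw [law_eq, integral_withDensity_eq_integral_toReal_smul hm.ennreal_ofReal
      (Filter.Eventually.of_forall fun _ => ENNReal.ofReal_lt_top)]
    refine integral_congr_ae (Filter.Eventually.of_forall fun y => ?_)
    simp only [ENNReal.toReal_ofReal (hp0 y), smul_eq_mul, mul_comm]
  have key : ∀ s : ℝ, s = 1 ∨ s = -1 →
      s * ∫ y, dualFun i y * density ρ y ∂refMeasure ≤ s * coef ρ i := by
    intro s hs
    have hsB : ∀ y, |s * dualFun i y| ≤ B := fun y => by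
      rcases hs with rfl | rfl <;> simpa using hB y
    have hdec : ∀ q : ℝ × ℝ → ℝ, (fun y => (B + s * dualFun i y) * q y) =
        fun y => B * q y + s * (dualFun i y * q y) := fun q => funext fun y => by ring
    have hN : ∀ N, i.1 + i.2 + 1 ≤ N →
        ∫ y, (B + s * dualFun i y) * (truncDensity ρ N y).re ∂refMeasure ≤
          B + s * coef ρ i := fun N hN => by
      rw [hdec fun y => (truncDensity ρ N y).re,
        integral_add ((hpN N).const_mul B) ((hfpN N).const_mul s), integral_const_mul,
        integral_const_mul, integral_dualFun_mul_truncDensity hρ.isPositive (by omega) (by omega)]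
      have := mul_le_mul_of_nonneg_left (hmassN N) hB0
      linarith
    have hL0 : 0 ≤ B + s * coef ρ i := by
      refine le_trans (integral_nonneg fun y => ?_) (hN _ le_rfl)
      exact mul_nonneg (by linarith [(abs_le.1 (hsB y)).1])
        (truncDensity_re_nonneg hρ.isPositive _ y)
    have h1 := integral_mul_density_le hρ hH hE (F := fun y => B + s * dualFun i y)
      ((continuous_dualFun i).measurable.const_mul s |>.const_add B)
      (fun y => by linarith [(abs_le.1 (hsB y)).1]) hL0
      (fun N => by
        rw [hdec fun y => (truncDensity ρ N y).re]
        exact ((hpN N).const_mul B).add ((hfpN N).const_mul s)) hN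
    rw [hdec (density ρ), integral_add (hp_int.const_mul B) (hfp.const_mul s), integral_const_mul,
      integral_const_mul, hp1] at h1
    linarith
  rw [hlaw]
  have h1 := key 1 (Or.inl rfl)
  have h2 := key (-1) (Or.inr rfl)
  linarith

theorem ae_law_mem (ρ : L2R →L[ℂ] L2R) :
    ∀ᵐ y ∂(law ρ), y ∈ (Set.univ ×ˢ Set.Icc 0 Real.pi : Set (ℝ × ℝ)) := by
  rw [law_eq]
  refine (withDensity_absolutelyContinuous _ _).ae_le ?_
  have h : ∀ᵐ y ∂refMeasure, y.2 ∈ Set.Ico 0 Real.pi :=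
    Measure.quasiMeasurePreserving_snd.ae ae_phase_mem
  filter_upwards [h] with y hy
  exact ⟨Set.mem_univ _, Set.Ico_subset_Icc_self hy⟩

/-! ### The oscillation of the dual functions -/

theorem bddAbove_dualFun (i : ℕ × ℕ) (s : Set (ℝ × ℝ)) : BddAbove (dualFun i '' s) := by
  obtain ⟨B, hB⟩ := exists_abs_dualFun_le i
  refine ⟨B, ?_⟩
  rintro _ ⟨y, -, rfl⟩
  exact (abs_le.1 (hB y)).2

theorem bddBelow_dualFun (i : ℕ × ℕ) (s : Set (ℝ × ℝ)) : BddBelow (dualFun i '' s) := by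
  obtain ⟨B, hB⟩ := exists_abs_dualFun_le i
  refine ⟨-B, ?_⟩
  rintro _ ⟨y, -, rfl⟩
  exact (abs_le.1 (hB y)).1

theorem dualFun_mem_Icc {i : ℕ × ℕ} {y : ℝ × ℝ}
    (hy : y ∈ (Set.univ ×ˢ Set.Icc 0 Real.pi : Set (ℝ × ℝ))) :
    dualFun i y ∈ Set.Icc (sInf (dualFun i '' (Set.univ ×ˢ Set.Icc 0 Real.pi)))
      (sSup (dualFun i '' (Set.univ ×ˢ Set.Icc 0 Real.pi))) :=
  ⟨csInf_le (bddBelow_dualFun i _) ⟨y, hy, rfl⟩, le_csSup (bddAbove_dualFun i _) ⟨y, hy, rfl⟩⟩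

theorem osc_nonneg (i : ℕ × ℕ) : 0 ≤ osc i := by
  have h := dualFun_mem_Icc (i := i) (y := (0, 0))
    ⟨Set.mem_univ _, le_rfl, Real.pi_pos.le⟩
  unfold osc
  linarith [h.1.trans h.2]

theorem osc_sq_le : ∃ C : ℝ, 0 < C ∧ ∀ i : ℕ × ℕ, osc i ^ 2 ≤ C * patternBound i.1 i.2 := by
  obtain ⟨C, hC, h⟩ := dualFun_sq_le
  refine ⟨4 * C, by positivity, fun i => ?_⟩
  have hb : ∀ y, |dualFun i y| ≤ Real.sqrt (C * patternBound i.1 i.2) := fun y =>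
    Real.abs_le_sqrt (h i y)
  have hne : (dualFun i '' (Set.univ ×ˢ Set.Icc 0 Real.pi)).Nonempty :=
    ⟨_, (0, 0), ⟨Set.mem_univ _, le_rfl, Real.pi_pos.le⟩, rfl⟩
  have h1 : sSup (dualFun i '' (Set.univ ×ˢ Set.Icc 0 Real.pi)) ≤
      Real.sqrt (C * patternBound i.1 i.2) := by
    refine csSup_le hne ?_
    rintro _ ⟨y, -, rfl⟩
    exact (abs_le.1 (hb y)).2
  have h2 : -Real.sqrt (C * patternBound i.1 i.2) ≤
      sInf (dualFun i '' (Set.univ ×ˢ Set.Icc 0 Real.pi)) := by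
    refine le_csInf hne ?_
    rintro _ ⟨y, -, rfl⟩
    exact (abs_le.1 (hb y)).1
  have h3 : osc i ≤ 2 * Real.sqrt (C * patternBound i.1 i.2) := by unfold osc; linarith
  have h4 := pow_le_pow_left₀ (osc_nonneg i) h3 2
  have := patternBound_pos i.1 i.2
  rw [mul_pow, Real.sq_sqrt (by positivity)] at h4
  linarith

/-- A function of mean zero sees only the oscillation of `f̃_i`. -/
theorem abs_integral_dualFun_mul_le {i : ℕ × ℕ} {h : ℝ × ℝ → ℝ} (hh : Integrable h refMeasure)
    (h0 : ∫ y, h y ∂refMeasure = 0) :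
    |∫ y, dualFun i y * h y ∂refMeasure| ≤ osc i / 2 * ∫ y, |h y| ∂refMeasure := by
  obtain ⟨B, hB⟩ := exists_abs_dualFun_le i
  set S := dualFun i '' (Set.univ ×ˢ Set.Icc 0 Real.pi) with hS
  set c := (sSup S + sInf S) / 2 with hc
  have hfh : Integrable (fun y => dualFun i y * h y) refMeasure :=
    hh.bdd_mul (c := B) (continuous_dualFun i).aestronglyMeasurable
      (Filter.Eventually.of_forall hB)
  have h1 : ∫ y, dualFun i y * h y ∂refMeasure = ∫ y, (dualFun i y - c) * h y ∂refMeasure := by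
    simp_rw [sub_mul]
    rw [integral_sub hfh (hh.const_mul c), integral_const_mul, h0, mul_zero, sub_zero]
  rw [h1, ← integral_const_mul, ← Real.norm_eq_abs]
  refine norm_integral_le_of_norm_le (hh.abs.const_mul _) ?_
  have hae : ∀ᵐ y ∂refMeasure, y.2 ∈ Set.Ico 0 Real.pi :=
    Measure.quasiMeasurePreserving_snd.ae ae_phase_mem
  filter_upwards [hae] with y hy
  have h2 := dualFun_mem_Icc (i := i) (y := y) ⟨Set.mem_univ _, Set.Ico_subset_Icc_self hy⟩
  rw [Real.norm_eq_abs, abs_mul]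
  gcongr
  rw [← hS] at h2
  rw [abs_le, osc, ← hS]
  constructor <;> linarith [h2.1, h2.2]

theorem integral_abs_re_unitDensity_le (l m : ℕ) :
    ∫ y, ‖unitDensity l m y‖ ∂refMeasure ≤ 1 := by
  have h1 : ∫ y, ‖unitDensity l m y‖ ∂refMeasure = ∫ x, |psi l x * psi m x| := by
    simp_rw [norm_unitDensity]
    have := integral_prod_mul (μ := (volume : Measure ℝ)) (ν := phase)
      (fun x => |psi l x * psi m x|) (fun _ => (1 : ℝ))
    simpa [refMeasure] using this
  have h2 : ∀ x, |psi l x * psi m x| ≤ 1 / 2 * (psi l x * psi l x) + 1 / 2 * (psi m x * psi m x) :=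
    fun x => by
      rw [abs_mul]
      nlinarith [sq_nonneg (|psi l x| - |psi m x|), sq_abs (psi l x), sq_abs (psi m x)]
  rw [h1]
  refine (integral_mono (integrable_psi_mul_psi l m).abs
    (((integrable_psi_mul_psi l l).const_mul _).add ((integrable_psi_mul_psi m m).const_mul _))
    h2).trans (le_of_eq ?_)
  simp only [Pi.add_apply]
  rw [integral_add ((integrable_psi_mul_psi l l).const_mul _)
    ((integrable_psi_mul_psi m m).const_mul _), integral_const_mul, integral_const_mul,
    integral_psi_mul_psi, integral_psi_mul_psi]
  norm_num

/-- The penalty is nonnegative because `M_i ≥ 1`: the means of `f̃_i` under two states differing in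
the `i`-th coefficient are at distance at least one. -/
theorem one_le_osc (i : ℕ × ℕ) : 1 ≤ osc i := by
  have s2 : (1 : ℝ) ≤ Real.sqrt 2 := Real.one_le_sqrt.2 (by norm_num)
  have key : ∀ h : ℝ × ℝ → ℝ, Integrable h refMeasure → ∫ y, h y ∂refMeasure = 0 →
      ∫ y, |h y| ∂refMeasure ≤ 2 → 1 ≤ |∫ y, dualFun i y * h y ∂refMeasure| → 1 ≤ osc i := by
    intro h h1 h2 h3 h4
    have h5 := abs_integral_dualFun_mul_le (i := i) h1 h2
    have h6 := osc_nonneg i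
    nlinarith
  have habs : ∀ l m, ∀ f : ℂ → ℝ, (∀ z, |f z| ≤ ‖z‖) → Continuous f →
      ∫ y, |2 * f (unitDensity l m y)| ∂refMeasure ≤ 2 := fun l m f hf hfc => by
    refine (integral_mono_of_nonneg (Filter.Eventually.of_forall fun y => abs_nonneg _)
      ((integrable_unitDensity l m).norm.const_mul 2)
      (Filter.Eventually.of_forall fun y => ?_)).trans ?_
    · simp only [abs_mul, abs_two]
      gcongr
      exact hf _
    · rw [integral_const_mul]
      linarith [integral_abs_re_unitDensity_le l m]
  rcases lt_trichotomy i.1 i.2 with h | h | h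
  · have e0 := integral_re (integrable_unitDensity i.1 i.2)
    have e1 := integral_re ((integrable_patternC_mul_unitDensity i.1 i.2 i.1 i.2).add
      (integrable_patternC_mul_unitDensity i.1 i.2 i.2 i.1))
    simp only [Pi.add_apply] at e1
    rw [integral_unitDensity, if_neg h.ne] at e0
    rw [integral_add (integrable_patternC_mul_unitDensity i.1 i.2 i.1 i.2)
      (integrable_patternC_mul_unitDensity i.1 i.2 i.2 i.1),
      integral_patternC_mul_unitDensity h.le, integral_patternC_mul_unitDensity h.le,
      if_pos ⟨rfl, rfl⟩, if_neg (fun h' => h.ne h'.2)] at e1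
    simp only [RCLike.re_to_complex, Complex.zero_re, add_zero, Complex.one_re] at e0 e1
    refine key (fun y => 2 * (unitDensity i.1 i.2 y).re)
      ((integrable_unitDensity i.1 i.2).re.const_mul 2)
      (by rw [integral_const_mul, e0, mul_zero])
      (habs _ _ Complex.re Complex.abs_re_le_norm Complex.continuous_re) ?_
    have e2 : ∀ y, dualFun i y * (2 * (unitDensity i.1 i.2 y).re) = Real.sqrt 2 *
        (patternC i.1 i.2 y * unitDensity i.1 i.2 y +
          patternC i.1 i.2 y * unitDensity i.2 i.1 y).re := fun y => by
      rw [dualFun_eq_of_lt h, ← conj_unitDensity i.1 i.2]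
      simp only [Complex.add_re, Complex.mul_re, Complex.conj_re, Complex.conj_im]
      ring
    simp_rw [e2]
    rw [integral_const_mul, e1, mul_one, abs_of_nonneg (by positivity)]
    exact s2
  · have hw := integrable_unitDensity i.1 i.1
    have hw' := integrable_unitDensity (i.1 + 1) (i.1 + 1)
    have e0 := integral_re (hw.sub hw')
    have e1 := integral_re ((integrable_patternC_mul_unitDensity i.1 i.1 i.1 i.1).sub
      (integrable_patternC_mul_unitDensity i.1 i.1 (i.1 + 1) (i.1 + 1)))
    simp only [Pi.sub_apply] at e0 e1
    rw [integral_sub hw hw', integral_unitDensity, integral_unitDensity, if_pos rfl,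
      if_pos rfl] at e0
    rw [integral_sub (integrable_patternC_mul_unitDensity i.1 i.1 i.1 i.1)
      (integrable_patternC_mul_unitDensity i.1 i.1 (i.1 + 1) (i.1 + 1)),
      integral_patternC_mul_unitDensity le_rfl, integral_patternC_mul_unitDensity le_rfl,
      if_pos ⟨rfl, rfl⟩, if_neg (by omega)] at e1
    simp only [RCLike.re_to_complex, sub_self, sub_zero, Complex.zero_re, Complex.one_re] at e0 e1
    have him : ∀ l y, (unitDensity l l y).im = 0 := fun l y =>
      Complex.conj_eq_iff_im.1 (conj_unitDensity l l y)
    refine key (fun y => (unitDensity i.1 i.1 y - unitDensity (i.1 + 1) (i.1 + 1) y).re)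
      (hw.sub hw').re e0 ?_ ?_
    · refine (integral_mono_of_nonneg (Filter.Eventually.of_forall fun y => abs_nonneg _)
        (hw.norm.add hw'.norm) (Filter.Eventually.of_forall fun y =>
          (Complex.abs_re_le_norm _).trans (norm_sub_le _ _))).trans ?_
      rw [integral_add' hw.norm hw'.norm]
      linarith [integral_abs_re_unitDensity_le i.1 i.1,
        integral_abs_re_unitDensity_le (i.1 + 1) (i.1 + 1)]
    · have e2 : ∀ y, dualFun i y * (unitDensity i.1 i.1 y -
          unitDensity (i.1 + 1) (i.1 + 1) y).re = (patternC i.1 i.1 y * unitDensity i.1 i.1 y -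
          patternC i.1 i.1 y * unitDensity (i.1 + 1) (i.1 + 1) y).re := fun y => by
        rw [dualFun_eq_self h]
        simp only [Complex.sub_re, Complex.mul_re, him]
        ring
      simp_rw [e2]
      rw [e1, abs_one]
  · have e0 := integral_im (integrable_unitDensity i.2 i.1)
    have e1 := integral_re ((integrable_patternC_mul_unitDensity i.2 i.1 i.1 i.2).sub
      (integrable_patternC_mul_unitDensity i.2 i.1 i.2 i.1))
    simp only [Pi.sub_apply] at e1
    rw [integral_unitDensity, if_neg h.ne] at e0
    rw [integral_sub (integrable_patternC_mul_unitDensity i.2 i.1 i.1 i.2)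
      (integrable_patternC_mul_unitDensity i.2 i.1 i.2 i.1),
      integral_patternC_mul_unitDensity h.le, integral_patternC_mul_unitDensity h.le,
      if_neg (fun h' => h.ne h'.2), if_pos ⟨rfl, rfl⟩] at e1
    simp only [RCLike.re_to_complex, RCLike.im_to_complex, Complex.zero_im, zero_sub,
      Complex.neg_re, Complex.one_re] at e0 e1
    refine key (fun y => 2 * (unitDensity i.2 i.1 y).im)
      ((integrable_unitDensity i.2 i.1).im.const_mul 2)
      (by rw [integral_const_mul, e0, mul_zero])
      (habs _ _ Complex.im Complex.abs_im_le_norm Complex.continuous_im) ?_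
    have e2 : ∀ y, dualFun i y * (2 * (unitDensity i.2 i.1 y).im) = Real.sqrt 2 *
        (patternC i.2 i.1 y * unitDensity i.1 i.2 y -
          patternC i.2 i.1 y * unitDensity i.2 i.1 y).re := fun y => by
      rw [dualFun_eq_of_gt h, ← conj_unitDensity i.2 i.1]
      simp only [Complex.sub_re, Complex.mul_re, Complex.conj_re, Complex.conj_im]
      ring
    simp_rw [e2]
    rw [integral_const_mul, e1, mul_neg, mul_one, abs_neg, abs_of_nonneg (by positivity)]
    exact s2

/-! ### Concentration of the empirical coefficients -/

/-- A random variable with the two-sided Gaussian tail `2 exp (-a s²)` has a small expected excess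
of its square over a level `b`. -/
theorem lintegral_sq_sub_le {Ω : Type*} [MeasurableSpace Ω] {P : Measure Ω} {ν : Ω → ℝ}
    (hν : Measurable ν) {a b : ℝ} (ha : 0 < a) (hb : 0 ≤ b)
    (htail : ∀ s, 0 ≤ s → P {ω | s ≤ |ν ω|} ≤ ENNReal.ofReal (2 * Real.exp (-(a * s ^ 2)))) :
    ∫⁻ ω, ENNReal.ofReal (ν ω ^ 2 - b) ∂P ≤ ENNReal.ofReal (2 / a * Real.exp (-(a * b))) := by
  have h1 : ∀ ω, ENNReal.ofReal (ν ω ^ 2 - b) = ENNReal.ofReal (max (ν ω ^ 2 - b) 0) := fun ω => by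
    rcases le_total (ν ω ^ 2 - b) 0 with h | h
    · rw [max_eq_right h, ENNReal.ofReal_of_nonpos h, ENNReal.ofReal_zero]
    · rw [max_eq_left h]
  simp_rw [h1]
  rw [lintegral_eq_lintegral_meas_le P (f := fun ω => max (ν ω ^ 2 - b) 0)
    (Filter.Eventually.of_forall fun ω => le_max_right _ _)
    (((hν.pow_const 2).sub_const b).max measurable_const).aemeasurable]
  have h2 : ∀ t ∈ Set.Ioi (0 : ℝ), P {ω | t ≤ max (ν ω ^ 2 - b) 0} ≤
      ENNReal.ofReal (2 * Real.exp (-(a * b)) * Real.exp (-a * t)) := fun t ht => by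
    have ht' : 0 < t := ht
    have h3 : {ω | t ≤ max (ν ω ^ 2 - b) 0} ⊆ {ω | Real.sqrt (b + t) ≤ |ν ω|} := fun ω hω => by
      rcases le_max_iff.1 (show t ≤ max (ν ω ^ 2 - b) 0 from hω) with h | h
      · show Real.sqrt (b + t) ≤ |ν ω|
        rw [← Real.sqrt_sq_eq_abs]
        exact Real.sqrt_le_sqrt (by linarith)
      · linarith
    refine (measure_mono h3).trans ((htail _ (Real.sqrt_nonneg _)).trans (le_of_eq ?_))
    rw [Real.sq_sqrt (by positivity), mul_assoc, ← Real.exp_add]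
    congr 3
    ring
  refine (setLIntegral_mono' measurableSet_Ioi h2).trans (le_of_eq ?_)
  have h4 : IntegrableOn (fun t : ℝ => Real.exp (-a * t)) (Set.Ioi 0) :=
    exp_neg_integrableOn_Ioi 0 ha
  rw [← ofReal_integral_eq_lintegral_ofReal (h4.const_mul _)
    (Filter.Eventually.of_forall fun t => by positivity), integral_const_mul]
  congr 1
  rw [integral_exp_mul_Ioi (by linarith) 0]
  simp
  field_simp

theorem measurable_empCoeff {n : ℕ} (i : ℕ × ℕ) :
    Measurable fun y : Fin n → ℝ × ℝ => empCoeff y i := by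
  unfold empCoeff
  have := (continuous_dualFun i).measurable
  fun_prop

/-- Hoeffding's inequality for the empirical coefficients. -/
theorem measure_le_abs_empCoeff_sub_coef_le {ρ : L2R →L[ℂ] L2R} (hρ : IsDensityOperator ρ) {H : ℝ}
    (hH : 0 ≤ H) (hE : energy ρ ≤ ENNReal.ofReal (H + 1 / 2)) {Ω : Type*} [MeasurableSpace Ω]
    {P : Measure Ω} [IsProbabilityMeasure P] {n : ℕ} (hn : 0 < n) {Y : Fin n → Ω → ℝ × ℝ}
    (hY : ∀ k, Measurable (Y k)) (hindep : iIndepFun Y P) (hlaw : ∀ k, P.map (Y k) = law ρ)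
    (i : ℕ × ℕ) {s : ℝ} (hs : 0 ≤ s) :
    P {ω | s ≤ |empCoeff (fun k => Y k ω) i - coef ρ i|} ≤
      ENNReal.ofReal (2 * Real.exp (-(2 * n / osc i ^ 2 * s ^ 2))) := by
  have hn' : (0 : ℝ) < n := by exact_mod_cast hn
  have hM := one_le_osc i
  have : IsProbabilityMeasure (law ρ) := by
    rw [← hlaw ⟨0, hn⟩]
    exact Measure.isProbabilityMeasure_map (hY _).aemeasurable
  have hf := (continuous_dualFun i).measurable
  set X : Fin n → Ω → ℝ := fun k ω => dualFun i (Y k ω) - coef ρ i with hX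
  set c : NNReal := (‖osc i‖₊ / 2) ^ 2 with hc
  have hc' : (c : ℝ) = osc i ^ 2 / 4 := by
    rw [hc]
    push_cast
    rw [Real.norm_eq_abs, div_pow, sq_abs]
    norm_num
  have hsub : ∀ k, HasSubgaussianMGF (X k) c P := fun k => by
    have hb : ∀ᵐ ω ∂P, dualFun i (Y k ω) ∈
        Set.Icc (sInf (dualFun i '' (Set.univ ×ˢ Set.Icc 0 Real.pi)))
          (sSup (dualFun i '' (Set.univ ×ˢ Set.Icc 0 Real.pi))) := by
      have h := ae_law_mem ρ
      rw [← hlaw k] at h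
      filter_upwards [ae_of_ae_map (hY k).aemeasurable h] with ω hω
      exact dualFun_mem_Icc hω
    have h := hasSubgaussianMGF_of_mem_Icc (hf.comp (hY k)).aemeasurable hb
    have hmean : ∫ ω, dualFun i (Y k ω) ∂P = coef ρ i := by
      rw [← integral_dualFun_law hρ hH hE, ← hlaw k]
      exact (integral_map (hY k).aemeasurable hf.aestronglyMeasurable).symm
    simp only [Function.comp_apply, hmean] at h
    exact h
  have hXi : iIndepFun X P := hindep.comp (fun _ y => dualFun i y - coef ρ i)
    fun _ => hf.sub_const _
  have hXi' : iIndepFun (fun k => -X k) P := hindep.comp (fun _ y => -(dualFun i y - coef ρ i))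
    fun _ => (hf.sub_const _).neg
  have hsum : ∀ ω, ∑ k, X k ω = n * (empCoeff (fun k => Y k ω) i - coef ρ i) := fun ω => by
    simp only [hX, empCoeff, Finset.sum_sub_distrib, Finset.sum_const, Finset.card_univ,
      Fintype.card_fin, nsmul_eq_mul]
    field_simp
  have hexp : ∀ t : ℝ, t = n * s → -t ^ 2 / (2 * ∑ _k : Fin n, (c : ℝ)) =
      -(2 * n / osc i ^ 2 * s ^ 2) := fun t ht => by
    rw [Finset.sum_const, Finset.card_univ, Fintype.card_fin, nsmul_eq_mul, hc', ht]
    field_simp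
    ring
  have h1 := HasSubgaussianMGF.measure_sum_ge_le_of_iIndepFun hXi (s := Finset.univ)
    (c := fun _ => c) (fun k _ => hsub k) (ε := n * s) (by positivity)
  have h2 := HasSubgaussianMGF.measure_sum_ge_le_of_iIndepFun hXi' (s := Finset.univ)
    (c := fun _ => c) (fun k _ => (hsub k).neg) (ε := n * s) (by positivity)
  push_cast at h1 h2
  rw [hexp _ rfl] at h1 h2
  have hsubset : {ω | s ≤ |empCoeff (fun k => Y k ω) i - coef ρ i|} ⊆
      {ω | n * s ≤ ∑ k, X k ω} ∪ {ω | n * s ≤ ∑ k, (-X k) ω} := fun ω hω => by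
    simp only [Set.mem_union, Set.mem_ofPred_eq, Pi.neg_apply, Finset.sum_neg_distrib, hsum]
    rcases le_abs.1 (show s ≤ |empCoeff (fun k => Y k ω) i - coef ρ i| from hω) with h | h
    · left
      gcongr
    · right
      rw [← mul_neg]
      gcongr
  refine (measure_mono hsubset).trans ((measure_union_le _ _).trans ?_)
  rw [two_mul, ENNReal.ofReal_add (by positivity) (by positivity)]
  refine add_le_add ?_ ?_
  · rw [← ofReal_measureReal]
    exact ENNReal.ofReal_le_ofReal h1
  · rw [← ofReal_measureReal]
    exact ENNReal.ofReal_le_ofReal h2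

/-- The excess of the squared error of an empirical coefficient over its penalty. -/
theorem lintegral_empCoeff_sub_coef_sq_sub_le {ρ : L2R →L[ℂ] L2R} (hρ : IsDensityOperator ρ)
    {H : ℝ} (hH : 0 ≤ H) (hE : energy ρ ≤ ENNReal.ofReal (H + 1 / 2)) {Ω : Type*}
    [MeasurableSpace Ω] {P : Measure Ω} [IsProbabilityMeasure P] {n : ℕ} (hn : 0 < n)
    {Y : Fin n → Ω → ℝ × ℝ} (hY : ∀ k, Measurable (Y k)) (hindep : iIndepFun Y P)
    (hlaw : ∀ k, P.map (Y k) = law ρ) (i : ℕ × ℕ) {w : ℝ} (hw : 0 ≤ w) :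
    ∫⁻ ω, ENNReal.ofReal ((empCoeff (fun k => Y k ω) i - coef ρ i) ^ 2 -
        (Real.log (osc i) + w / 2) * (osc i ^ 2 / n)) ∂P ≤
      ENNReal.ofReal (Real.exp (-w) / n) := by
  have hn' : (0 : ℝ) < n := by exact_mod_cast hn
  have hM := one_le_osc i
  have hM0 : 0 < osc i := by linarith
  have hlog := Real.log_nonneg hM
  have hmeas : Measurable fun ω => empCoeff (fun k => Y k ω) i - coef ρ i :=
    ((measurable_empCoeff i).comp (measurable_pi_lambda _ hY)).sub_const _
  refine (lintegral_sq_sub_le hmeas (a := 2 * n / osc i ^ 2) (by positivity) (by positivity)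
    fun s hs => measure_le_abs_empCoeff_sub_coef_le hρ hH hE hn hY hindep hlaw i hs).trans
      (le_of_eq ?_)
  congr 1
  have h1 : -(2 * n / osc i ^ 2 * ((Real.log (osc i) + w / 2) * (osc i ^ 2 / n))) =
      -(Real.log (osc i) + Real.log (osc i)) + -w := by
    field_simp
    ring
  rw [h1, Real.exp_add, Real.exp_neg, Real.exp_add, Real.exp_log hM0]
  field_simp

/-! ### The oracle inequality -/

/-- One coordinate of the oracle inequality. Here `c` is the true coefficient, `r` its estimate,
`(1 + ε) q` its penalty, and `u`, `v` tell whether the coordinate belongs to the selected and to the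
reference model. -/
theorem coordinate_oracle_le {ε : ℝ} (hε : 0 < ε) {c r q : ℝ} (hq : 0 ≤ q) (u v : Prop)
    [Decidable u] [Decidable v] :
    min ε 1 / 2 * ((if u then r else 0) - c) ^ 2 +
        ((if u then r ^ 2 - (1 + ε) * q else 0) - if v then r ^ 2 - (1 + ε) * q else 0) ≤
      (3 + 2 / ε + 2 * ε) *
        ((c - if v then c else 0) ^ 2 + (if v then q else 0) + max ((r - c) ^ 2 - q) 0) := by
  set κ := min ε 1 / 2 with hκ
  have hκ0 : 0 < κ := by positivity
  have hκε : κ ≤ ε / 2 := by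
    have := min_le_left ε 1
    linarith
  have hκ1 : κ ≤ 1 / 2 := by
    have := min_le_right ε 1
    linarith
  set p := max ((r - c) ^ 2 - q) 0 with hp
  have hp0 : 0 ≤ p := le_max_right _ _
  have hpν : (r - c) ^ 2 - q ≤ p := le_max_left _ _
  have hε' : 0 < 2 / ε := by positivity
  have hν0 := sq_nonneg (r - c)
  have hc0 := sq_nonneg c
  -- Young's inequality, with a weight that leaves room below `1 + ε` on the error `r - c`
  have hy : r ^ 2 ≤ (1 + 2 / ε) * c ^ 2 + (1 + ε / 2) * (r - c) ^ 2 := by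
    have h : (1 + 2 / ε) * c ^ 2 + (1 + ε / 2) * (r - c) ^ 2 - r ^ 2 =
        (2 * c - ε * (r - c)) ^ 2 / (2 * ε) := by
      field_simp
      ring
    have : 0 ≤ (2 * c - ε * (r - c)) ^ 2 / (2 * ε) := by positivity
    linarith
  have hy' : c ^ 2 ≤ 2 * r ^ 2 + 2 * (r - c) ^ 2 := by nlinarith [sq_nonneg (2 * r - c)]
  have h1 : κ * (r - c) ^ 2 ≤ ε / 2 * (r - c) ^ 2 := by gcongr
  have h2 : κ * (r - c) ^ 2 ≤ 1 / 2 * (r - c) ^ 2 := by gcongr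
  have h3 : κ * c ^ 2 ≤ 1 / 2 * c ^ 2 := by gcongr
  have h4 : (1 + ε) * (r - c) ^ 2 ≤ (1 + ε) * (p + q) := by gcongr; linarith
  have m1 : 0 ≤ 2 / ε * c ^ 2 := by positivity
  have m2 : 0 ≤ 2 / ε * p := by positivity
  have m3 : 0 ≤ 2 / ε * q := by positivity
  have m4 : 0 ≤ ε * p := by positivity
  have m5 : 0 ≤ ε * q := by positivity
  have m6 : 0 ≤ ε * c ^ 2 := by positivity
  by_cases hu : u <;> by_cases hv : v <;> simp only [hu, hv, if_true, if_false] <;>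
    simp only [sub_zero, zero_sub, sub_self, neg_sq, add_zero] <;> nlinarith

/-- A minimizer of the penalized contrast over models containing `I` has a loss controlled by the
bias of `I`, its penalty, and the excess of the squared errors over the penalties. -/
theorem tsum_loss_le {ι : Type*} [DecidableEq ι] {ε : ℝ} (hε : 0 < ε) {m I : Finset ι}
    {c r q : ι → ℝ} (hq : ∀ i, 0 ≤ q i)
    (hsel : ∑ i ∈ I, (r i ^ 2 - (1 + ε) * q i) ≤ ∑ i ∈ m, (r i ^ 2 - (1 + ε) * q i)) :
    ∑' i, ENNReal.ofReal (((if i ∈ m then r i else 0) - c i) ^ 2) ≤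
      ENNReal.ofReal ((min ε 1 / 2)⁻¹ * (3 + 2 / ε + 2 * ε)) *
        (∑' i, ENNReal.ofReal ((c i - if i ∈ I then c i else 0) ^ 2) +
          ENNReal.ofReal (∑ i ∈ I, q i) + ∑' i, ENNReal.ofReal ((r i - c i) ^ 2 - q i)) := by
  have hκ : 0 < min ε 1 / 2 := by positivity
  set κ := min ε 1 / 2
  set K := 3 + 2 / ε + 2 * ε with hK
  have hK0 : 0 < K := by positivity
  set B : ι → ℝ := fun i => (c i - if i ∈ I then c i else 0) ^ 2 + (if i ∈ I then q i else 0) +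
    max ((r i - c i) ^ 2 - q i) 0 with hB
  have hif : ∀ i, 0 ≤ if i ∈ I then q i else 0 := fun i => by
    split_ifs
    · exact hq i
    · exact le_rfl
  have hB0 : ∀ i, 0 ≤ B i := fun i =>
    add_nonneg (add_nonneg (sq_nonneg _) (hif i)) (le_max_right _ _)
  have h1 : ∑' i, ENNReal.ofReal (((if i ∈ m then r i else 0) - c i) ^ 2) ≤
      ∑' i, ENNReal.ofReal (κ⁻¹ * K * B i) := by
    rw [ENNReal.tsum_eq_iSup_sum]
    refine iSup_le fun T => ?_
    -- on finite sets containing both models the selection inequality applies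
    set S := T ∪ (m ∪ I) with hS
    refine (Finset.sum_le_sum_of_subset (Finset.subset_union_left : T ⊆ S)).trans
      (le_trans ?_ (ENNReal.sum_le_tsum S))
    rw [← ENNReal.ofReal_sum_of_nonneg fun i _ => sq_nonneg _,
      ← ENNReal.ofReal_sum_of_nonneg fun i _ => mul_nonneg (by positivity) (hB0 i)]
    refine ENNReal.ofReal_le_ofReal ?_
    have h2 := Finset.sum_le_sum fun i (_ : i ∈ S) =>
      coordinate_oracle_le hε (c := c i) (r := r i) (hq i) (i ∈ m) (i ∈ I)
    rw [Finset.sum_add_distrib, Finset.sum_sub_distrib, Finset.sum_ite_mem, Finset.sum_ite_mem,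
      Finset.inter_eq_right.2 (Finset.subset_union_left.trans Finset.subset_union_right),
      Finset.inter_eq_right.2 (Finset.subset_union_right.trans Finset.subset_union_right),
      ← Finset.mul_sum, ← Finset.mul_sum] at h2
    rw [← Finset.mul_sum, mul_assoc, ← div_eq_inv_mul, le_div_iff₀ hκ, mul_comm]
    exact (le_add_of_nonneg_right (sub_nonneg.2 hsel)).trans h2
  refine h1.trans (le_of_eq ?_)
  have h3 : ∀ i, ENNReal.ofReal (κ⁻¹ * K * B i) = ENNReal.ofReal (κ⁻¹ * K) *
      (ENNReal.ofReal ((c i - if i ∈ I then c i else 0) ^ 2) +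
        ENNReal.ofReal (if i ∈ I then q i else 0) + ENNReal.ofReal ((r i - c i) ^ 2 - q i)) :=
    fun i => by
    rw [ENNReal.ofReal_mul (by positivity), hB,
      ENNReal.ofReal_add (add_nonneg (sq_nonneg _) (hif i)) (le_max_right _ _),
      ENNReal.ofReal_add (sq_nonneg _) (hif i), ENNReal.ofReal_max, ENNReal.ofReal_zero,
      max_eq_left zero_le]
  simp_rw [h3]
  rw [ENNReal.tsum_mul_left, ENNReal.tsum_add, ENNReal.tsum_add]
  congr 3
  rw [tsum_eq_sum (s := I) fun i hi => by simp [hi],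
    ENNReal.ofReal_sum_of_nonneg fun i _ => hq i]
  exact Finset.sum_congr rfl fun i hi => by simp [hi]

theorem hsSq_projEst_sub {ρ : L2R →L[ℂ] L2R} (hρ : ρ.IsPositive) {n : ℕ} (y : Fin n → ℝ × ℝ)
    (m : Finset (ℕ × ℕ)) : hsSq (projEst y m - ρ) =
      ∑' i, ENNReal.ofReal (((if i ∈ m then empCoeff y i else 0) - coef ρ i) ^ 2) :=
  hsSq_eq_tsum fun j k => by
    rw [entry_sub, projEst, entry_modelOp, entry_eq_matOf hρ, matOf_sub]

theorem hsSq_sub_modelOp_coef {ρ : L2R →L[ℂ] L2R} (hρ : ρ.IsPositive) (m : Finset (ℕ × ℕ)) :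
    hsSq (ρ - modelOp m (coef ρ)) =
      ∑' i, ENNReal.ofReal ((coef ρ i - if i ∈ m then coef ρ i else 0) ^ 2) :=
  hsSq_eq_tsum fun j k => by
    rw [entry_sub, entry_modelOp, entry_eq_matOf hρ, matOf_sub]

theorem empContrast_add_penalty (ε : ℝ) (w : ℕ × ℕ → ℝ) {n : ℕ} (y : Fin n → ℝ × ℝ)
    (m : Finset (ℕ × ℕ)) : empContrast y m (empCoeff y) + penalty ε w n m =
      -∑ i ∈ m, (empCoeff y i ^ 2 -
        (1 + ε) * ((Real.log (osc i) + w i / 2) * (osc i ^ 2 / n))) := by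
  rw [empContrast, penalty, Finset.sum_sub_distrib]
  simp only [← mul_assoc, ← pow_two]
  ring

/-- The risk of the penalized estimator against any square model. -/
theorem lintegral_risk_le {ε : ℝ} (hε : 0 < ε) {σ : ℝ} {w : ℕ × ℕ → ℝ} (hw : ∀ i, 0 < w i)
    (hws : Summable fun i => Real.exp (-w i)) (hwσ : ∑' i, Real.exp (-w i) ≤ σ)
    {models : Set (Finset (ℕ × ℕ))} {n : ℕ} (hn : 0 < n)
    {mhat : (Fin n → ℝ × ℝ) → Finset (ℕ × ℕ)} (hsel : IsPenalizedSelector ε w models n mhat)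
    {ρ : L2R →L[ℂ] L2R} (hρ : IsDensityOperator ρ) {H : ℝ} (hH : 0 ≤ H)
    (hE : energy ρ ≤ ENNReal.ofReal (H + 1 / 2)) {Ω : Type*} [MeasurableSpace Ω] {P : Measure Ω}
    [IsProbabilityMeasure P] {Y : Fin n → Ω → ℝ × ℝ} (hY : ∀ k, Measurable (Y k))
    (hindep : iIndepFun Y P) (hlaw : ∀ k, P.map (Y k) = law ρ) {N : ℕ} (hN : 1 ≤ N)
    (hmem : squareModel N ∈ models) :
    ∫⁻ ω, hsSq (projEst (fun k => Y k ω) (mhat fun k => Y k ω) - ρ) ∂P ≤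
      ENNReal.ofReal ((min ε 1 / 2)⁻¹ * (3 + 2 / ε + 2 * ε) * (2 * H / N +
        ∑ i ∈ squareModel N, (Real.log (osc i) + w i / 2) * (osc i ^ 2 / n) + σ / n)) := by
  have hn' : (0 : ℝ) < n := by exact_mod_cast hn
  have hN' : (0 : ℝ) < N := by exact_mod_cast hN
  set q : ℕ × ℕ → ℝ := fun i => (Real.log (osc i) + w i / 2) * (osc i ^ 2 / n) with hq
  have hq0 : ∀ i, 0 ≤ q i := fun i => by
    have h1 := Real.log_nonneg (one_le_osc i)
    have h2 := hw i
    positivity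
  set K := (min ε 1 / 2)⁻¹ * (3 + 2 / ε + 2 * ε) with hK
  have hK0 : 0 < K := by positivity
  have hpoint : ∀ ω, hsSq (projEst (fun k => Y k ω) (mhat fun k => Y k ω) - ρ) ≤
      ENNReal.ofReal K * (ENNReal.ofReal (2 * H / N) +
        ENNReal.ofReal (∑ i ∈ squareModel N, q i) +
        ∑' i, ENNReal.ofReal ((empCoeff (fun k => Y k ω) i - coef ρ i) ^ 2 - q i)) := fun ω => by
    have h1 := hsel.le (fun k => Y k ω) _ hmem
    rw [empContrast_add_penalty, empContrast_add_penalty, neg_le_neg_iff] at h1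
    have h2 := tsum_coef_sq_not_mem_le hρ hH hE hN
    rw [hsSq_sub_modelOp_coef hρ.isPositive] at h2
    rw [hsSq_projEst_sub hρ.isPositive]
    refine (tsum_loss_le hε hq0 h1).trans ?_
    gcongr
  refine (lintegral_mono hpoint).trans ?_
  have hmeas : ∀ i, Measurable fun ω =>
      ENNReal.ofReal ((empCoeff (fun k => Y k ω) i - coef ρ i) ^ 2 - q i) := fun i =>
    (((((measurable_empCoeff i).comp (measurable_pi_lambda _ hY)).sub_const _).pow_const
      2).sub_const _).ennreal_ofReal
  rw [lintegral_const_mul' _ _ ENNReal.ofReal_ne_top, lintegral_add_left measurable_const,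
    lintegral_const, measure_univ, mul_one, lintegral_tsum fun i => (hmeas i).aemeasurable]
  have hσ : ∑' i, ∫⁻ ω, ENNReal.ofReal ((empCoeff (fun k => Y k ω) i - coef ρ i) ^ 2 - q i) ∂P ≤
      ENNReal.ofReal (σ / n) := by
    refine (ENNReal.tsum_le_tsum fun i => lintegral_empCoeff_sub_coef_sq_sub_le hρ hH hE hn hY
      hindep hlaw i (hw i).le).trans ?_
    rw [← ENNReal.ofReal_tsum_of_nonneg (fun i => by positivity) (hws.div_const _),
      tsum_div_const]
    refine ENNReal.ofReal_le_ofReal ?_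
    gcongr
  have hσ0 : 0 ≤ σ := (tsum_nonneg fun i => (Real.exp_pos _).le).trans hwσ
  have hs0 : 0 ≤ ∑ i ∈ squareModel N, q i := Finset.sum_nonneg fun i _ => hq0 i
  rw [ENNReal.ofReal_mul hK0.le, ENNReal.ofReal_add (by positivity) (by positivity),
    ENNReal.ofReal_add (by positivity) hs0]
  gcongr

/-! ### The rate -/

theorem exists_sum_penalty_le (A : ℝ) : ∃ C : ℝ, 0 < C ∧ ∀ w : ℕ × ℕ → ℝ,
    (∀ j k : ℕ, w (j, k) ≤ A * Real.log (j + k + 2)) → (∀ i, 0 < w i) → ∀ N n : ℕ, 1 ≤ N → 0 < n →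
      ∑ i ∈ squareModel N, (Real.log (osc i) + w i / 2) * (osc i ^ 2 / n) ≤
        C * (1 + Real.log N) * ((N : ℝ) ^ (7 / 3 : ℝ) / n) := by
  obtain ⟨C₁, hC₁, h₁⟩ := osc_sq_le
  obtain ⟨C₂, hC₂, h₂⟩ := sum_patternBound_le
  set D := C₁ * C₂ with hD
  have hD0 : 0 < D := by positivity
  refine ⟨(|Real.log D| + 2 + |A|) * D, by positivity, fun w hwA hw N n hN hn => ?_⟩
  have hn' : (0 : ℝ) < n := by exact_mod_cast hn
  have hN1 : (1 : ℝ) ≤ N := by exact_mod_cast hN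
  have hN' : (0 : ℝ) < N := by linarith
  have hlogN := Real.log_nonneg hN1
  have hsum : ∑ i ∈ squareModel N, osc i ^ 2 ≤ D * (N : ℝ) ^ (7 / 3 : ℝ) := by
    refine (Finset.sum_le_sum fun i _ => h₁ i).trans ?_
    rw [← Finset.mul_sum, squareModel, Finset.sum_product, hD, mul_assoc]
    gcongr
    exact h₂ N
  have hbr : ∀ i ∈ squareModel N, Real.log (osc i) + w i / 2 ≤
      (|Real.log D| + 2 + |A|) * (1 + Real.log N) := fun i hi => by
    have hM := one_le_osc i
    have e1 : osc i ^ 2 ≤ D * (N : ℝ) ^ (7 / 3 : ℝ) :=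
      (Finset.single_le_sum (f := fun i => osc i ^ 2) (fun i _ => sq_nonneg _) hi).trans hsum
    have e2 := Real.log_le_log (by positivity) e1
    rw [Real.log_pow, Real.log_mul hD0.ne' (by positivity), Real.log_rpow hN'] at e2
    push_cast at e2
    have e3 := le_abs_self (Real.log D)
    have e3' := abs_nonneg (Real.log D)
    rw [squareModel, Finset.mem_product, Finset.mem_range, Finset.mem_range] at hi
    have e4 : ((i.1 : ℝ) + i.2 + 2) ≤ 2 * N := by
      have : i.1 + i.2 + 2 ≤ 2 * N := by omega
      exact_mod_cast this
    have e5 := Real.log_le_log (by positivity) e4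
    rw [Real.log_mul two_ne_zero hN'.ne'] at e5
    have e6 : Real.log 2 ≤ 1 := by linarith [Real.log_two_lt_d9]
    have e7 : 0 ≤ Real.log ((i.1 : ℝ) + i.2 + 2) :=
      Real.log_nonneg (by linarith [(Nat.cast_nonneg i.1 : (0 : ℝ) ≤ i.1),
        (Nat.cast_nonneg i.2 : (0 : ℝ) ≤ i.2)])
    have e8 : w i ≤ |A| * (1 + Real.log N) := (hwA i.1 i.2).trans
      (mul_le_mul (le_abs_self A) (by linarith) e7 (abs_nonneg A))
    have e9 : 0 ≤ |A| * (1 + Real.log N) := by positivity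
    have e10 : 0 ≤ |Real.log D| * Real.log N := by positivity
    linarith
  calc ∑ i ∈ squareModel N, (Real.log (osc i) + w i / 2) * (osc i ^ 2 / n)
      ≤ ∑ i ∈ squareModel N, (|Real.log D| + 2 + |A|) * (1 + Real.log N) * (osc i ^ 2 / n) :=
        Finset.sum_le_sum fun i hi => by
          gcongr
          exact hbr i hi
    _ = (|Real.log D| + 2 + |A|) * (1 + Real.log N) * ((∑ i ∈ squareModel N, osc i ^ 2) / n) := by
        rw [← Finset.mul_sum, Finset.sum_div]
    _ ≤ (|Real.log D| + 2 + |A|) * (1 + Real.log N) * (D * (N : ℝ) ^ (7 / 3 : ℝ) / n) := by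
        gcongr
    _ = _ := by ring

/-- The choice `N = ⌈(H n)^{3/10}⌉` balances the bias `H / N` and the penalty `N^{7/3} / n`. -/
theorem exists_balanced_size {H : ℝ} {n : ℕ} (hH : 1 ≤ H) (hn : 1 ≤ n) : ∃ N : ℕ, 1 ≤ N ∧
    H / N ≤ H ^ (7 / 10 : ℝ) * (n : ℝ) ^ (-(3 / 10) : ℝ) ∧
    (N : ℝ) ^ (7 / 3 : ℝ) / n ≤ 8 * (H ^ (7 / 10 : ℝ) * (n : ℝ) ^ (-(3 / 10) : ℝ)) ∧
    Real.log N ≤ 1 + Real.log H + Real.log n := by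
  have hn1 : (1 : ℝ) ≤ n := by exact_mod_cast hn
  have hn' : (0 : ℝ) < n := by linarith
  have hH' : 0 < H := by linarith
  have hHn : 1 ≤ H * n := one_le_mul_of_one_le_of_one_le hH hn1
  set x := (H * n) ^ (3 / 10 : ℝ) with hx
  have hx1 : 1 ≤ x := Real.one_le_rpow hHn (by norm_num)
  have hx0 : 0 < x := by linarith
  have hle := Nat.le_ceil x
  have hlt := Nat.ceil_lt_add_one hx0.le
  have hN0 : (0 : ℝ) < (⌈x⌉₊ : ℝ) := by linarith
  have hN2 : (⌈x⌉₊ : ℝ) ≤ 2 * x := by linarith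
  refine ⟨⌈x⌉₊, Nat.one_le_ceil_iff.2 hx0, ?_, ?_, ?_⟩
  · calc H / (⌈x⌉₊ : ℝ) ≤ H / x := by gcongr
      _ = _ := by
        rw [hx, Real.mul_rpow hH'.le hn'.le, Real.rpow_neg hn'.le, div_eq_mul_inv, mul_inv,
          ← mul_assoc]
        congr 1
        rw [← Real.rpow_neg hH'.le]
        nth_rewrite 1 [← Real.rpow_one H]
        rw [← Real.rpow_add hH']
        norm_num
  · have h1 : (⌈x⌉₊ : ℝ) ^ (7 / 3 : ℝ) ≤ 8 * (H * n) ^ (7 / 10 : ℝ) := by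
      refine (Real.rpow_le_rpow hN0.le hN2 (by norm_num)).trans ?_
      rw [Real.mul_rpow two_pos.le hx0.le, hx, ← Real.rpow_mul (by positivity)]
      have h2 : (2 : ℝ) ^ (7 / 3 : ℝ) ≤ 8 := by
        calc (2 : ℝ) ^ (7 / 3 : ℝ) ≤ 2 ^ (3 : ℝ) :=
              Real.rpow_le_rpow_of_exponent_le (by norm_num) (by norm_num)
          _ = 8 := by norm_num
      norm_num at h2 ⊢
      gcongr
    calc (⌈x⌉₊ : ℝ) ^ (7 / 3 : ℝ) / n ≤ 8 * (H * n) ^ (7 / 10 : ℝ) / n := by gcongr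
      _ = _ := by
        rw [Real.mul_rpow hH'.le hn'.le]
        have h3 : (n : ℝ) ^ (7 / 10 : ℝ) = (n : ℝ) ^ (-(3 / 10) : ℝ) * n := by
          nth_rewrite 3 [← Real.rpow_one (n : ℝ)]
          rw [← Real.rpow_add hn']
          norm_num
        rw [h3]
        field_simp
  · have h1 := Real.log_le_log hN0 hN2
    rw [Real.log_mul two_ne_zero hx0.ne', hx, Real.log_rpow (by positivity),
      Real.log_mul hH'.ne' hn'.ne'] at h1
    have h2 := Real.log_nonneg hH
    have h3 := Real.log_nonneg hn1
    have h4 := Real.log_two_lt_d9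
    linarith

theorem exists_lintegral_risk_le {ε : ℝ} (σ A : ℝ) {h₀ : ℝ} (hε : 0 < ε) (hh₀ : 1 < h₀) :
    ∃ C : ℝ, 0 < C ∧
      ∀ w : ℕ × ℕ → ℝ, (∀ i, 0 < w i) →
        Summable (fun i => Real.exp (-w i)) → ∑' i, Real.exp (-w i) ≤ σ →
        (∀ j k : ℕ, w (j, k) ≤ A * Real.log (j + k + 2)) →
      ∀ models : Set (Finset (ℕ × ℕ)), (∀ N : ℕ, 1 ≤ N → squareModel N ∈ models) →
      ∀ n : ℕ, 2 ≤ n →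
      ∀ mhat : (Fin n → ℝ × ℝ) → Finset (ℕ × ℕ), IsPenalizedSelector ε w models n mhat →
      ∀ (H : ℝ) (ρ : L2R →L[ℂ] L2R), h₀ ≤ H →
        IsDensityOperator ρ → energy ρ ≤ ENNReal.ofReal (H + 1 / 2) →
      ∀ (Ω : Type*) [MeasurableSpace Ω] (P : Measure Ω) [IsProbabilityMeasure P]
        (Y : Fin n → Ω → ℝ × ℝ), (∀ k, Measurable (Y k)) → iIndepFun Y P →
        (∀ k, P.map (Y k) = law ρ) →
        ∫⁻ ω, hsSq (projEst (fun k => Y k ω) (mhat (fun k => Y k ω)) - ρ) ∂P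
          ≤ ENNReal.ofReal
              (C * H ^ (7 / 10 : ℝ) * Real.log H * (n : ℝ) ^ (-(3 / 10) : ℝ) * Real.log n) := by
  obtain ⟨C₁, hC₁, h₁⟩ := exists_sum_penalty_le A
  have ha := Real.log_pos hh₀
  set a := Real.log h₀ with ha_def
  set K := (min ε 1 / 2)⁻¹ * (3 + 2 / ε + 2 * ε) with hK
  have hK0 : 0 < K := by positivity
  refine ⟨K * (2 + 8 * C₁ + |σ|) * (2 + 5 / a), by positivity, ?_⟩
  intro w hw hws hwσ hwA models hmod n hn mhat hsel H ρ hH hρ hE Ω _ P _ Y hY hindep hlaw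
  have hH1 : 1 ≤ H := by linarith
  have hn1 : (1 : ℝ) ≤ n := by exact_mod_cast (by omega : 1 ≤ n)
  obtain ⟨N, hN, b1, b2, b3⟩ := exists_balanced_size (n := n) hH1 (by omega)
  refine (lintegral_risk_le hε hw hws hwσ (by omega) hsel hρ (by linarith) hE hY hindep hlaw hN
    (hmod N hN)).trans (ENNReal.ofReal_le_ofReal ?_)
  set R := H ^ (7 / 10 : ℝ) * (n : ℝ) ^ (-(3 / 10) : ℝ) with hR
  have hR0 : 0 < R := by positivity
  have hlH : a ≤ Real.log H := Real.log_le_log (by linarith) hH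
  have hln : 1 / 2 ≤ Real.log n := by
    have := Real.log_le_log two_pos (show (2 : ℝ) ≤ n by exact_mod_cast hn)
    linarith [Real.log_two_gt_d9]
  have hlH0 : 0 < Real.log H := by linarith
  set T := 2 + Real.log H + Real.log n with hT
  have hT1 : 1 ≤ T := by linarith
  -- both logarithms are bounded below, hence each is dominated by their product
  have hT2 : T ≤ (2 + 5 / a) * (Real.log H * Real.log n) := by
    have e1 : Real.log H ≤ 2 * (Real.log H * Real.log n) := by nlinarith
    have e2 : Real.log n ≤ 1 / a * (Real.log H * Real.log n) := by
      rw [div_mul_eq_mul_div, one_mul, le_div_iff₀ ha]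
      nlinarith
    have e3 : (2 + 5 / a) * (Real.log H * Real.log n) = 2 * (Real.log H * Real.log n) +
        5 * (1 / a * (Real.log H * Real.log n)) := by ring
    linarith
  have b4 : σ / n ≤ |σ| * R := by
    have e1 : (n : ℝ)⁻¹ ≤ (n : ℝ) ^ (-(3 / 10) : ℝ) := by
      rw [← Real.rpow_neg_one]
      exact Real.rpow_le_rpow_of_exponent_le hn1 (by norm_num)
    have e2 : 1 ≤ H ^ (7 / 10 : ℝ) := Real.one_le_rpow hH1 (by norm_num)
    have e3 : (n : ℝ)⁻¹ ≤ R := e1.trans (le_mul_of_one_le_left (by positivity) e2)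
    rw [div_eq_mul_inv]
    exact mul_le_mul (le_abs_self σ) e3 (by positivity) (abs_nonneg σ)
  have b5 := h₁ w hwA hw N n hN (by omega)
  have b6 : C₁ * (1 + Real.log N) * ((N : ℝ) ^ (7 / 3 : ℝ) / n) ≤ C₁ * T * (8 * R) := by
    gcongr
    linarith
  have b7 : 2 * H / N ≤ 2 * R := by
    rw [mul_div_assoc]
    linarith
  have b8 : (2 + |σ|) * R ≤ (2 + |σ|) * R * T := le_mul_of_one_le_right (by positivity) hT1
  calc K * (2 * H / N + ∑ i ∈ squareModel N, (Real.log (osc i) + w i / 2) * (osc i ^ 2 / n) +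
        σ / n)
      ≤ K * ((2 + 8 * C₁ + |σ|) * R * T) := by
        gcongr
        linarith
    _ ≤ K * ((2 + 8 * C₁ + |σ|) * R * ((2 + 5 / a) * (Real.log H * Real.log n))) := by gcongr
    _ = _ := by rw [hR]; ring

end Homodyne

theorem mainTheorem4 :
    -- growth of the pattern functions
    (∃ C : ℝ, 0 < C ∧ ∀ N : ℕ, 1 ≤ N →
      ∑ j ∈ Finset.range (N + 1), ∑ k ∈ Finset.range (N + 1),
        (⨆ x : ℝ, ENNReal.ofReal |Homodyne.pattern j k x|) ^ 2
          ≤ ENNReal.ofReal (C * (N : ℝ) ^ (7 / 3 : ℝ))) ∧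
    -- bias of the square models
    (∀ (ρ : Homodyne.L2R →L[ℂ] Homodyne.L2R) (H : ℝ) (N : ℕ),
      Homodyne.IsDensityOperator ρ → 0 ≤ H →
      Homodyne.energy ρ ≤ ENNReal.ofReal (H + 1 / 2) → 1 ≤ N →
      Homodyne.biasSq ρ (Homodyne.squareModel N) ≤ ENNReal.ofReal (2 * H / N)) ∧
    -- non-asymptotic worst-case risk of the penalized estimator
    (∀ ε σ A h₀ : ℝ, 0 < ε → 1 < h₀ →
      ∃ C : ℝ, 0 < C ∧
        ∀ w : ℕ × ℕ → ℝ, (∀ i, 0 < w i) →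
          Summable (fun i => Real.exp (-w i)) → ∑' i, Real.exp (-w i) ≤ σ →
          (∀ j k : ℕ, w (j, k) ≤ A * Real.log (j + k + 2)) →
        ∀ models : Set (Finset (ℕ × ℕ)), (∀ N : ℕ, 1 ≤ N → Homodyne.squareModel N ∈ models) →
        ∀ n : ℕ, 2 ≤ n →
        ∀ mhat : (Fin n → ℝ × ℝ) → Finset (ℕ × ℕ),
          Homodyne.IsPenalizedSelector ε w models n mhat →
        ∀ (H : ℝ) (ρ : Homodyne.L2R →L[ℂ] Homodyne.L2R), h₀ ≤ H →
          Homodyne.IsDensityOperator ρ → Homodyne.energy ρ ≤ ENNReal.ofReal (H + 1 / 2) →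
        ∀ (Ω : Type*) [MeasurableSpace Ω] (P : Measure Ω) [IsProbabilityMeasure P]
          (Y : Fin n → Ω → ℝ × ℝ), (∀ k, Measurable (Y k)) → iIndepFun Y P →
          (∀ k, P.map (Y k) = Homodyne.law ρ) →
          ∫⁻ ω, Homodyne.hsSq
              (Homodyne.projEst (fun k => Y k ω) (mhat (fun k => Y k ω)) - ρ) ∂P
            ≤ ENNReal.ofReal
                (C * H ^ (7 / 10 : ℝ) * Real.log H * (n : ℝ) ^ (-(3 / 10) : ℝ) * Real.log n)) := by
  exact ⟨Homodyne.exists_sum_iSup_pattern_le,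
    fun ρ H N hρ hH hE hN => Homodyne.biasSq_squareModel_le hρ hH hE hN,
    fun ε σ A h₀ hε hh₀ => Homodyne.exists_lintegral_risk_le σ A hε hh₀⟩
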